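/- **Setting.** Let $\mathbb C_+$ be the open upper half-plane, and let $\{s_+,\nu_+\}$ be scattering data: $s_+$ is a measurable function on $\mathbb R$ with $|s_+|\le 1$, $s_+(\lambda)=\overline{s_+(-\lambda)}$ a.e. and $$\int_{\mathbb R}\frac{\log(1-|s_+(\lambda)|^2)}{1+\lambda^2}\,d\lambda>-\infty ,$$ and $\nu_+=\sum_{\lambda_k\in\Lambda}\nu_+(\lambda_k)\delta_{\lambda_k}$, $\nu_+(\lambda_k)>0$, is a (not necessarily finite) discrete measure whose support $\Lambda\subset i(0,\infty)$ satisfies $\sum_{\lambda_k/i\le1}\lambda_k/i<\infty$ and $\sum_{\lambda_k/i>1}i/\lambda_k<\infty$. $L^2_{\{s_+,\nu_+\}}$ is the Hilbert space of functions $f$ on $\mathbb R\cup\Lambda$, measurable on $\mathbb R$ and identified when they agree on $\Lambda$ and a.e. on $\mathbb R$, with finite norm $$\|f\|^2_{\{s_+,\nu_+\}}=\sum_{\lambda_k\in\Lambda}|f(\lambda_k)|^2\nu_+(\lambda_k)+\frac1{4\pi}\int_{\mathbb R}\begin{bmatrix}\overline{f(\lambda)}&\overline{-f(-\lambda)}\end{bmatrix}\begin{bmatrix}1&\overline{s_+(\lambda)}\\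 s_+(\lambda)&1\end{bmatrix}\begin{bmatrix}f(\lambda)\\-f(-\lambda)\end{bmatrix}d\lambda .$$ Let $s_e$ be the outer function in $\mathbb C_+$ with $|s_e|^2+|s_+|^2=1$ a.e. on $\mathbb R$, and let $H^2,H^\infty$ be the standard Hardy spaces of $\mathbb C_+$. For $w\in\Lambda$ put $b_w(\lambda)=\frac{\lambda-w}{\lambda-\bar w}$ if $w/i\le1$ and $b_w(\lambda)=-\frac{\lambda-w}{\lambda-\bar w}$ if $w/i>1$. * $H^2_{\{s_+,\nu_+\}}$ is the closure in $L^2_{\{s_+,\nu_+\}}$ of the functions $f=B'g$ on $\mathbb R\cup\Lambda$, where $g\in H^\infty\cap H^2$ and $B'=\prod_{w\in\Lambda\setminus E}b_w$ with $E\subset\Lambda$ finite. * $\hat H^2_{\{s_+,\nu_+\}}$ is the set of $f\in L^2_{\{s_+,\nu_+\}}$ such that $g=s_ef$ on $\mathbb R$ is the boundary function of a function $g\in H^2$, and $f(\lambda_k)=(g/s_e)(\lambda_k)$ for all $\lambda_k\in\Lambda$. Elements $f$ of both spaces have an analytic continuation $F$ from $\mathbb R$ to $\mathbb C_+$ with $s_eF\in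 H^2$, and $f(\lambda_0)$ means $F(\lambda_0)$ for $\lambda_0\in\mathbb C_+$. The reproducing kernels $k_{\{s_+,\nu_+\}}(\cdot,\lambda_0)\in H^2_{\{s_+,\nu_+\}}$ and $\hat k_{\{s_+,\nu_+\}}(\cdot,\lambda_0)\in\hat H^2_{\{s_+,\nu_+\}}$ are the elements whose scalar product with every $f$ in the respective space gives $f(\lambda_0)$. For $x\in\mathbb R$, $\{s_+e^{2i\lambda x},\nu_+e^{2i\lambda x}\}$ are the scattering data with function $s_+(\lambda)e^{2i\lambda x}$ on $\mathbb R$ and masses $\nu_+(\lambda_k)e^{2i\lambda_kx}$ on $\Lambda$. Finally let $\tilde k(\lambda,\lambda_0)=\frac{i}{\lambda-\bar\lambda_0}$ for $\lambda\in\mathbb R$ and $\tilde k(\lambda,\lambda_0)=0$ for $\lambda\in\Lambda$. **Theorem 1.3.** For every $\lambda_0\in\mathbb C_+$, the kernels $k_{\{s_+e^{2i\lambda x},\nu_+e^{2i\lambda x}\}}(\cdot,\lambda_0)$ and $\hat k_{\{s_+e^{2i\lambda x},\nu_+e^{2i\lambda x}\}}(\cdot,\lambda_0)$ exist for all $x\in\mathbb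 R$, and $$\lim_{x\to+\infty}\big\|e^{i\lambda x}k_{\{s_+e^{2i\lambda x},\nu_+e^{2i\lambda x}\}}(\cdot,\lambda_0)-e^{i\lambda x}\tilde k(\cdot,\lambda_0)\big\|_{\{s_+,\nu_+\}}=0,$$ $$\lim_{x\to+\infty}\big\|e^{i\lambda x}\hat k_{\{s_+e^{2i\lambda x},\nu_+e^{2i\lambda x}\}}(\cdot,\lambda_0)-e^{i\lambda x}\tilde k(\cdot,\lambda_0)\big\|_{\{s_+,\nu_+\}}=0.$$ -/

import Mathlib

open Filter Topology MeasureTheory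
open scoped ENNReal ComplexConjugate Matrix

noncomputable section

/-- The open upper half-plane, as a set of complex numbers. -/
def upperHalf : Set ℂ := {z | 0 < z.im}

/-- `F` has the boundary function `f` on the real line: `F (t + iy) → f t` as `y → 0+`, for almost
every real `t`. -/
def HasBoundaryValues (F : ℂ → ℂ) (f : ℝ → ℂ) : Prop :=
  ∀ᵐ t : ℝ, Tendsto (fun y : ℝ => F (t + y * Complex.I)) (𝓝[>] 0) (𝓝 (f t))

/-- The standard Hardy space `H²` of the upper half-plane. -/
def IsHardyTwo (G : ℂ → ℂ) : Prop :=
  DifferentiableOn ℂ G upperHalf ∧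
    ∃ C : ℝ, ∀ y : ℝ, 0 < y →
      ∫⁻ t : ℝ, ENNReal.ofReal (‖G (t + y * Complex.I)‖ ^ 2) ≤ ENNReal.ofReal C

/-- The standard Hardy space `H^∞` of the upper half-plane. -/
def IsHardyInfty (G : ℂ → ℂ) : Prop :=
  DifferentiableOn ℂ G upperHalf ∧ ∃ C : ℝ, ∀ z ∈ upperHalf, ‖G z‖ ≤ C

/-- Scattering data `{s₊, ν₊}`, where `Λ` is the support of the discrete measure
`ν₊ = ∑_{w ∈ Λ} ν₊(w) δ_w`.  The measure need not be finite, and `Λ` may be empty, finite or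
infinite (it is countable by the Blaschke condition). -/
structure ScatteringData (Λ : Set ℂ) where
  /-- the function `s₊` on the real line -/
  s : ℝ → ℂ
  /-- the masses of `ν₊` -/
  ν : Λ → ℝ
  aemeasurable_s : AEMeasurable s
  /-- the symmetry `s₊(t) = conj (s₊(-t))` -/
  symm_s : ∀ᵐ t : ℝ, s t = conj (s (-t))
  /-- `s₊` is contractive; the bound is strict almost everywhere because the integral in the Szegő
  condition is to be finite, with `log 0 = -∞`. -/
  norm_s_lt_one : ∀ᵐ t : ℝ, ‖s t‖ < 1
  /-- the Szegő condition; the integrand is nonpositive, so that its integral is `> -∞` exactly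
  when it is integrable. -/
  szego : Integrable fun t : ℝ => Real.log (1 - ‖s t‖ ^ 2) / (1 + t ^ 2)
  /-- `Λ` lies on the positive imaginary half-axis -/
  re_eq_zero : ∀ w ∈ Λ, w.re = 0
  im_pos : ∀ w ∈ Λ, 0 < w.im
  /-- the two halves of the Blaschke condition -/
  blaschke_small : Summable fun w : {w : Λ // (w : ℂ).im ≤ 1} => ((w : Λ) : ℂ).im
  blaschke_large : Summable fun w : {w : Λ // 1 < (w : ℂ).im} => (((w : Λ) : ℂ).im)⁻¹
  ν_pos : ∀ w, 0 < ν w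

/-- The points of the disjoint union `ℝ ∪ Λ`, as complex numbers. A function on `ℝ ∪ Λ` is a function
`ℝ ⊕ Λ → ℂ`. -/
def toPoint {Λ : Set ℂ} : ℝ ⊕ Λ → ℂ := Sum.elim (fun t : ℝ => (t : ℂ)) (fun w : Λ => (w : ℂ))

/-- Multiplication of a function on `ℝ ∪ Λ` by `e^{iλx}`. -/
def expMul {Λ : Set ℂ} (x : ℝ) (f : ℝ ⊕ Λ → ℂ) : ℝ ⊕ Λ → ℂ :=
  fun p => Complex.exp (Complex.I * toPoint p * x) * f p

/-- The kernel `k(λ, z₀) = i / (λ - conj z₀)` of the standard `H²` on the real line, extended by zero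
to `Λ`. -/
def kTilde (Λ : Set ℂ) (z₀ : ℂ) : ℝ ⊕ Λ → ℂ :=
  Sum.elim (fun t : ℝ => Complex.I / ((t : ℂ) - conj z₀)) (fun _ => 0)

/-- The elementary Blaschke factor with zero `w`. -/
def blaschkeFactor (w z : ℂ) : ℂ :=
  if w.im ≤ 1 then (z - w) / (z - conj w) else -((z - w) / (z - conj w))

/-- The Blaschke product over all points of `Λ` outside the finite set `E`. -/
def blaschkeProd (Λ : Set ℂ) (E : Finset Λ) (z : ℂ) : ℂ :=
  ∏' w : {w : Λ // w ∉ E}, blaschkeFactor ((w : Λ) : ℂ) z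

namespace ScatteringData

variable {Λ : Set ℂ}

/-- The data `{s₊ e^{2iλx}, ν₊ e^{2iλx}}`; at a point `w = iκ` of `Λ` the exponential is
`e^{-2κx}`. -/
def twist (D : ScatteringData Λ) (x : ℝ) : ScatteringData Λ where
  s := fun t => D.s t * Complex.exp (2 * Complex.I * t * x)
  ν := fun w => D.ν w * Real.exp (-2 * (w : ℂ).im * x)
  aemeasurable_s := D.aemeasurable_s.mul (by fun_prop)
  symm_s := by
    filter_upwards [D.symm_s] with t ht
    rw [map_mul, ← ht, ← Complex.exp_conj]
    simp [Complex.conj_ofNat]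
  norm_s_lt_one := by
    filter_upwards [D.norm_s_lt_one] with t ht
    have h : (2 * Complex.I * t * x : ℂ) = ((2 * t * x : ℝ) : ℂ) * Complex.I := by
      push_cast; ring
    rw [norm_mul, h, Complex.norm_exp_ofReal_mul_I, mul_one]
    exact ht
  szego := by
    refine D.szego.congr (Eventually.of_forall fun t => ?_)
    have h : (2 * Complex.I * t * x : ℂ) = ((2 * t * x : ℝ) : ℂ) * Complex.I := by
      push_cast; ring
    simp only [norm_mul, h, Complex.norm_exp_ofReal_mul_I, mul_one]
  re_eq_zero := D.re_eq_zero
  im_pos := D.im_pos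
  blaschke_small := D.blaschke_small
  blaschke_large := D.blaschke_large
  ν_pos := fun w => mul_pos (D.ν_pos w) (Real.exp_pos _)

/-- The integrand of the scalar product: `[conj h(t), conj(-h(-t))] [1, conj s₊(t); s₊(t), 1]
[f(t); -f(-t)]`. -/
def form (D : ScatteringData Λ) (f h : ℝ ⊕ Λ → ℂ) (t : ℝ) : ℂ :=
  star ![h (Sum.inl t), -h (Sum.inl (-t))] ⬝ᵥ
    (!![1, conj (D.s t); D.s t, 1] *ᵥ ![f (Sum.inl t), -f (Sum.inl (-t))])

/-- The squared norm of `L²_{s₊,ν₊}`, possibly infinite. -/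
def normSq (D : ScatteringData Λ) (f : ℝ ⊕ Λ → ℂ) : ℝ≥0∞ :=
  (∑' w : Λ, ENNReal.ofReal (‖f (Sum.inr w)‖ ^ 2 * D.ν w)) +
    ENNReal.ofReal (1 / (4 * Real.pi)) * ∫⁻ t : ℝ, ENNReal.ofReal (D.form f f t).re

/-- The norm of `L²_{s₊,ν₊}`. -/
def norm (D : ScatteringData Λ) (f : ℝ ⊕ Λ → ℂ) : ℝ≥0∞ := D.normSq f ^ (1 / 2 : ℝ)

/-- The space `L²_{s₊,ν₊}`; functions that agree on `Λ` and almost everywhere on the real line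
represent the same element. -/
def L2 (D : ScatteringData Λ) : Set (ℝ ⊕ Λ → ℂ) :=
  {f | AEMeasurable (fun t : ℝ => f (Sum.inl t)) ∧ D.normSq f < ⊤}

/-- The scalar product of `L²_{s₊,ν₊}`, linear in the first argument; sum and integral converge
absolutely on `L²_{s₊,ν₊}`. -/
def inner (D : ScatteringData Λ) (f h : ℝ ⊕ Λ → ℂ) : ℂ :=
  (∑' w : Λ, f (Sum.inr w) * conj (h (Sum.inr w)) * (D.ν w : ℂ)) +
    (1 / (4 * Real.pi) : ℂ) * ∫ t : ℝ, D.form f h t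

/-- The outer function `s_e` in the upper half-plane with `|s_e|² + |s₊|² = 1` a.e. on the real line
(normalized to be positive on the imaginary half-axis), as the exponential of the Schwarz integral of
`log |s_e| = (1/2) log (1 - |s₊|²)`; here `(1 + tz) / ((t - z)(1 + t²)) = 1/(t - z) - t/(1 + t²)`. -/
def outer (D : ScatteringData Λ) (z : ℂ) : ℂ :=
  Complex.exp ((1 / (Real.pi * Complex.I)) *
    ∫ t : ℝ, (1 + t * z) / ((t - z) * (1 + t ^ 2)) * ((1 / 2 * Real.log (1 - ‖D.s t‖ ^ 2) : ℝ) : ℂ))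

/-- `F` is the analytic continuation of `f`, given on the real line, to the upper half-plane, with
`s_e F` in the standard `H²`. (As `s_e` has no zeros and its boundary values are nonzero a.e., this
says that `s_e f` on the real line is the boundary function of `g = s_e F ∈ H²`, and `F = g / s_e`.) -/
def IsContinuation (D : ScatteringData Λ) (f : ℝ ⊕ Λ → ℂ) (F : ℂ → ℂ) : Prop :=
  DifferentiableOn ℂ F upperHalf ∧ IsHardyTwo (fun z => D.outer z * F z) ∧
    HasBoundaryValues F (fun t => f (Sum.inl t))

/-- The functions `B' g` on `ℝ ∪ Λ`, where `g ∈ H^∞ ∩ H²` and `B'` is a divisor of the Blaschke product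
with zero set `Λ` such that the quotient is a finite Blaschke product. -/
def generators (Λ : Set ℂ) : Set (ℝ ⊕ Λ → ℂ) :=
  {f | ∃ (E : Finset Λ) (g : ℂ → ℂ), IsHardyInfty g ∧ IsHardyTwo g ∧
    HasBoundaryValues (fun z => blaschkeProd Λ E z * g z) (fun t => f (Sum.inl t)) ∧
    ∀ w : Λ, f (Sum.inr w) = blaschkeProd Λ E w * g w}

/-- The Hardy space `H²_{s₊,ν₊}`: the closure in `L²_{s₊,ν₊}` of the generators. -/
def H2 (D : ScatteringData Λ) : Set (ℝ ⊕ Λ → ℂ) :=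
  {f | f ∈ D.L2 ∧ ∀ ε : ℝ≥0∞, 0 < ε → ∃ h ∈ generators Λ, h ∈ D.L2 ∧ D.norm (f - h) < ε}

/-- The Hardy space `Ĥ²_{s₊,ν₊}`: those `f` in `L²_{s₊,ν₊}` with `s_e f` in the standard `H²` whose
values on `Λ` are those of the analytic continuation. -/
def H2hat (D : ScatteringData Λ) : Set (ℝ ⊕ Λ → ℂ) :=
  {f | f ∈ D.L2 ∧ ∃ F : ℂ → ℂ, D.IsContinuation f F ∧ ∀ w : Λ, f (Sum.inr w) = F w}

/-- `k` is the reproducing kernel at `z₀` of the space `M` of functions in `L²_{s₊,ν₊}`: `k ∈ M` and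
`f(z₀) = ⟨f, k⟩` for all `f ∈ M`, where `f(z₀)` is the value of the analytic continuation. -/
def IsReproducingKernel (D : ScatteringData Λ) (M : Set (ℝ ⊕ Λ → ℂ)) (z₀ : ℂ)
    (k : ℝ ⊕ Λ → ℂ) : Prop :=
  k ∈ M ∧ ∀ f ∈ M, ∃ F : ℂ → ℂ, D.IsContinuation f F ∧ F z₀ = D.inner f k

end ScatteringData

end

/-! Multiplication by e^{iλx} is an isometry from the space with twisted data onto the original one
(`norm_expMul`), so the claim is that ‖k_x − k̃‖ → 0 in the norm of the twisted data, where k_x is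
either reproducing kernel at z₀. With K = 1/(2 Im z₀), expand ‖k_x − k̃‖² = ‖k_x‖² − 2 Re⟨k_x, k̃⟩ +
‖k̃‖². Three facts then suffice.

(a) ‖k̃‖² → K. The only x-dependent term is an integral containing s₊e^{2itx}, which vanishes in the
limit by Riemann–Lebesgue (`tendsto_norm_sq_twist`).

(b) k̃ reproduces the value at z₀ up to o(1)‖f‖, uniformly over f with an analytic continuation
(`eventually_norm_inner_kTilde_sub_le`). Since ‖k_x‖² = k_x(z₀) and ‖k_x‖ is bounded uniformly in x,
this gives ⟨k_x, k̃⟩ = ‖k_x‖² + o(1).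

(c) liminf ‖k_x‖² ≥ K (`eventually_le_norm_sq_kernel`). Test k_x by Cauchy–Schwarz against B'k̃: its
value at z₀ is close to K when B' omits enough zeros, and the limit of its squared norm is at most
K.

Hence ‖k_x − k̃‖² = ‖k̃‖² − ‖k_x‖² + o(1) has limsup at most K − K = 0. Both kernels are treated at
once, because only the inclusions generators ⊆ M ⊆ L² are used of the space M.

The delicate point is (b), since f itself need not be square-integrable on the line; only s_e f and
s₊f − f(−·) are. So k̃ is replaced by conj(s_e ω) k̃, where ω is the boundary function of a bounded
analytic b with |s_e ω| ≤ 1 and s_e b(z₀) close to 1. The error is small in the Poisson measure of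
z₀, uniformly in x. The scalar product with the new function is s_e b F(z₀), by Cauchy's formula,
minus a multiple of ∫ χ e^{2itx} s_e f with a fixed χ ∈ L². Such functionals on H² tend to zero in
norm (`eventually_norm_integral_mul_exp_le`): for Cauchy kernels χ this is Cauchy's formula, and
these span a dense subspace.

Existence of the kernels comes from the isometry f ↦ (4π)^{-1/2} (s_e f, s₊f − f(−·)) together with
√ν₊ f on Λ, into an honest Hilbert space. The image of Ĥ² is cut out by bounded functionals, hence
closed; the image of H² is the closure of the generators inside it; evaluation at z₀ is bounded by
Cauchy's formula, and the kernel is the projection of its representing vector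
(`exists_kernel_of_closed`). -/

noncomputable section

/-! ### Poisson integrals and Fatou's theorem. -/

/-- The Poisson kernel of the upper half-plane at the point `x + iy`. -/
def halfPlanePoisson (x y t : ℝ) : ℝ := Real.pi⁻¹ * y * ((t - x) ^ 2 + y ^ 2)⁻¹

lemma halfPlanePoisson_nonneg (x : ℝ) {y : ℝ} (hy : 0 < y) (t : ℝ) :
    0 ≤ halfPlanePoisson x y t := by
  unfold halfPlanePoisson; positivity

lemma continuous_halfPlanePoisson (x : ℝ) {y : ℝ} (hy : 0 < y) :
    Continuous (halfPlanePoisson x y) := by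
  unfold halfPlanePoisson
  refine continuous_const.mul (Continuous.inv₀ (by fun_prop) fun t => ?_)
  positivity

lemma integral_halfPlanePoisson (x : ℝ) {y : ℝ} (hy : 0 < y) :
    ∫ t, halfPlanePoisson x y t = 1 := by
  lift y to NNReal using hy.le
  exact ProbabilityTheory.integral_cauchyPDFReal_eq_one x (by exact_mod_cast hy.ne')

lemma integrable_halfPlanePoisson (x : ℝ) {y : ℝ} (hy : 0 < y) :
    Integrable (halfPlanePoisson x y) := by
  by_contra h
  have := integral_undef h
  rw [integral_halfPlanePoisson x hy] at this
  exact one_ne_zero this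

lemma halfPlanePoisson_symm (x t : ℝ) (y : ℝ) :
    halfPlanePoisson x y t = halfPlanePoisson t y x := by
  unfold halfPlanePoisson; congr 2; ring

/-- The Poisson integral of a density that has small averages near `x` is small. -/
lemma setLIntegral_halfPlanePoisson_mul_le {x ε δ y : ℝ} {w : ℝ → ℝ≥0∞} (hw : AEMeasurable w)
    (hε : 0 ≤ ε) (hδ : 0 < δ) (hy : 0 < y)
    (h : ∀ r, 0 < r → r ≤ δ → ∫⁻ t in Metric.closedBall x r, w t ≤ ENNReal.ofReal (ε * r)) :
    ∫⁻ t in Metric.closedBall x δ, ENNReal.ofReal (halfPlanePoisson x y t) * w t ≤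
      ENNReal.ofReal (2 * ε) := by
  have hpi := Real.pi_pos
  set μ := (volume.restrict (Metric.closedBall x δ)).withDensity w with hμ
  have h1 : ∫⁻ t in Metric.closedBall x δ, ENNReal.ofReal (halfPlanePoisson x y t) * w t =
      ∫⁻ t, ENNReal.ofReal (halfPlanePoisson x y t) ∂μ := by
    rw [hμ, lintegral_withDensity_eq_lintegral_mul₀ hw.restrict
      (continuous_halfPlanePoisson x hy).measurable.ennreal_ofReal.aemeasurable]
    simp_rw [Pi.mul_apply, mul_comm]
  -- Layer-cake formula: superlevel sets of the kernel lie in intervals centred at x, and the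
  -- hypothesis bounds the mass of exactly such intervals.
  rw [h1, lintegral_eq_lintegral_meas_lt _
    (Eventually.of_forall fun t => halfPlanePoisson_nonneg x hy t)
    (continuous_halfPlanePoisson x hy).measurable.aemeasurable]
  -- The maximum of the kernel, attained at t = x; above this level the superlevel sets are empty.
  set c := (Real.pi * y)⁻¹ with hc
  have hc0 : 0 < c := by positivity
  have key : ∀ τ ∈ Set.Ioi (0 : ℝ), μ {a | τ < halfPlanePoisson x y a} ≤
      (Set.Ioc 0 c).indicator (fun τ => ENNReal.ofReal (ε * (√(y / Real.pi) * τ ^ (-(1 / 2) : ℝ)))) τ := by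
    intro τ hτ
    rw [Set.mem_Ioi] at hτ
    by_cases hτc : τ ≤ c
    · rw [Set.indicator_of_mem (by exact ⟨hτ, hτc⟩)]
      -- The kernel exceeds τ iff (a − x)² + y² < y/(πτ); r is the radius obtained by dropping y².
      set r := √(y / Real.pi) * τ ^ (-(1 / 2) : ℝ) with hr
      have hr0 : 0 < r := by positivity
      have hr2 : r ^ 2 = y / (Real.pi * τ) := by
        rw [hr, mul_pow, Real.sq_sqrt (by positivity), ← Real.rpow_natCast, ← Real.rpow_mul hτ.le]
        norm_num
        rw [Real.rpow_neg_one]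
        field_simp
      have hsub : {a | τ < halfPlanePoisson x y a} ⊆ Metric.closedBall x r := by
        intro a ha
        rw [Metric.mem_closedBall, Real.dist_eq]
        refine abs_le_of_sq_le_sq ?_ hr0.le
        rw [hr2]
        have ha' : τ < Real.pi⁻¹ * y * ((a - x) ^ 2 + y ^ 2)⁻¹ := ha
        rw [← div_eq_mul_inv, lt_div_iff₀ (by positivity), inv_mul_eq_div, lt_div_iff₀ hpi] at ha'
        rw [le_div_iff₀ (by positivity)]
        nlinarith [mul_pos (mul_pos hτ hpi) (pow_pos hy 2)]
      have hm : MeasurableSet (Metric.closedBall x r) := Metric.isClosed_closedBall.measurableSet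
      refine (measure_mono hsub).trans ?_
      rw [hμ, withDensity_apply _ hm, Measure.restrict_restrict hm]
      by_cases hrd : r ≤ δ
      · exact (lintegral_mono_set Set.inter_subset_left).trans (h r hr0 hrd)
      · refine (lintegral_mono_set Set.inter_subset_right).trans ((h δ hδ le_rfl).trans ?_)
        exact ENNReal.ofReal_le_ofReal (mul_le_mul_of_nonneg_left (le_of_not_ge hrd) hε)
    · have hempty : {a | τ < halfPlanePoisson x y a} = ∅ := by
        ext a
        simp only [Set.mem_ofPred_eq, Set.mem_empty_iff_false, iff_false, not_lt]
        refine le_trans ?_ (le_of_not_ge hτc)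
        rw [halfPlanePoisson, ← div_eq_mul_inv, hc, div_le_iff₀ (by positivity), mul_inv]
        field_simp
        nlinarith [sq_nonneg (a - x)]
      rw [hempty, measure_empty]
      exact zero_le
  refine (setLIntegral_mono' measurableSet_Ioi key).trans ?_
  rw [lintegral_indicator measurableSet_Ioc, Measure.restrict_restrict measurableSet_Ioc]
  refine (lintegral_mono_set Set.inter_subset_left).trans ?_
  have hint : IntervalIntegrable (fun τ : ℝ => ε * (√(y / Real.pi) * τ ^ (-(1 / 2) : ℝ)))
      volume 0 c :=
    ((intervalIntegral.intervalIntegrable_rpow' (by norm_num)).const_mul _).const_mul _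
  rw [intervalIntegrable_iff_integrableOn_Ioc_of_le hc0.le] at hint
  rw [← ofReal_integral_eq_lintegral_ofReal hint]
  · refine ENNReal.ofReal_le_ofReal ?_
    rw [← intervalIntegral.integral_of_le hc0.le, intervalIntegral.integral_const_mul,
      intervalIntegral.integral_const_mul, integral_rpow (Or.inl (by norm_num))]
    norm_num
    have h2 : √(y / Real.pi) * √c ≤ 1 := by
      rw [← Real.sqrt_mul (by positivity)]
      refine (Real.sqrt_le_sqrt ?_).trans_eq Real.sqrt_one
      rw [hc, mul_inv, div_eq_mul_inv]
      have : Real.pi⁻¹ ≤ 1 := inv_le_one_of_one_le₀ (by linarith [Real.pi_gt_three])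
      have h3 : y * Real.pi⁻¹ * (Real.pi⁻¹ * y⁻¹) = Real.pi⁻¹ * Real.pi⁻¹ := by field_simp
      rw [h3]
      exact mul_le_one₀ this (by positivity) this
    have h4 : ε * (√(y / Real.pi) * (√c / (1 / 2))) = 2 * ε * (√(y / Real.pi) * √c) := by ring
    rw [← Real.sqrt_eq_rpow, h4]
    exact mul_le_of_le_one_right (by positivity) h2
  · filter_upwards [ae_restrict_mem measurableSet_Ioc] with τ hτ
    have := hτ.1
    positivity

/-- Use 1 + t² ≤ 1 + 2x² + 2(t − x)² and absorb the constant by 1 ≤ (t − x)²/δ². The factor y is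
what makes the part of a Poisson integral away from x disappear as y → 0. -/
lemma halfPlanePoisson_le_of_le {x y t δ : ℝ} (hδ : 0 < δ) (hy : 0 < y) (h : δ ≤ |t - x|) :
    halfPlanePoisson x y t ≤ y * ((2 + 2 * x ^ 2) / δ ^ 2 + 2) * (1 + t ^ 2)⁻¹ := by
  have hpi : Real.pi⁻¹ ≤ 1 := inv_le_one_of_one_le₀ (by linarith [Real.pi_gt_three])
  have h2 : δ ^ 2 ≤ (t - x) ^ 2 := by
    rw [← sq_abs (t - x)]; exact pow_le_pow_left₀ hδ.le h 2
  have h3 : ((t - x) ^ 2 + y ^ 2)⁻¹ ≤ ((2 + 2 * x ^ 2) / δ ^ 2 + 2) * (1 + t ^ 2)⁻¹ := by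
    rw [inv_le_iff_one_le_mul₀ (by positivity), ← div_eq_mul_inv, div_mul_eq_mul_div,
      one_le_div (by positivity)]
    have h4 : 1 ≤ (t - x) ^ 2 / δ ^ 2 := (one_le_div (by positivity)).2 h2
    have h5 : (2 + 2 * x ^ 2) ≤ (2 + 2 * x ^ 2) / δ ^ 2 * (t - x) ^ 2 := by
      rw [div_mul_eq_mul_div, mul_div_assoc]
      nlinarith [sq_nonneg x]
    have h6 : 0 ≤ (2 + 2 * x ^ 2) / δ ^ 2 * y ^ 2 := by positivity
    nlinarith [sq_nonneg (t - 2 * x), sq_nonneg y]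
  calc halfPlanePoisson x y t ≤ 1 * y * (((2 + 2 * x ^ 2) / δ ^ 2 + 2) * (1 + t ^ 2)⁻¹) := by
        unfold halfPlanePoisson; gcongr
    _ = _ := by ring

/-- For fixed y the constant is irrelevant; the bound serves to integrate against every density that
is integrable with weight 1/(1 + t²). -/
lemma halfPlanePoisson_le (x : ℝ) {y : ℝ} (hy : 0 < y) (t : ℝ) :
    halfPlanePoisson x y t ≤ (y * (2 + 2 * x ^ 2 / y ^ 2) + (1 + 2 * x ^ 2) / y) * (1 + t ^ 2)⁻¹ := by
  have hpi : Real.pi⁻¹ ≤ 1 := inv_le_one_of_one_le₀ (by linarith [Real.pi_gt_three])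
  have h3 : ((t - x) ^ 2 + y ^ 2)⁻¹ ≤
      ((2 + 2 * x ^ 2 / y ^ 2) + (1 + 2 * x ^ 2) / y ^ 2) * (1 + t ^ 2)⁻¹ := by
    rw [inv_le_iff_one_le_mul₀ (by positivity), ← div_eq_mul_inv, div_mul_eq_mul_div,
      one_le_div (by positivity)]
    have h5 : (1 + 2 * x ^ 2) / y ^ 2 * y ^ 2 = 1 + 2 * x ^ 2 := by field_simp
    have h6 : 0 ≤ (1 + 2 * x ^ 2) / y ^ 2 * (t - x) ^ 2 := by positivity
    have h7 : 0 ≤ (2 * x ^ 2 / y ^ 2) * ((t - x) ^ 2 + y ^ 2) := by positivity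
    nlinarith [sq_nonneg (t - 2 * x), sq_nonneg y]
  calc halfPlanePoisson x y t ≤
      1 * y * (((2 + 2 * x ^ 2 / y ^ 2) + (1 + 2 * x ^ 2) / y ^ 2) * (1 + t ^ 2)⁻¹) := by
        unfold halfPlanePoisson; gcongr
    _ = _ := by field_simp

section Fatou

variable {E : Type*} [NormedAddCommGroup E] [NormedSpace ℝ E]

lemma integrable_halfPlanePoisson_smul {g : ℝ → E}
    (hg : Integrable fun t : ℝ => (1 + t ^ 2)⁻¹ • g t) (x : ℝ) {y : ℝ} (hy : 0 < y) :
    Integrable fun t => halfPlanePoisson x y t • g t := by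
  have hm : AEStronglyMeasurable (fun t => halfPlanePoisson x y t • g t) := by
    have : (fun t => halfPlanePoisson x y t • g t) =
        fun t => (halfPlanePoisson x y t * (1 + t ^ 2)) • ((1 + t ^ 2)⁻¹ • g t) := by
      ext t
      rw [smul_smul, mul_assoc, mul_inv_cancel₀ (by positivity), mul_one]
    rw [this]
    have := continuous_halfPlanePoisson x hy
    exact (Continuous.aestronglyMeasurable (by fun_prop)).smul hg.1
  refine (hg.norm.const_mul
    (y * (2 + 2 * x ^ 2 / y ^ 2) + (1 + 2 * x ^ 2) / y)).mono' hm (Eventually.of_forall fun t => ?_)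
  rw [norm_smul, norm_smul, ← mul_assoc, Real.norm_of_nonneg (halfPlanePoisson_nonneg x hy t),
    Real.norm_of_nonneg (by positivity : 0 ≤ (1 + t ^ 2)⁻¹)]
  gcongr
  exact halfPlanePoisson_le x hy t

/-- **Fatou's theorem** for Poisson integrals over the real line (vertical limits). -/
theorem ae_tendsto_integral_halfPlanePoisson [CompleteSpace E] {g : ℝ → E}
    (hg : Integrable fun t : ℝ => (1 + t ^ 2)⁻¹ • g t) :
    ∀ᵐ x : ℝ, Tendsto (fun y : ℝ => ∫ t, halfPlanePoisson x y t • g t) (𝓝[>] 0) (𝓝 (g x)) := by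
  have hgm : AEStronglyMeasurable g := by
    have : g = fun t : ℝ => (1 + t ^ 2) • ((1 + t ^ 2)⁻¹ • g t) := by
      ext t
      rw [smul_smul, mul_inv_cancel₀ (by positivity), one_smul]
    rw [this]
    exact (Continuous.aestronglyMeasurable (by fun_prop)).smul hg.1
  have hloc : LocallyIntegrable g := by
    have : g = fun t : ℝ => (1 + t ^ 2) • ((1 + t ^ 2)⁻¹ • g t) := by
      ext t
      rw [smul_smul, mul_inv_cancel₀ (by positivity), one_smul]
    rw [this, ← locallyIntegrableOn_univ]
    exact (hg.locallyIntegrable.locallyIntegrableOn _).continuousOn_smul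
      isOpen_univ.isLocallyClosed (by fun_prop)
  filter_upwards [IsUnifLocDoublingMeasure.ae_tendsto_average_norm_sub volume hloc 1] with x hx
  have hx' : Tendsto (fun r : ℝ => ⨍ t in Metric.closedBall x r, ‖g t - g x‖) (𝓝[>] 0) (𝓝 0) :=
    hx (fun _ => x) id tendsto_id (by
      filter_upwards [self_mem_nhdsWithin] with r hr
      simpa using (le_of_lt hr))
  set M := ∫ t : ℝ, (1 + t ^ 2)⁻¹ * ‖g t - g x‖ with hM
  have hsubint : Integrable fun t : ℝ => (1 + t ^ 2)⁻¹ • (g t - g x) := by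
    simp_rw [smul_sub]
    exact hg.sub (integrable_inv_one_add_sq.smul_const _)
  have hnint : Integrable fun t : ℝ => (1 + t ^ 2)⁻¹ * ‖g t - g x‖ := by
    refine hsubint.norm.congr (Eventually.of_forall fun t => ?_)
    simp only [norm_smul, Real.norm_of_nonneg (by positivity : 0 ≤ (1 + t ^ 2)⁻¹)]
  rw [Metric.tendsto_nhds]
  intro ε hε
  -- x is a Lebesgue point. An average below ε/16 over an interval of length 2r means a mass below
  -- (ε/8) r, which the near-part estimate doubles to ε/4; the far part gets ε/2.
  have hev : ∀ᶠ r in 𝓝[>] (0 : ℝ), ⨍ t in Metric.closedBall x r, ‖g t - g x‖ < ε / 16 :=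
    hx'.eventually (gt_mem_nhds (by positivity))
  obtain ⟨δ, hδ, hδr⟩ := mem_nhdsGT_iff_exists_Ioc_subset.1 hev
  rw [Set.mem_Ioi] at hδ
  set Cδ := (2 + 2 * x ^ 2) / δ ^ 2 + 2 with hCδ
  have hev2 : ∀ᶠ y in 𝓝[>] (0 : ℝ), y * (Cδ * M) < ε / 2 := by
    have : Tendsto (fun y : ℝ => y * (Cδ * M)) (𝓝[>] 0) (𝓝 0) := by
      have h0 : Tendsto (fun y : ℝ => y * (Cδ * M)) (𝓝 0) (𝓝 (0 * (Cδ * M))) :=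
        (continuous_mul_const _).tendsto 0
      rw [zero_mul] at h0
      exact h0.mono_left nhdsWithin_le_nhds
    exact this.eventually (gt_mem_nhds (by positivity))
  filter_upwards [hev2, self_mem_nhdsWithin] with y hy2 hy
  rw [Set.mem_Ioi] at hy
  have hP := integrable_halfPlanePoisson_smul hsubint
  have e1 : (∫ t, halfPlanePoisson x y t • g t) - g x =
      ∫ t, halfPlanePoisson x y t • (g t - g x) := by
    simp_rw [smul_sub]
    rw [integral_sub (integrable_halfPlanePoisson_smul hg x hy)
      ((integrable_halfPlanePoisson x hy).smul_const _), integral_smul_const,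
      integral_halfPlanePoisson x hy, one_smul]
  have hPn : Integrable fun t => halfPlanePoisson x y t * ‖g t - g x‖ := by
    refine (integrable_halfPlanePoisson_smul hsubint x hy).norm.congr
      (Eventually.of_forall fun t => ?_)
    simp only [norm_smul, Real.norm_of_nonneg (halfPlanePoisson_nonneg x hy t)]
  rw [dist_eq_norm, e1]
  have e2 : ‖∫ t, halfPlanePoisson x y t • (g t - g x)‖ ≤
      ∫ t, halfPlanePoisson x y t * ‖g t - g x‖ := by
    refine (norm_integral_le_integral_norm _).trans (le_of_eq ?_)
    congr 1; ext t
    rw [norm_smul, Real.norm_of_nonneg (halfPlanePoisson_nonneg x hy t)]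
  have hms : MeasurableSet (Metric.closedBall x δ) := Metric.isClosed_closedBall.measurableSet
  rw [← integral_add_compl hms hPn] at e2
  have b1 : ∫ t in Metric.closedBall x δ, halfPlanePoisson x y t * ‖g t - g x‖ ≤ ε / 4 := by
    rw [integral_eq_lintegral_of_nonneg_ae
      (Eventually.of_forall fun t => mul_nonneg (halfPlanePoisson_nonneg x hy t) (norm_nonneg _))
      hPn.1.restrict]
    refine ENNReal.toReal_le_of_le_ofReal (by positivity) ?_
    simp_rw [ENNReal.ofReal_mul (halfPlanePoisson_nonneg x hy _)]
    refine (setLIntegral_halfPlanePoisson_mul_le (ε := ε / 8)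
      ((hgm.sub aestronglyMeasurable_const).norm.aemeasurable.ennreal_ofReal)
      (by positivity) hδ hy fun r hr hrδ => ?_).trans (by
        apply ENNReal.ofReal_le_ofReal; linarith)
    have h1 := hδr (⟨hr, hrδ⟩ : r ∈ Set.Ioc 0 δ)
    have hloc' : IntegrableOn (fun t => ‖g t - g x‖) (Metric.closedBall x r) :=
      ((hloc.integrableOn_isCompact (isCompact_closedBall x r)).sub
        (integrableOn_const measure_closedBall_lt_top.ne)).norm
    simp only [Pi.sub_apply]
    rw [← ofReal_integral_eq_lintegral_ofReal hloc' (Eventually.of_forall fun t => norm_nonneg _)]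
    refine ENNReal.ofReal_le_ofReal ?_
    simp only [Set.mem_ofPred_eq, setAverage_eq, measureReal_def, Real.volume_closedBall,
      ENNReal.toReal_ofReal (by positivity : 0 ≤ 2 * r), smul_eq_mul] at h1
    rw [inv_mul_lt_iff₀ (by positivity)] at h1
    linarith
  have b2 : ∫ t in (Metric.closedBall x δ)ᶜ, halfPlanePoisson x y t * ‖g t - g x‖ ≤
      y * (Cδ * M) := by
    calc _ ≤ ∫ t in (Metric.closedBall x δ)ᶜ, (y * Cδ) * ((1 + t ^ 2)⁻¹ * ‖g t - g x‖) := by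
          refine setIntegral_mono_on hPn.integrableOn (hnint.const_mul _).integrableOn hms.compl ?_
          intro t ht
          rw [Set.mem_compl_iff, Metric.mem_closedBall, Real.dist_eq, not_le] at ht
          rw [← mul_assoc]
          gcongr
          exact halfPlanePoisson_le_of_le hδ hy ht.le
      _ ≤ ∫ t, (y * Cδ) * ((1 + t ^ 2)⁻¹ * ‖g t - g x‖) :=
          setIntegral_le_integral (hnint.const_mul _)
            (Eventually.of_forall fun t => by simp only [hCδ]; positivity)
      _ = _ := by rw [integral_const_mul, hM]; ring
  linarith

end Fatou

/-! ### Cauchy kernels and Cauchy integrals on the real line. -/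

lemma ofReal_sub_ne_zero (t : ℝ) {z : ℂ} (hz : z.im ≠ 0) : (t : ℂ) - z ≠ 0 := by
  intro h
  have := congrArg Complex.im h
  simp at this
  exact hz this

lemma abs_im_le_norm_sub (t : ℝ) (z : ℂ) : |z.im| ≤ ‖(t : ℂ) - z‖ := by
  have := Complex.abs_im_le_norm ((t : ℂ) - z)
  simpa using this

lemma isOpen_upperHalf : IsOpen upperHalf := isOpen_lt continuous_const Complex.continuous_im

lemma continuous_inv_ofReal_sub {z : ℂ} (hz : z.im ≠ 0) :
    Continuous fun t : ℝ => ((t : ℂ) - z)⁻¹ :=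
  Continuous.inv₀ (by fun_prop) fun t => ofReal_sub_ne_zero t hz

lemma integrable_div_ofReal_sub {h : ℝ → ℂ} (hh : Integrable h) {z : ℂ} (hz : z.im ≠ 0) :
    Integrable fun t : ℝ => h t / (t - z) := by
  simp_rw [div_eq_mul_inv]
  refine hh.mul_bdd (c := |z.im|⁻¹) (continuous_inv_ofReal_sub hz).aestronglyMeasurable
    (Eventually.of_forall fun t => ?_)
  rw [norm_inv]
  exact inv_anti₀ (abs_pos.2 hz) (abs_im_le_norm_sub t z)

/-- Cauchy integrals are holomorphic. -/
theorem differentiableOn_cauchy_integral {h : ℝ → ℂ} (hh : Integrable h) :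
    DifferentiableOn ℂ (fun z => ∫ t : ℝ, h t / (t - z)) upperHalf := by
  intro z hz
  have hz' : 0 < z.im := hz
  have hball : ∀ w ∈ Metric.ball z (z.im / 2), z.im / 2 < w.im := by
    intro w hw
    have h1 := Complex.abs_im_le_norm (w - z)
    rw [Metric.mem_ball, dist_eq_norm] at hw
    rw [Complex.sub_im] at h1
    have := neg_abs_le (w.im - z.im)
    linarith
  refine (hasDerivAt_integral_of_dominated_loc_of_deriv_le (μ := volume)
    (F := fun z t => h t / (t - z)) (F' := fun z t => h t / (t - z) ^ 2)
    (bound := fun t => ‖h t‖ * ((z.im / 2) ^ 2)⁻¹)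
    (Metric.ball_mem_nhds z (half_pos hz')) ?_ (integrable_div_ofReal_sub hh hz'.ne') ?_ ?_
    (hh.norm.mul_const _) ?_).2.differentiableAt.differentiableWithinAt
  · filter_upwards [isOpen_upperHalf.mem_nhds hz] with w hw
    exact (integrable_div_ofReal_sub hh (ne_of_gt hw)).1
  · have : (fun t : ℝ => h t / ((t : ℂ) - z) ^ 2) = fun t : ℝ => h t * (((t : ℂ) - z)⁻¹) ^ 2 := by
      ext t; rw [div_eq_mul_inv, inv_pow]
    rw [this]
    exact hh.1.mul ((continuous_inv_ofReal_sub hz'.ne').pow 2).aestronglyMeasurable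
  · refine Eventually.of_forall fun t w hw => ?_
    rw [norm_div, norm_pow, div_eq_mul_inv]
    have h1 := hball w hw
    have h2 := abs_im_le_norm_sub t w
    rw [abs_of_pos (by linarith)] at h2
    gcongr
    linarith
  · refine Eventually.of_forall fun t w hw => ?_
    have h1 := hball w hw
    have hne := ofReal_sub_ne_zero t (z := w) (by linarith)
    have hd := (((hasDerivAt_id w).const_sub (t : ℂ)).inv hne).const_mul (h t)
    simp only [div_eq_mul_inv]
    convert! hd using 1
    simp [div_eq_mul_inv]
lemma MeasureTheory.MemLp.integrable_norm_sq {f : ℝ → ℂ} (hf : MemLp f 2) :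
    Integrable fun t => ‖f t‖ ^ 2 :=
  (memLp_two_iff_integrable_sq_norm hf.1).1 hf

/-- The Cauchy–Schwarz inequality for the integral of a product. -/
lemma norm_integral_mul_le {f g : ℝ → ℂ} (hf : MemLp f 2) (hg : MemLp g 2) :
    ‖∫ t, f t * g t‖ ≤ √(∫ t, ‖f t‖ ^ 2) * √(∫ t, ‖g t‖ ^ 2) := by
  have h2 : ENNReal.ofReal 2 = 2 := by norm_num
  have h := integral_mul_norm_le_Lp_mul_Lq (μ := volume) (f := f) (g := g)
    (p := 2) (q := 2) (by constructor <;> norm_num) (by rwa [h2]) (by rwa [h2])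
  simp only [Real.rpow_two] at h
  rw [← Real.sqrt_eq_rpow, ← Real.sqrt_eq_rpow] at h
  refine (norm_integral_le_integral_norm _).trans ?_
  simpa only [norm_mul] using h

lemma norm_ofReal_sub_sq (t : ℝ) (z : ℂ) : ‖(t : ℂ) - z‖ ^ 2 = (t - z.re) ^ 2 + z.im ^ 2 := by
  rw [← Complex.normSq_eq_norm_sq, Complex.normSq_apply]
  simp
  ring

lemma norm_inv_ofReal_sub_sq (t : ℝ) {z : ℂ} (hz : z.im ≠ 0) :
    ‖((t : ℂ) - z)⁻¹‖ ^ 2 = Real.pi / |z.im| * halfPlanePoisson z.re |z.im| t := by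
  have := abs_pos.2 hz
  rw [norm_inv, inv_pow, norm_ofReal_sub_sq, halfPlanePoisson, sq_abs]
  have h0 : (t - z.re) ^ 2 + z.im ^ 2 ≠ 0 := by positivity
  have := Real.pi_pos
  field_simp

lemma memLp_inv_ofReal_sub {z : ℂ} (hz : z.im ≠ 0) : MemLp (fun t : ℝ => ((t : ℂ) - z)⁻¹) 2 := by
  rw [memLp_two_iff_integrable_sq_norm (continuous_inv_ofReal_sub hz).aestronglyMeasurable]
  simp_rw [norm_inv_ofReal_sub_sq _ hz]
  exact (integrable_halfPlanePoisson _ (abs_pos.2 hz)).const_mul _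

lemma integral_norm_inv_ofReal_sub_sq {z : ℂ} (hz : z.im ≠ 0) :
    ∫ t : ℝ, ‖((t : ℂ) - z)⁻¹‖ ^ 2 = Real.pi / |z.im| := by
  simp_rw [norm_inv_ofReal_sub_sq _ hz]
  rw [integral_const_mul, integral_halfPlanePoisson _ (abs_pos.2 hz), mul_one]

lemma two_I_im (z : ℂ) : z - conj z = 2 * Complex.I * z.im := by
  apply Complex.ext <;> simp; ring

/-- The bridge between Cauchy and Poisson integrals: subtracting the Cauchy integral at the
reflected point, where it vanishes for H² functions, turns Cauchy's formula into a Poisson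
representation. -/
lemma two_pi_I_mul_halfPlanePoisson (t : ℝ) {z : ℂ} (hz : 0 < z.im) :
    2 * Real.pi * Complex.I * (halfPlanePoisson z.re z.im t : ℂ) =
      ((t : ℂ) - z)⁻¹ - ((t : ℂ) - conj z)⁻¹ := by
  have h1 := ofReal_sub_ne_zero t hz.ne'
  have h2 := ofReal_sub_ne_zero t (z := conj z) (by simpa using hz.ne')
  have h3 : ((t : ℂ) - z) * ((t : ℂ) - conj z) = (((t - z.re) ^ 2 + z.im ^ 2 : ℝ) : ℂ) := by
    rw [← norm_ofReal_sub_sq, ← Complex.normSq_eq_norm_sq, Complex.normSq_eq_conj_mul_self]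
    simp [mul_comm]
  have h4 : ((((t - z.re) ^ 2 + z.im ^ 2 : ℝ)) : ℂ) ≠ 0 := by
    rw [← h3]; exact mul_ne_zero h1 h2
  rw [inv_sub_inv h1 h2, h3]
  have h5 : (t : ℂ) - conj z - (t - z) = 2 * Complex.I * z.im := by
    rw [← two_I_im]; ring
  rw [h5, halfPlanePoisson]
  have hpi : (Real.pi : ℂ) ≠ 0 := by exact_mod_cast Real.pi_ne_zero
  push_cast at h4 ⊢
  field_simp

/-! ### Elementary properties of the Hardy spaces. -/

lemma add_mul_I_mem_upperHalf (t : ℝ) {y : ℝ} (hy : 0 < y) :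
    (t : ℂ) + y * Complex.I ∈ upperHalf := by
  simpa [upperHalf] using hy

lemma continuous_on_line {G : ℂ → ℂ} (hG : DifferentiableOn ℂ G upperHalf) {y : ℝ} (hy : 0 < y) :
    Continuous fun t : ℝ => G (t + y * Complex.I) :=
  hG.continuousOn.comp_continuous (by fun_prop) fun t => add_mul_I_mem_upperHalf t hy

/-- The Hardy space in terms of square-integrability on horizontal lines. -/
lemma isHardyTwo_iff {G : ℂ → ℂ} : IsHardyTwo G ↔ DifferentiableOn ℂ G upperHalf ∧
    ∃ C : ℝ, 0 ≤ C ∧ ∀ y : ℝ, 0 < y → MemLp (fun t : ℝ => G (t + y * Complex.I)) 2 ∧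
      ∫ t : ℝ, ‖G (t + y * Complex.I)‖ ^ 2 ≤ C := by
  refine and_congr_right fun hG => ⟨?_, ?_⟩
  · rintro ⟨C, hC⟩
    refine ⟨max C 0, le_max_right _ _, fun y hy => ?_⟩
    have hc := continuous_on_line hG hy
    have hint : Integrable fun t : ℝ => ‖G (t + y * Complex.I)‖ ^ 2 := by
      have hm : AEStronglyMeasurable (fun t : ℝ => ‖G (t + y * Complex.I)‖ ^ 2) :=
        (hc.norm.pow 2).aestronglyMeasurable
      rw [← lintegral_ofReal_ne_top_iff_integrable hm
        (Eventually.of_forall fun t => by positivity)]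
      exact ((hC y hy).trans_lt ENNReal.ofReal_lt_top).ne
    refine ⟨(memLp_two_iff_integrable_sq_norm hc.aestronglyMeasurable).2 hint, ?_⟩
    have := hC y hy
    rw [← ofReal_integral_eq_lintegral_ofReal hint
      (Eventually.of_forall fun t => by positivity)] at this
    rw [← ENNReal.ofReal_le_ofReal_iff (le_max_right _ _)]
    exact this.trans (ENNReal.ofReal_le_ofReal (le_max_left _ _))
  · rintro ⟨C, -, hC⟩
    refine ⟨C, fun y hy => ?_⟩
    rw [← ofReal_integral_eq_lintegral_ofReal (hC y hy).1.integrable_norm_sq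
      (Eventually.of_forall fun t => by positivity)]
    exact ENNReal.ofReal_le_ofReal (hC y hy).2

lemma IsHardyTwo.memLp {G : ℂ → ℂ} (hG : IsHardyTwo G) {y : ℝ} (hy : 0 < y) :
    MemLp (fun t : ℝ => G (t + y * Complex.I)) 2 := by
  obtain ⟨C, -, hC⟩ := (isHardyTwo_iff.1 hG).2
  exact (hC y hy).1

lemma IsHardyTwo.add {F G : ℂ → ℂ} (hF : IsHardyTwo F) (hG : IsHardyTwo G) :
    IsHardyTwo (fun z => F z + G z) := by
  rw [isHardyTwo_iff] at *
  obtain ⟨hF, C, hC0, hC⟩ := hF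
  obtain ⟨hG, C', hC0', hC'⟩ := hG
  refine ⟨hF.add hG, 2 * C + 2 * C', by positivity, fun y hy => ⟨(hC y hy).1.add (hC' y hy).1, ?_⟩⟩
  have h1 := ((hC y hy).1.integrable_norm_sq).const_mul 2
  have h2 := ((hC' y hy).1.integrable_norm_sq).const_mul 2
  calc _ ≤ ∫ t : ℝ, (2 * ‖F (t + y * Complex.I)‖ ^ 2 + 2 * ‖G (t + y * Complex.I)‖ ^ 2) := by
        refine integral_mono (((hC y hy).1.add (hC' y hy).1).integrable_norm_sq) (h1.add h2)
          fun t => ?_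
        have h3 := norm_add_le (F (t + y * Complex.I)) (G (t + y * Complex.I))
        have h4 := pow_le_pow_left₀ (norm_nonneg _) h3 2
        simp only at *
        nlinarith [sq_nonneg (‖F (t + y * Complex.I)‖ - ‖G (t + y * Complex.I)‖)]
    _ = 2 * (∫ t : ℝ, ‖F (t + y * Complex.I)‖ ^ 2) + 2 * ∫ t : ℝ, ‖G (t + y * Complex.I)‖ ^ 2 := by
        rw [integral_add h1 h2, integral_const_mul, integral_const_mul]
    _ ≤ _ := by linarith [(hC y hy).2, (hC' y hy).2]

lemma IsHardyTwo.bdd_mul {F b : ℂ → ℂ} (hF : IsHardyTwo F) (hb : IsHardyInfty b) :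
    IsHardyTwo (fun z => b z * F z) := by
  obtain ⟨hb, M, hM⟩ := hb
  rw [isHardyTwo_iff] at *
  obtain ⟨hF, C, hC0, hC⟩ := hF
  refine ⟨hb.mul hF, M ^ 2 * C, by positivity, fun y hy => ?_⟩
  have h0 : MemLp (fun t : ℝ => b (t + y * Complex.I) * F (t + y * Complex.I)) 2 := by
    refine ((hC y hy).1.const_mul (M : ℂ)).of_le
      ((continuous_on_line hb hy).mul (continuous_on_line hF hy)).aestronglyMeasurable
      (Eventually.of_forall fun t => ?_)
    rw [norm_mul, norm_mul, Complex.norm_real]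
    gcongr
    exact (hM _ (add_mul_I_mem_upperHalf t hy)).trans (le_abs_self _)
  refine ⟨h0, ?_⟩
  calc _ ≤ ∫ t : ℝ, M ^ 2 * ‖F (t + y * Complex.I)‖ ^ 2 := by
        refine integral_mono h0.integrable_norm_sq ((hC y hy).1.integrable_norm_sq.const_mul _)
          fun t => ?_
        simp only [norm_mul, mul_pow]
        gcongr
        exact hM _ (add_mul_I_mem_upperHalf t hy)
    _ ≤ _ := by
        rw [integral_const_mul]
        gcongr
        exact (hC y hy).2

lemma isHardyInfty_const (c : ℂ) : IsHardyInfty fun _ => c :=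
  ⟨differentiableOn_const c, ‖c‖, fun _ _ => le_rfl⟩

lemma IsHardyInfty.mul {b c : ℂ → ℂ} (hb : IsHardyInfty b) (hc : IsHardyInfty c) :
    IsHardyInfty (fun z => b z * c z) := by
  obtain ⟨hb, M, hM⟩ := hb
  obtain ⟨hc, M', hM'⟩ := hc
  refine ⟨hb.mul hc, M * M', fun z hz => ?_⟩
  rw [norm_mul]
  exact mul_le_mul (hM z hz) (hM' z hz) (norm_nonneg _) ((norm_nonneg _).trans (hM z hz))

lemma IsHardyInfty.add {b c : ℂ → ℂ} (hb : IsHardyInfty b) (hc : IsHardyInfty c) :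
    IsHardyInfty (fun z => b z + c z) := by
  obtain ⟨hb, M, hM⟩ := hb
  obtain ⟨hc, M', hM'⟩ := hc
  exact ⟨hb.add hc, M + M', fun z hz =>
    (norm_add_le _ _).trans (add_le_add (hM z hz) (hM' z hz))⟩

/-- Szegő-type kernels `1 / (z - a)` with a pole in the lower half-plane belong to `H²`. -/
lemma isHardyTwo_inv_sub {a : ℂ} (ha : a.im < 0) : IsHardyTwo fun z => (z - a)⁻¹ := by
  have hne : ∀ z ∈ upperHalf, z - a ≠ 0 := by
    intro z hz h
    have hz' : 0 < z.im := hz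
    have := congrArg Complex.im h
    simp at this
    linarith
  rw [isHardyTwo_iff]
  refine ⟨DifferentiableOn.inv (by fun_prop) hne, Real.pi / |a.im|, by positivity, fun y hy => ?_⟩
  have e : ∀ t : ℝ, (t : ℂ) + y * Complex.I - a = t - (a - y * Complex.I) := fun t => by ring
  have him : (a - y * Complex.I).im ≠ 0 := by simp; linarith
  simp_rw [e]
  refine ⟨memLp_inv_ofReal_sub him, ?_⟩
  rw [integral_norm_inv_ofReal_sub_sq him]
  have : |a.im| ≤ |(a - y * Complex.I).im| := by
    have h1 : (a - y * Complex.I).im = a.im - y := by simp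
    rw [h1, abs_of_neg ha, abs_of_neg (by linarith)]
    linarith
  have := abs_pos_of_neg ha
  have := Real.pi_pos
  gcongr

lemma isHardyInfty_inv_sub {a : ℂ} (ha : a.im < 0) : IsHardyInfty fun z => (z - a)⁻¹ := by
  refine ⟨(isHardyTwo_inv_sub ha).1, |a.im|⁻¹, fun z hz => ?_⟩
  have hz' : 0 < z.im := hz
  rw [norm_inv]
  have := abs_pos_of_neg ha
  refine inv_anti₀ this ((?_ : |a.im| ≤ |(z - a).im|).trans (Complex.abs_im_le_norm _))
  rw [Complex.sub_im, abs_of_neg ha, abs_of_pos (by linarith)]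
  linarith

/-! ### Cauchy's theorem and formula on horizontal lines. -/

/-- Integrals over two horizontal lines of a function `H = N / (ζ - z)` with `N ∈ H²` and removable
singularity agree. -/
lemma integral_line_eq_integral_line {N H : ℂ → ℂ} (hN : IsHardyTwo N)
    (hH : DifferentiableOn ℂ H upperHalf) {z : ℂ} (hNH : ∀ ζ ∈ upperHalf, H ζ * (ζ - z) = N ζ)
    {ε Y : ℝ} (hε : 0 < ε) (hεY : ε < Y)
    (h1 : Integrable fun t : ℝ => H (t + ε * Complex.I))
    (h2 : Integrable fun t : ℝ => H (t + Y * Complex.I)) :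
    ∫ t : ℝ, H (t + ε * Complex.I) = ∫ t : ℝ, H (t + Y * Complex.I) := by
  obtain ⟨C, hC0, hC⟩ := (isHardyTwo_iff.1 hN).2
  have hcN : ContinuousOn N upperHalf := hN.1.continuousOn
  have hsq : ∀ R : ℝ, ContinuousOn (fun y : ℝ => ‖N (R + y * Complex.I)‖ ^ 2) (Set.uIcc ε Y) := by
    intro R
    rw [Set.uIcc_of_le hεY.le]
    refine (ContinuousOn.norm ?_).pow 2
    exact hcN.comp (by fun_prop) fun y hy => add_mul_I_mem_upperHalf R (hε.trans_le hy.1)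
  -- Integrate over the rectangle [−R, R] × [ε, Y]. No pointwise bound on the vertical sides is
  -- available, but W, the squared mass of N on the side at abscissa R, is integrable in R because N
  -- ∈ H².
  set W : ℝ → ℝ≥0∞ := fun R => ∫⁻ y in Set.Ioc ε Y, ENNReal.ofReal (‖N (R + y * Complex.I)‖ ^ 2)
    with hW
  have hmeas : AEMeasurable (Function.uncurry fun R y : ℝ =>
      ENNReal.ofReal (‖N (R + y * Complex.I)‖ ^ 2))
      ((volume : Measure ℝ).prod (volume.restrict (Set.Ioc ε Y))) := by
    have : (volume : Measure ℝ).prod (volume.restrict (Set.Ioc ε Y)) =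
        (volume.prod volume).restrict (Set.univ ×ˢ Set.Ioc ε Y) := by
      rw [← Measure.prod_restrict, Measure.restrict_univ]
    rw [this]
    refine ContinuousOn.aemeasurable ?_ (MeasurableSet.univ.prod measurableSet_Ioc)
    refine ENNReal.continuous_ofReal.comp_continuousOn ((ContinuousOn.norm ?_).pow 2)
    exact hcN.comp (by fun_prop) fun p hp => add_mul_I_mem_upperHalf p.1 (hε.trans hp.2.1)
  have hWfin : ∫⁻ R, W R ≤ ENNReal.ofReal C * ENNReal.ofReal (Y - ε) := by
    rw [hW, lintegral_lintegral_swap hmeas]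
    calc _ ≤ ∫⁻ y in Set.Ioc ε Y, ENNReal.ofReal C := by
          refine setLIntegral_mono' measurableSet_Ioc fun y hy => ?_
          have hy0 := hε.trans hy.1
          rw [← ofReal_integral_eq_lintegral_ofReal (hC y hy0).1.integrable_norm_sq
            (Eventually.of_forall fun t => by positivity)]
          exact ENNReal.ofReal_le_ofReal (hC y hy0).2
      _ = _ := by simp
  have hWR : ∀ R, W R = ENNReal.ofReal (∫ y in ε..Y, ‖N (R + y * Complex.I)‖ ^ 2) := by
    intro R
    rw [hW, intervalIntegral.integral_of_le hεY.le, ofReal_integral_eq_lintegral_ofReal]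
    · exact (intervalIntegrable_iff_integrableOn_Ioc_of_le hεY.le).1 (hsq R).intervalIntegrable
    · exact Eventually.of_forall fun y => by positivity
  set L := (∫ t : ℝ, H (t + ε * Complex.I)) - ∫ t : ℝ, H (t + Y * Complex.I) with hL
  by_contra hne
  have hLpos : 0 < ‖L‖ := norm_pos_iff.2 (sub_ne_zero.2 hne)
  have hlim : Tendsto (fun R : ℝ => ‖(∫ t in -R..R, H (t + ε * Complex.I)) -
      ∫ t in -R..R, H (t + Y * Complex.I)‖) atTop (𝓝 ‖L‖) :=
    ((intervalIntegral_tendsto_integral h1 tendsto_neg_atTop_atBot tendsto_id).sub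
      (intervalIntegral_tendsto_integral h2 tendsto_neg_atTop_atBot tendsto_id)).norm
  -- On the side, |ζ − z| ≥ |R| − |Re z| and |N| ≤ 1 + |N|², so the contribution is at most (Y − ε +
  -- W(R)) / (|R| − |Re z|).
  have hside : ∀ R : ℝ, |z.re| + 1 ≤ |R| → ‖∫ y in ε..Y, H (R + y * Complex.I)‖ * (|R| - |z.re|) ≤
      (Y - ε) + ∫ y in ε..Y, ‖N (R + y * Complex.I)‖ ^ 2 := by
    intro R hR
    have hpos : 0 < |R| - |z.re| := by linarith
    have hb : ‖∫ y in ε..Y, H (R + y * Complex.I)‖ ≤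
        ∫ y in ε..Y, (|R| - |z.re|)⁻¹ * (1 + ‖N (R + y * Complex.I)‖ ^ 2) := by
      refine intervalIntegral.norm_integral_le_of_norm_le hεY.le (Eventually.of_forall ?_) ?_
      · intro y hy
        have hmem := add_mul_I_mem_upperHalf R (hε.trans hy.1)
        have h3 : |R| - |z.re| ≤ ‖(R : ℂ) + y * Complex.I - z‖ := by
          refine le_trans ?_ (Complex.abs_re_le_norm _)
          simpa using abs_sub_abs_le_abs_sub R z.re
        have h4 := congrArg norm (hNH _ hmem)
        rw [norm_mul] at h4
        rw [inv_mul_eq_div, le_div_iff₀ hpos]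
        calc _ ≤ ‖N (R + y * Complex.I)‖ := by
              rw [← h4]; gcongr
          _ ≤ _ := by nlinarith [sq_nonneg (‖N (R + y * Complex.I)‖ - 1)]
      · exact ((continuousOn_const.add (hsq R)).intervalIntegrable).const_mul _
    rw [intervalIntegral.integral_const_mul, intervalIntegral.integral_add
      (intervalIntegrable_const) (hsq R).intervalIntegrable, inv_mul_eq_div,
      le_div_iff₀ hpos] at hb
    simpa using hb
  have hrect : ∀ R : ℝ, ‖(∫ t in -R..R, H (t + ε * Complex.I)) -
      ∫ t in -R..R, H (t + Y * Complex.I)‖ ≤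
      ‖∫ y in ε..Y, H (R + y * Complex.I)‖ + ‖∫ y in ε..Y, H ((-R : ℝ) + y * Complex.I)‖ := by
    intro R
    have h0 := Complex.integral_boundary_rect_eq_zero_of_differentiableOn H
      ⟨-R, ε⟩ ⟨R, Y⟩ (hH.mono ?_)
    · simp only [smul_eq_mul] at h0
      have h5 : (∫ t in -R..R, H (t + ε * Complex.I)) - ∫ t in -R..R, H (t + Y * Complex.I) =
          Complex.I * (∫ y in ε..Y, H ((-R : ℝ) + y * Complex.I)) -
          Complex.I * ∫ y in ε..Y, H (R + y * Complex.I) := by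
        linear_combination h0
      rw [h5]
      refine (norm_sub_le _ _).trans ?_
      simp [add_comm]
    · intro w hw
      have := hw.2
      rw [Set.uIcc_of_le hεY.le] at this
      exact hε.trans_le this.1
  -- If the two line integrals differed by L ≠ 0, the sides would contribute at least |L|/2 for all
  -- large R. The last threshold makes (|L|/2)(R − |Re z|) at least 1 + 2(Y − ε), which forces W(R)
  -- + W(−R) ≥ 1 and contradicts integrability.
  have hev : ∀ᶠ R : ℝ in atTop, (1 : ℝ≥0∞) ≤ W R + W (-R) := by
    filter_upwards [hlim.eventually (lt_mem_nhds (half_lt_self hLpos)),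
      eventually_ge_atTop (|z.re| + 1),
      eventually_ge_atTop (|z.re| + (1 + 2 * (Y - ε)) / (‖L‖ / 2))] with R hR1 hR2 hR3
    have hR0 : 0 ≤ R := by linarith [abs_nonneg z.re]
    have ha : |R| = R := abs_of_nonneg hR0
    have s1 := hside R (by rwa [ha])
    have s2 := hside (-R) (by rwa [abs_neg, ha])
    rw [abs_neg] at s2
    rw [ha] at s1 s2
    have hr := hrect R
    rw [← sub_nonneg] at hR3
    have h6 : 1 + 2 * (Y - ε) ≤ (‖L‖ / 2) * (R - |z.re|) := by
      rw [← div_le_iff₀' (by positivity)]; linarith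
    have h7 : (‖L‖ / 2) * (R - |z.re|) ≤ (‖∫ y in ε..Y, H (R + y * Complex.I)‖ +
        ‖∫ y in ε..Y, H ((-R : ℝ) + y * Complex.I)‖) * (R - |z.re|) := by
      apply mul_le_mul_of_nonneg_right _ (by linarith)
      linarith
    rw [hWR, hWR, ← ENNReal.ofReal_add, ← ENNReal.ofReal_one]
    · apply ENNReal.ofReal_le_ofReal
      linarith
    · exact intervalIntegral.integral_nonneg hεY.le fun y _ => by positivity
    · exact intervalIntegral.integral_nonneg hεY.le fun y _ => by positivity
  obtain ⟨R₀, hR₀⟩ := eventually_atTop.1 hev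
  have htop : ∫⁻ R, (W R + W (-R)) = ⊤ := by
    rw [eq_top_iff]
    calc (⊤ : ℝ≥0∞) = ∫⁻ R in Set.Ici R₀, 1 := by simp
      _ ≤ ∫⁻ R in Set.Ici R₀, (W R + W (-R)) :=
          setLIntegral_mono' measurableSet_Ici fun R hR => hR₀ R hR
      _ ≤ _ := setLIntegral_le_lintegral _ _
  have hle : ∫⁻ R, (W R + W (-R)) ≤ (∫⁻ R, W R) + ∫⁻ R, W (-R) := by
    exact (lintegral_add_left' hmeas.lintegral_prod_right' _).le
  rw [htop, lintegral_neg_eq_self (μ := volume) W] at hle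
  have h8 : (∫⁻ R, W R) + ∫⁻ R, W R < ⊤ :=
    ENNReal.add_lt_top.2 ⟨hWfin.trans_lt (ENNReal.mul_lt_top ENNReal.ofReal_lt_top
      ENNReal.ofReal_lt_top), hWfin.trans_lt (ENNReal.mul_lt_top ENNReal.ofReal_lt_top
      ENNReal.ofReal_lt_top)⟩
  exact absurd hle (not_le.2 h8)

/-- The integral over a horizontal line of a function `H = N / (ζ - z)` with `N ∈ H²` and removable
singularity vanishes. -/
lemma integral_line_eq_zero {N H : ℂ → ℂ} (hN : IsHardyTwo N)
    (hH : DifferentiableOn ℂ H upperHalf) {z : ℂ} (hNH : ∀ ζ ∈ upperHalf, H ζ * (ζ - z) = N ζ)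
    {ε : ℝ} (hε : 0 < ε) (hεz : ε ≠ z.im) :
    ∫ t : ℝ, H (t + ε * Complex.I) = 0 := by
  obtain ⟨C, hC0, hC⟩ := (isHardyTwo_iff.1 hN).2
  have heq : ∀ y : ℝ, 0 < y → y ≠ z.im → (fun t : ℝ => H (t + y * Complex.I)) =
      fun t : ℝ => N (t + y * Complex.I) * ((t : ℂ) - (z - y * Complex.I))⁻¹ := by
    intro y hy hyz
    ext t
    have h0 : (t : ℂ) - (z - y * Complex.I) ≠ 0 :=
      ofReal_sub_ne_zero t (by simpa [sub_eq_zero] using hyz.symm)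
    rw [← hNH _ (add_mul_I_mem_upperHalf t hy), mul_assoc]
    have : (t : ℂ) + y * Complex.I - z = t - (z - y * Complex.I) := by ring
    rw [this, mul_inv_cancel₀ h0, mul_one]
  have hint : ∀ y : ℝ, 0 < y → y ≠ z.im → Integrable fun t : ℝ => H (t + y * Complex.I) := by
    intro y hy hyz
    rw [heq y hy hyz]
    exact (hC y hy).1.integrable_mul
      (memLp_inv_ofReal_sub (by simpa [sub_eq_zero] using hyz.symm))
  -- Move the line up to height y and apply Cauchy–Schwarz; the L² norm of the Cauchy kernel decays
  -- as y grows.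
  have hbound : ∀ y : ℝ, ε < y → z.im < y →
      ‖∫ t : ℝ, H (t + ε * Complex.I)‖ ≤ √C * √(Real.pi / (y - z.im)) := by
    intro y hy hyz
    have hy0 := hε.trans hy
    have him : (z - y * Complex.I).im ≠ 0 := by simp; linarith
    rw [integral_line_eq_integral_line hN hH hNH hε hy (hint ε hε hεz) (hint y hy0 hyz.ne'),
      heq y hy0 hyz.ne']
    refine (norm_integral_mul_le (hC y hy0).1 (memLp_inv_ofReal_sub him)).trans ?_
    rw [integral_norm_inv_ofReal_sub_sq him]
    have : |(z - y * Complex.I).im| = y - z.im := by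
      have h3 : (z - y * Complex.I).im = z.im - y := by simp
      rw [h3, abs_of_neg (by linarith)]; ring
    rw [this]
    gcongr
    exact (hC y hy0).2
  have hlim : Tendsto (fun y : ℝ => √C * √(Real.pi / (y - z.im))) atTop (𝓝 0) := by
    have h1 : Tendsto (fun y : ℝ => Real.pi / (y - z.im)) atTop (𝓝 0) :=
      tendsto_const_nhds.div_atTop (tendsto_atTop_add_const_right _ _ tendsto_id)
    have h2 := ((Real.continuous_sqrt.tendsto 0).comp h1).const_mul (√C)
    simpa using h2
  have := ge_of_tendsto hlim (by
    filter_upwards [eventually_gt_atTop ε, eventually_gt_atTop z.im] with y h1 h2 using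
      hbound y h1 h2)
  exact norm_le_zero_iff.1 this

/-- In the original coordinate the pole is z + iε, which is not in the open upper half-plane, so the
integrand is holomorphic there and no singularity has to be removed. -/
lemma IsHardyTwo.integral_line_lower {G : ℂ → ℂ} (hG : IsHardyTwo G) {z : ℂ} {ε : ℝ} (hε : 0 < ε)
    (hz : z.im + ε ≤ 0) : ∫ t : ℝ, G (t + ε * Complex.I) / (t - z) = 0 := by
  have hne : ∀ ζ ∈ upperHalf, ζ - (z + ε * Complex.I) ≠ 0 := by
    intro ζ hζ h
    have hζ' : 0 < ζ.im := hζ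
    have := congrArg Complex.im h
    simp at this
    linarith
  have := integral_line_eq_zero hG (H := fun ζ => G ζ / (ζ - (z + ε * Complex.I)))
    (hG.1.div (by fun_prop) hne) (z := z + ε * Complex.I)
    (fun ζ hζ => div_mul_cancel₀ _ (hne ζ hζ)) hε (by simp; linarith)
  rw [← this]
  congr 1; ext t; congr 1; ring

/-- Subtract from G a multiple of 1/(ζ − a), with a in the lower half-plane, so that the difference
N vanishes at the pole z₁ = z + iε; then N/(ζ − z₁) has a removable singularity and integrates to
zero. Taking a to be the reflection of z₁ in the line of integration makes the subtracted term a
Poisson kernel, whose integral is 1. -/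
lemma IsHardyTwo.integral_line_upper {G : ℂ → ℂ} (hG : IsHardyTwo G) {z : ℂ} {ε : ℝ} (hε : 0 < ε)
    (hz : ε < z.im) : ∫ t : ℝ, G (t + ε * Complex.I) / (t - z) =
      2 * Real.pi * Complex.I * G (z + ε * Complex.I) := by
  have hz0 : 0 < z.im := hε.trans hz
  set z₁ := z + ε * Complex.I with hz₁
  set a := conj z + ε * Complex.I with ha
  have hz₁a : z₁ - a = z - conj z := by rw [hz₁, ha]; ring
  have hzz : z - conj z ≠ 0 := by
    rw [two_I_im]
    have : (z.im : ℂ) ≠ 0 := by exact_mod_cast hz0.ne'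
    simp [this]
  have haim : a.im < 0 := by simp [ha]; linarith
  set c := G z₁ * (z - conj z) with hc
  have hN : IsHardyTwo fun ζ => G ζ + (-c) * (ζ - a)⁻¹ :=
    hG.add ((isHardyTwo_inv_sub haim).bdd_mul (isHardyInfty_const _))
  set N : ℂ → ℂ := fun ζ => G ζ + (-c) * (ζ - a)⁻¹ with hNdef
  have hNz : N z₁ = 0 := by
    simp only [hNdef, hz₁a, hc]
    field_simp
    ring
  have hmem : z₁ ∈ upperHalf := by
    change 0 < z₁.im
    simp [hz₁]; linarith
  have hdiff : DifferentiableOn ℂ (dslope N z₁) upperHalf :=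
    (Complex.differentiableOn_dslope (isOpen_upperHalf.mem_nhds hmem)).2 hN.1
  have h0 := integral_line_eq_zero hN hdiff (z := z₁) (fun ζ _ => by
    have := sub_smul_dslope N z₁ ζ
    rw [hNz, sub_zero, smul_eq_mul] at this
    rw [mul_comm, this]) hε (by simp [hz₁]; linarith)
  have him : z.im ≠ 0 := hz0.ne'
  have hds : ∀ t : ℝ, dslope N z₁ (t + ε * Complex.I) =
      G (t + ε * Complex.I) / (t - z) - G z₁ * (2 * Real.pi * Complex.I *
        (halfPlanePoisson z.re z.im t : ℂ)) := by
    intro t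
    have hne : (t : ℂ) - z ≠ 0 := ofReal_sub_ne_zero t him
    have hne2 : (t : ℂ) - conj z ≠ 0 := ofReal_sub_ne_zero t (by simpa using him)
    have hne1 : (t : ℂ) + ε * Complex.I - z₁ ≠ 0 := by
      rw [hz₁]; convert hne using 1; ring
    have := sub_smul_dslope N z₁ (t + ε * Complex.I)
    rw [hNz, sub_zero, smul_eq_mul] at this
    rw [eq_comm, ← mul_right_inj' hne1, this, hNdef, two_pi_I_mul_halfPlanePoisson t hz0]
    have e1 : (t : ℂ) + ε * Complex.I - z₁ = t - z := by rw [hz₁]; ring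
    have e2 : (t : ℂ) + ε * Complex.I - a = t - conj z := by rw [ha]; ring
    simp only [e1, e2, hc]
    field_simp
    ring
  simp_rw [hds] at h0
  have hi1 : Integrable fun t : ℝ => G (t + ε * Complex.I) / (t - z) := by
    simp_rw [div_eq_mul_inv]
    exact (hG.memLp hε).integrable_mul (memLp_inv_ofReal_sub him)
  have hi2 : Integrable fun t : ℝ => (halfPlanePoisson z.re z.im t : ℂ) :=
    (integrable_halfPlanePoisson z.re hz0).ofReal
  rw [integral_sub hi1 ((hi2.const_mul _).const_mul _), integral_const_mul, integral_const_mul,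
    integral_complex_ofReal, integral_halfPlanePoisson _ hz0, sub_eq_zero] at h0
  rw [h0]; push_cast; ring

/-! ### Boundary values of Hardy functions and their characterization by Cauchy integrals. -/

lemma integral_toLp_inner {f g : ℝ → ℂ} (hf : MemLp f 2) (hg : MemLp g 2) :
    inner ℂ (hf.toLp f) (hg.toLp g) = ∫ t, conj (f t) * g t := by
  rw [L2.inner_def]
  refine integral_congr_ae ?_
  filter_upwards [hf.coeFn_toLp, hg.coeFn_toLp] with t h1 h2
  rw [h1, h2, RCLike.inner_apply, mul_comm]

/-- The Cauchy transform of a square-integrable function. -/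
lemma integrable_div_of_memLp {g : ℝ → ℂ} (hg : MemLp g 2) {z : ℂ} (hz : z.im ≠ 0) :
    Integrable fun t : ℝ => g t / (t - z) := by
  simp_rw [div_eq_mul_inv]
  exact hg.integrable_mul (memLp_inv_ofReal_sub hz)

lemma MeasureTheory.MemLp.integrable_inv_one_add_sq_smul {g : ℝ → ℂ} (hg : MemLp g 2) :
    Integrable fun t : ℝ => (1 + t ^ 2)⁻¹ • g t := by
  have h1 : (fun t : ℝ => (1 + t ^ 2)⁻¹ • g t) =
      fun t : ℝ => g t / (t - Complex.I) * ((t : ℂ) - (-Complex.I))⁻¹ := by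
    ext t
    have h2 : ((t : ℂ) - Complex.I) * (t - (-Complex.I)) = ((1 + t ^ 2 : ℝ) : ℂ) := by
      push_cast; linear_combination (-1 : ℂ) * Complex.I_sq
    rw [div_mul_eq_mul_div, mul_div_assoc, Complex.real_smul, mul_comm, Complex.ofReal_inv, ← h2,
      mul_inv, div_eq_mul_inv, mul_comm ((t : ℂ) - Complex.I)⁻¹]
  rw [h1]
  refine (integrable_div_of_memLp hg (by simp)).mul_bdd (c := 1)
    (continuous_inv_ofReal_sub (by simp)).aestronglyMeasurable (Eventually.of_forall fun t => ?_)
  have := abs_im_le_norm_sub t (-Complex.I)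
  rw [norm_inv]
  exact inv_le_one_of_one_le₀ (by simpa using this)

/-- A square-integrable function whose Cauchy integral represents `G` and vanishes in the lower
half-plane has Poisson integral `G`. -/
lemma integral_halfPlanePoisson_smul_eq {g : ℝ → ℂ} (hg : MemLp g 2) {z : ℂ} (hz : 0 < z.im)
    {w : ℂ} (h1 : ∫ t : ℝ, g t / (t - z) = 2 * Real.pi * Complex.I * w)
    (h2 : ∫ t : ℝ, g t / (t - conj z) = 0) :
    ∫ t, halfPlanePoisson z.re z.im t • g t = w := by
  have hne : (2 * Real.pi * Complex.I : ℂ) ≠ 0 := by simp [Real.pi_ne_zero]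
  rw [← mul_right_inj' hne, ← h1, ← sub_zero (∫ t : ℝ, g t / (t - z)), ← h2,
    ← integral_sub (integrable_div_of_memLp hg hz.ne')
      (integrable_div_of_memLp hg (by simpa using hz.ne')), ← integral_const_mul]
  congr 1; ext t
  rw [Complex.real_smul, ← mul_assoc, two_pi_I_mul_halfPlanePoisson t hz]
  ring

lemma add_mul_I_re (x y : ℝ) : ((x : ℂ) + y * Complex.I).re = x := by simp

lemma add_mul_I_im (x y : ℝ) : ((x : ℂ) + y * Complex.I).im = y := by simp

/-- Under these conditions G is the Poisson integral of g, so Fatou's theorem applies. -/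
lemma hasBoundaryValues_of_cauchy {G : ℂ → ℂ} {g : ℝ → ℂ} (hg : MemLp g 2)
    (h1 : ∀ z ∈ upperHalf, ∫ t : ℝ, g t / (t - z) = 2 * Real.pi * Complex.I * G z)
    (h2 : ∀ z : ℂ, z.im < 0 → ∫ t : ℝ, g t / (t - z) = 0) : HasBoundaryValues G g := by
  filter_upwards [ae_tendsto_integral_halfPlanePoisson hg.integrable_inv_one_add_sq_smul] with x hx
  refine hx.congr' ?_
  filter_upwards [self_mem_nhdsWithin] with y hy
  have hmem := add_mul_I_mem_upperHalf x hy
  have := integral_halfPlanePoisson_smul_eq hg hmem (h1 _ hmem) (h2 _ (by simpa using hy))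
  rwa [add_mul_I_re, add_mul_I_im] at this

/-- Functions in `H²` have square-integrable boundary values, which represent the function by
Cauchy's formula. -/
theorem IsHardyTwo.exists_boundary {G : ℂ → ℂ} (hG : IsHardyTwo G) :
    ∃ g : ℝ → ℂ, MemLp g 2 ∧
      (∀ z ∈ upperHalf, ∫ t : ℝ, g t / (t - z) = 2 * Real.pi * Complex.I * G z) ∧
      ∀ z : ℂ, z.im < 0 → ∫ t : ℝ, g t / (t - z) = 0 := by
  obtain ⟨C, hC0, hC⟩ := (isHardyTwo_iff.1 hG).2
  let H := Lp ℂ 2 (volume : Measure ℝ)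
  -- The value 0 for ε ≤ 0 is a filler: the limit below is taken along a filter living on ε > 0.
  let γ : ℝ → H := fun ε => if hε : 0 < ε then (hG.memLp hε).toLp _ else 0
  have hγ : ∀ ε (hε : 0 < ε), γ ε = (hG.memLp hε).toLp _ := fun ε hε => dif_pos hε
  let Φ : ℝ → WeakDual ℂ H := fun ε => StrongDual.toWeakDual (InnerProductSpace.toDual ℂ H (γ ε))
  have hcpt := WeakDual.isCompact_closedBall (𝕜 := ℂ) (E := H) 0 (√C)
  have hmem : ∀ ε, Φ ε ∈ WeakDual.toStrongDual ⁻¹' Metric.closedBall (0 : StrongDual ℂ H) (√C) := by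
    intro ε
    change InnerProductSpace.toDual ℂ H (γ ε) ∈ Metric.closedBall (0 : StrongDual ℂ H) (√C)
    rw [mem_closedBall_zero_iff, LinearIsometryEquiv.norm_map]
    by_cases hε : 0 < ε
    · refine Real.le_sqrt_of_sq_le ?_
      rw [hγ ε hε, ← @inner_self_eq_norm_sq ℂ, integral_toLp_inner]
      refine le_trans (le_of_eq ?_) (hC ε hε).2
      have : ∀ t : ℝ, conj (G (t + ε * Complex.I)) * G (t + ε * Complex.I) =
          ((‖G (t + ε * Complex.I)‖ ^ 2 : ℝ) : ℂ) := by
        intro t; rw [Complex.conj_mul']; push_cast; rfl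
      simp_rw [this]
      rw [integral_complex_ofReal]; simp
    · simp [γ, hε]
  -- The restrictions of G to horizontal lines are bounded in L², so Banach–Alaoglu gives a weak
  -- limit g along an ultrafilter finer than ε → 0+. Cauchy kernels are L² test functions, so
  -- Cauchy's formula on lines passes to the limit.
  set U : Ultrafilter ℝ := Ultrafilter.of (𝓝[>] (0 : ℝ)) with hU
  have hUle : (U : Filter ℝ) ≤ 𝓝[>] (0 : ℝ) := Ultrafilter.of_le _
  obtain ⟨ψ, -, hψ⟩ := hcpt.ultrafilter_le_nhds (U.map Φ) (by
    rw [le_principal_iff]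
    exact Filter.mem_map.2 (Filter.univ_mem' hmem))
  have hψ' : Tendsto Φ U (𝓝 ψ) := hψ
  set g : H := (InnerProductSpace.toDual ℂ H).symm (WeakDual.toStrongDual ψ) with hg
  have hconv : ∀ φ : H, Tendsto (fun ε => inner ℂ (γ ε) φ) U (𝓝 (inner ℂ g φ)) := by
    intro φ
    have h1 := ((WeakDual.eval_continuous (𝕜 := ℂ) φ).tendsto ψ).comp hψ'
    have h2 : inner ℂ g φ = ψ φ := by
      rw [hg, InnerProductSpace.toDual_symm_apply]; rfl
    rw [h2]
    exact h1
  have hgm : MemLp (g : ℝ → ℂ) 2 := Lp.memLp g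
  have hkey : ∀ z : ℂ, z.im ≠ 0 → Tendsto (fun ε : ℝ => ∫ t : ℝ, G (t + ε * Complex.I) / (t - z)) U
      (𝓝 (∫ t : ℝ, g t / (t - z))) := by
    intro z hz
    have hz' : (conj z).im ≠ 0 := by simpa using hz
    have hk := memLp_inv_ofReal_sub hz'
    have h1 := (Complex.continuous_conj.tendsto _).comp (hconv (hk.toLp _))
    have h2 : ∀ f : ℝ → ℂ, ∀ hf : MemLp f 2, conj (inner ℂ (hf.toLp f) (hk.toLp _)) =
        ∫ t : ℝ, f t / (t - z) := by
      intro f hf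
      rw [inner_conj_symm, integral_toLp_inner hk hf]
      congr 1; ext t
      simp [div_eq_inv_mul]
    have h3 := h2 g hgm
    rw [Lp.toLp_coeFn] at h3
    rw [h3] at h1
    refine h1.congr' ?_
    filter_upwards [hUle self_mem_nhdsWithin] with ε hε
    simp only [Function.comp]
    rw [hγ ε hε, h2]
  refine ⟨g, hgm, fun z hz => ?_, fun z hz => ?_⟩
  · have hz' : 0 < z.im := hz
    refine tendsto_nhds_unique (hkey z hz'.ne') ?_
    have h4 : Tendsto (fun ε : ℝ => 2 * Real.pi * Complex.I * G (z + ε * Complex.I)) U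
        (𝓝 (2 * Real.pi * Complex.I * G z)) := by
      refine Tendsto.const_mul _ ?_
      have h5 : ContinuousAt G z := (hG.1.differentiableAt (isOpen_upperHalf.mem_nhds hz)).continuousAt
      have h6 : Tendsto (fun ε : ℝ => z + ε * Complex.I) (𝓝 0) (𝓝 z) := by
        have : Continuous fun ε : ℝ => z + ε * Complex.I := by fun_prop
        simpa using this.tendsto 0
      exact (h5.tendsto.comp h6).mono_left (hUle.trans nhdsWithin_le_nhds)
    refine h4.congr' ?_
    filter_upwards [hUle self_mem_nhdsWithin, (hUle.trans nhdsWithin_le_nhds) (gt_mem_nhds hz')]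
      with ε hε hεz
    exact (hG.integral_line_upper hε hεz).symm
  · refine tendsto_nhds_unique (hkey z hz.ne) ?_
    refine tendsto_const_nhds.congr' ?_
    filter_upwards [hUle self_mem_nhdsWithin,
      (hUle.trans nhdsWithin_le_nhds) (gt_mem_nhds (neg_pos.2 hz))] with ε hε hεz
    exact (hG.integral_line_lower hε (by
      have : ε < -z.im := hεz
      linarith)).symm

lemma HasBoundaryValues.ae_eq {G : ℂ → ℂ} {f g : ℝ → ℂ} (hf : HasBoundaryValues G f)
    (hg : HasBoundaryValues G g) : f =ᵐ[volume] g := by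
  filter_upwards [hf, hg] with t h1 h2 using tendsto_nhds_unique h1 h2

lemma HasBoundaryValues.congr_ae {G : ℂ → ℂ} {f g : ℝ → ℂ} (hf : HasBoundaryValues G f)
    (hfg : f =ᵐ[volume] g) : HasBoundaryValues G g := by
  filter_upwards [hf, hfg] with t h1 h2
  rwa [← h2]

lemma HasBoundaryValues.mul {F G : ℂ → ℂ} {f g : ℝ → ℂ} (hf : HasBoundaryValues F f)
    (hg : HasBoundaryValues G g) : HasBoundaryValues (fun z => F z * G z) fun t => f t * g t := by
  filter_upwards [hf, hg] with t h1 h2 using h1.mul h2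

lemma HasBoundaryValues.add {F G : ℂ → ℂ} {f g : ℝ → ℂ} (hf : HasBoundaryValues F f)
    (hg : HasBoundaryValues G g) : HasBoundaryValues (fun z => F z + G z) fun t => f t + g t := by
  filter_upwards [hf, hg] with t h1 h2 using h1.add h2

lemma HasBoundaryValues.congr {F G : ℂ → ℂ} {f : ℝ → ℂ} (hf : HasBoundaryValues F f)
    (hFG : ∀ z ∈ upperHalf, F z = G z) : HasBoundaryValues G f := by
  filter_upwards [hf] with t h1
  refine h1.congr' ?_
  filter_upwards [self_mem_nhdsWithin] with y hy using hFG _ (add_mul_I_mem_upperHalf t hy)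

lemma tendsto_vertical (t : ℝ) :
    Tendsto (fun y : ℝ => (t : ℂ) + y * Complex.I) (𝓝[>] 0) (𝓝 (t : ℂ)) := by
  have : Continuous fun y : ℝ => (t : ℂ) + y * Complex.I := by fun_prop
  have h := this.tendsto 0
  simp only [Complex.ofReal_zero, zero_mul, add_zero] at h
  exact h.mono_left nhdsWithin_le_nhds

lemma hasBoundaryValues_of_continuousAt {F : ℂ → ℂ} (hF : ∀ t : ℝ, ContinuousAt F t) :
    HasBoundaryValues F fun t => F t :=
  Eventually.of_forall fun t => (hF t).tendsto.comp (tendsto_vertical t)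

/-- Cauchy's formula for a function in `H²` with given boundary values. -/
theorem IsHardyTwo.cauchy {G : ℂ → ℂ} (hG : IsHardyTwo G) {g : ℝ → ℂ}
    (hGg : HasBoundaryValues G g) : MemLp g 2 ∧
      (∀ z ∈ upperHalf, ∫ t : ℝ, g t / (t - z) = 2 * Real.pi * Complex.I * G z) ∧
      ∀ z : ℂ, z.im < 0 → ∫ t : ℝ, g t / (t - z) = 0 := by
  obtain ⟨g', hg', h1, h2⟩ := hG.exists_boundary
  have hae : g' =ᵐ[volume] g := (hasBoundaryValues_of_cauchy hg' h1 h2).ae_eq hGg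
  have hint : ∀ z : ℂ, ∫ t : ℝ, g t / (t - z) = ∫ t : ℝ, g' t / (t - z) := fun z =>
    integral_congr_ae (by filter_upwards [hae] with t ht; rw [ht])
  exact ⟨(memLp_congr_ae hae).1 hg', fun z hz => (hint z).trans (h1 z hz),
    fun z hz => (hint z).trans (h2 z hz)⟩

theorem IsHardyTwo.exists_hasBoundaryValues {G : ℂ → ℂ} (hG : IsHardyTwo G) :
    ∃ g : ℝ → ℂ, HasBoundaryValues G g := by
  obtain ⟨g', hg', h1, h2⟩ := hG.exists_boundary
  exact ⟨g', hasBoundaryValues_of_cauchy hg' h1 h2⟩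

/-- **Fatou's theorem** for bounded holomorphic functions. -/
theorem IsHardyInfty.exists_hasBoundaryValues {b : ℂ → ℂ} (hb : IsHardyInfty b) :
    ∃ g : ℝ → ℂ, HasBoundaryValues b g := by
  have him : (-Complex.I).im < 0 := by simp
  -- Dividing b by z + i puts it into H²; the factor is restored on the boundary.
  obtain ⟨g, hg⟩ := ((isHardyTwo_inv_sub him).bdd_mul hb).exists_hasBoundaryValues
  refine ⟨fun t => g t * (t - -Complex.I), ?_⟩
  refine (hg.mul (hasBoundaryValues_of_continuousAt (F := fun z => z - -Complex.I)
    (by fun_prop))).congr fun z hz => ?_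
  have hne : z - -Complex.I ≠ 0 := by
    intro h
    have hz' : 0 < z.im := hz
    have := congrArg Complex.im h
    simp at this
    linarith
  exact inv_mul_cancel_right₀ hne _

/-- Since g need not be integrable, regularize: 1/(t − z) = 1/(t + i) + (z + i)/((t + i)(t − z)),
where g/(t + i) is integrable. -/
lemma differentiableOn_cauchy_of_memLp {g : ℝ → ℂ} (hg : MemLp g 2) :
    DifferentiableOn ℂ (fun z => ∫ t : ℝ, g t / (t - z)) upperHalf := by
  have hi := integrable_div_of_memLp hg (z := -Complex.I) (by simp)
  have h0 := ((differentiableOn_cauchy_integral hi).const_mul 1)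
  have h1 : DifferentiableOn ℂ (fun z => (∫ t : ℝ, g t / (t - -Complex.I)) +
      (z + Complex.I) * ∫ t : ℝ, g t / (t - -Complex.I) / (t - z)) upperHalf :=
    (differentiableOn_const _).add
      (DifferentiableOn.mul (by fun_prop) (differentiableOn_cauchy_integral hi))
  refine h1.congr fun z hz => ?_
  have hz' : z.im ≠ 0 := ne_of_gt hz
  rw [← integral_const_mul, ← integral_add hi ((integrable_div_ofReal_sub hi hz').const_mul _)]
  congr 1; ext t
  have h2 := ofReal_sub_ne_zero t hz'
  have h3 := ofReal_sub_ne_zero t (z := -Complex.I) (by simp)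
  field_simp
  ring

/-- A square-integrable function annihilated by the Cauchy kernels of the lower half-plane is the
boundary function of an element of `H²`. -/
theorem isHardyTwo_of_cauchy {G : ℂ → ℂ} {g : ℝ → ℂ} (hg : MemLp g 2)
    (h1 : ∀ z ∈ upperHalf, ∫ t : ℝ, g t / (t - z) = 2 * Real.pi * Complex.I * G z)
    (h2 : ∀ z : ℂ, z.im < 0 → ∫ t : ℝ, g t / (t - z) = 0) : IsHardyTwo G := by
  have hne : (2 * Real.pi * Complex.I : ℂ) ≠ 0 := by simp [Real.pi_ne_zero]
  refine ⟨?_, ∫ t, ‖g t‖ ^ 2, fun y hy => ?_⟩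
  · refine ((differentiableOn_cauchy_of_memLp hg).const_mul
      (2 * Real.pi * Complex.I : ℂ)⁻¹).congr fun z hz => ?_
    rw [h1 z hz, inv_mul_cancel_left₀ hne]
  · have hP : ∀ t : ℝ, G (t + y * Complex.I) = ∫ s, halfPlanePoisson t y s • g s := by
      intro t
      have hmem := add_mul_I_mem_upperHalf t hy
      have := integral_halfPlanePoisson_smul_eq hg hmem (h1 _ hmem) (h2 _ (by simpa using hy))
      rw [add_mul_I_re, add_mul_I_im] at this
      exact this.symm
    have hPi := integrable_halfPlanePoisson
    -- Cauchy–Schwarz for the probability measure with Poisson density. Integrating in t afterwards,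
    -- by Tonelli and the symmetry of the kernel, costs nothing: the L² norm on each line is at most
    -- that of g.
    have hpt : ∀ t : ℝ, ENNReal.ofReal (‖G (t + y * Complex.I)‖ ^ 2) ≤
        ∫⁻ s, ENNReal.ofReal (halfPlanePoisson t y s) * ENNReal.ofReal (‖g s‖ ^ 2) := by
      intro t
      have hi1 := integrable_halfPlanePoisson_smul hg.integrable_inv_one_add_sq_smul t hy
      have hcs : ‖G (t + y * Complex.I)‖ₑ ≤
          ∫⁻ s, ENNReal.ofReal (halfPlanePoisson t y s) * ‖g s‖ₑ := by
        rw [hP]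
        refine (enorm_integral_le_lintegral_enorm _).trans (le_of_eq ?_)
        congr 1; ext s
        rw [enorm_smul, Real.enorm_of_nonneg (halfPlanePoisson_nonneg t hy s)]
      have hw : AEMeasurable (fun s => ENNReal.ofReal (halfPlanePoisson t y s)) :=
        (continuous_halfPlanePoisson t hy).measurable.ennreal_ofReal.aemeasurable
      set μ := (volume : Measure ℝ).withDensity fun s => ENNReal.ofReal (halfPlanePoisson t y s)
        with hμ
      have hμ1 : μ Set.univ = 1 := by
        rw [hμ, withDensity_apply _ MeasurableSet.univ, Measure.restrict_univ,
          ← ofReal_integral_eq_lintegral_ofReal (hPi t hy)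
          (Eventually.of_forall fun s => halfPlanePoisson_nonneg t hy s),
          integral_halfPlanePoisson t hy, ENNReal.ofReal_one]
      have hgμ : AEMeasurable (fun s => ‖g s‖ₑ) μ :=
        hg.1.enorm.mono_ac (withDensity_absolutelyContinuous _ _)
      have hconv : ∀ φ : ℝ → ℝ≥0∞, AEMeasurable φ →
          ∫⁻ s, ENNReal.ofReal (halfPlanePoisson t y s) * φ s = ∫⁻ s, φ s ∂μ := by
        intro φ hφ
        rw [hμ, lintegral_withDensity_eq_lintegral_mul₀ hw hφ]
        rfl
      have h3 := ENNReal.lintegral_mul_le_Lp_mul_Lq μ (p := 2) (q := 2)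
        (by constructor <;> norm_num) hgμ (aemeasurable_const (b := (1 : ℝ≥0∞)))
      simp only [Pi.mul_apply, mul_one, ENNReal.one_rpow, lintegral_const, hμ1] at h3
      have h4 : ENNReal.ofReal (‖G (t + y * Complex.I)‖ ^ 2) = ‖G (t + y * Complex.I)‖ₑ ^ 2 := by
        rw [ENNReal.ofReal_pow (norm_nonneg _), ofReal_norm]
      have h5 : ∀ s, ENNReal.ofReal (‖g s‖ ^ 2) = ‖g s‖ₑ ^ (2 : ℝ) := by
        intro s
        rw [ENNReal.ofReal_pow (norm_nonneg _), ofReal_norm, ENNReal.rpow_two]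
      rw [h4]
      simp_rw [h5]
      rw [hconv _ (hg.1.enorm.pow_const _)]
      calc _ ≤ (∫⁻ s, ‖g s‖ₑ ∂μ) ^ 2 := by
            gcongr
            rw [← hconv _ hg.1.enorm]
            exact hcs
        _ ≤ ((∫⁻ s, ‖g s‖ₑ ^ (2 : ℝ) ∂μ) ^ (1 / 2 : ℝ)) ^ 2 := by gcongr
        _ = _ := by
          rw [← ENNReal.rpow_natCast, ← ENNReal.rpow_mul]; norm_num
    calc _ ≤ ∫⁻ t, ∫⁻ s, ENNReal.ofReal (halfPlanePoisson t y s) * ENNReal.ofReal (‖g s‖ ^ 2) :=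
          lintegral_mono hpt
      _ = ∫⁻ s, ∫⁻ t, ENNReal.ofReal (halfPlanePoisson t y s) * ENNReal.ofReal (‖g s‖ ^ 2) := by
          have hm1 : AEMeasurable (fun p : ℝ × ℝ => ENNReal.ofReal (halfPlanePoisson p.1 y p.2))
              (volume.prod volume) := by
            refine (Continuous.measurable ?_).ennreal_ofReal.aemeasurable
            unfold halfPlanePoisson
            refine continuous_const.mul (Continuous.inv₀ (by fun_prop) fun t => ?_)
            positivity
          have hm2 : AEMeasurable (fun p : ℝ × ℝ => ENNReal.ofReal (‖g p.2‖ ^ 2))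
              (volume.prod volume) :=
            (hg.1.norm.pow 2).aemeasurable.ennreal_ofReal.comp_snd
          exact lintegral_lintegral_swap (hm1.mul hm2)
      _ = ∫⁻ s, ENNReal.ofReal (‖g s‖ ^ 2) := by
          congr 1; ext s
          rw [lintegral_mul_const' _ _ ENNReal.ofReal_ne_top]
          simp_rw [halfPlanePoisson_symm _ s]
          rw [← ofReal_integral_eq_lintegral_ofReal (hPi s hy)
            (Eventually.of_forall fun t => halfPlanePoisson_nonneg s hy t),
            integral_halfPlanePoisson s hy, ENNReal.ofReal_one, one_mul]
      _ ≤ _ := by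
          rw [ofReal_integral_eq_lintegral_ofReal hg.integrable_norm_sq
            (Eventually.of_forall fun t => by positivity)]

lemma HasBoundaryValues.aemeasurable {G : ℂ → ℂ} {g : ℝ → ℂ} (hg : HasBoundaryValues G g)
    (hG : DifferentiableOn ℂ G upperHalf) : AEMeasurable g := by
  have hseq : Tendsto (fun n : ℕ => 1 / ((n : ℝ) + 1)) atTop (𝓝[>] 0) :=
    tendsto_nhdsWithin_iff.2 ⟨tendsto_one_div_add_atTop_nhds_zero_nat,
      Eventually.of_forall fun n => by simpa using by positivity⟩
  refine aemeasurable_of_tendsto_metrizable_ae' (fun n : ℕ =>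
    (continuous_on_line hG (y := 1 / ((n : ℝ) + 1)) (by positivity)).measurable.aemeasurable) ?_
  filter_upwards [hg] with t ht using ht.comp hseq

/-! ### Outer functions as exponentials of Schwarz integrals. -/

section Outer

/-- The outer function with boundary modulus `exp u`, as the exponential of a Schwarz integral. -/
def schwarzOuter (u : ℝ → ℝ) (z : ℂ) : ℂ :=
  Complex.exp ((1 / (Real.pi * Complex.I)) *
    ∫ t : ℝ, (1 + t * z) / ((t - z) * (1 + t ^ 2)) * (u t : ℂ))

lemma ofReal_one_add_sq_ne_zero (t : ℝ) : (1 + (t : ℂ) ^ 2) ≠ 0 := by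
  have : ((1 + t ^ 2 : ℝ) : ℂ) ≠ 0 := by
    rw [Complex.ofReal_ne_zero]; positivity
  exact_mod_cast this

/-- Separates the Schwarz kernel into a term linear in z and a Cauchy kernel against the integrable
density c/(1 + t²), so integrability and holomorphy reduce to those of Cauchy integrals. -/
lemma schwarz_kernel_eq (t : ℝ) {z : ℂ} (hz : z.im ≠ 0) (c : ℂ) :
    (1 + t * z) / ((t - z) * (1 + t ^ 2)) * c =
      z * (c / (1 + t ^ 2)) + (1 + z ^ 2) * (c / (1 + t ^ 2) / (t - z)) := by
  have h1 := ofReal_sub_ne_zero t hz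
  have h2 := ofReal_one_add_sq_ne_zero t
  field_simp
  ring

variable {u v : ℝ → ℝ}

lemma integrable_ofReal_div (hu : Integrable fun t : ℝ => (1 + t ^ 2)⁻¹ • u t) :
    Integrable fun t : ℝ => (u t : ℂ) / (1 + (t : ℂ) ^ 2) := by
  refine hu.ofReal (𝕜 := ℂ) |>.congr (Eventually.of_forall fun t => ?_)
  simp [div_eq_inv_mul]

lemma integrable_schwarz (hu : Integrable fun t : ℝ => (1 + t ^ 2)⁻¹ • u t) {z : ℂ}
    (hz : z.im ≠ 0) :
    Integrable fun t : ℝ => (1 + t * z) / ((t - z) * (1 + t ^ 2)) * (u t : ℂ) := by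
  simp_rw [schwarz_kernel_eq _ hz]
  have h1 := integrable_ofReal_div hu
  exact (h1.const_mul _).add ((integrable_div_ofReal_sub h1 hz).const_mul _)

lemma schwarzOuter_ne_zero (u : ℝ → ℝ) (z : ℂ) : schwarzOuter u z ≠ 0 := Complex.exp_ne_zero _

lemma differentiableOn_schwarzOuter (hu : Integrable fun t : ℝ => (1 + t ^ 2)⁻¹ • u t) :
    DifferentiableOn ℂ (schwarzOuter u) upperHalf := by
  have h1 := integrable_ofReal_div hu
  refine DifferentiableOn.cexp (DifferentiableOn.const_mul ?_ _)
  have h2 : DifferentiableOn ℂ (fun z : ℂ => z * (∫ t : ℝ, (u t : ℂ) / (1 + (t : ℂ) ^ 2)) +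
      (1 + z ^ 2) * ∫ t : ℝ, (u t : ℂ) / (1 + (t : ℂ) ^ 2) / (t - z)) upperHalf :=
    DifferentiableOn.add (by fun_prop)
      (DifferentiableOn.mul (by fun_prop) (differentiableOn_cauchy_integral h1))
  refine h2.congr fun z hz => ?_
  have hz' : z.im ≠ 0 := ne_of_gt hz
  simp_rw [schwarz_kernel_eq _ hz']
  rw [integral_add (h1.const_mul _) ((integrable_div_ofReal_sub h1 hz').const_mul _),
    integral_const_mul, integral_const_mul]

lemma schwarzOuter_add (hu : Integrable fun t : ℝ => (1 + t ^ 2)⁻¹ • u t)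
    (hv : Integrable fun t : ℝ => (1 + t ^ 2)⁻¹ • v t) {z : ℂ} (hz : z ∈ upperHalf) :
    schwarzOuter (fun t => u t + v t) z = schwarzOuter u z * schwarzOuter v z := by
  have hz' : z.im ≠ 0 := ne_of_gt hz
  rw [schwarzOuter, schwarzOuter, schwarzOuter, ← Complex.exp_add, ← mul_add,
    ← integral_add (integrable_schwarz hu hz') (integrable_schwarz hv hz')]
  congr 3; ext t
  push_cast; ring

/-- Consequently the logarithm of the modulus of the outer function is the Poisson integral of u,
which yields both the maximum principle and the boundary modulus. -/
lemma re_schwarz_kernel (t : ℝ) {z : ℂ} (hz : z ∈ upperHalf) (c : ℝ) :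
    ((1 / (Real.pi * Complex.I)) * ((1 + t * z) / ((t - z) * (1 + t ^ 2)) * (c : ℂ))).re =
      halfPlanePoisson z.re z.im t * c := by
  have hz' : 0 < z.im := hz
  have h1 := ofReal_sub_ne_zero t hz'.ne'
  have h1' := ofReal_sub_ne_zero t (z := conj z) (by simpa using hz'.ne')
  have h2 := ofReal_one_add_sq_ne_zero t
  have hpi : (Real.pi : ℂ) ≠ 0 := by exact_mod_cast Real.pi_ne_zero
  have key : (1 / (Real.pi * Complex.I)) * ((1 + t * z) / ((t - z) * (1 + t ^ 2)) * (c : ℂ)) +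
      conj ((1 / (Real.pi * Complex.I)) * ((1 + t * z) / ((t - z) * (1 + t ^ 2)) * (c : ℂ))) =
      2 * ((halfPlanePoisson z.re z.im t * c : ℝ) : ℂ) := by
    have h3 := two_pi_I_mul_halfPlanePoisson t hz'
    have h4 : (halfPlanePoisson z.re z.im t : ℂ) =
        (((t : ℂ) - z)⁻¹ - ((t : ℂ) - conj z)⁻¹) / (2 * Real.pi * Complex.I) := by
      rw [← h3]; field_simp
    rw [Complex.ofReal_mul, h4]
    simp only [map_mul, map_div₀, map_add, map_sub, map_one, map_pow, Complex.conj_ofReal,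
      Complex.conj_I]
    field_simp
    ring
  have h5 := congrArg Complex.re key
  have h6 : ∀ x : ℝ, (2 * (x : ℂ)).re = 2 * x := fun x => by simp
  rw [Complex.add_re, Complex.conj_re, h6] at h5
  linarith

lemma norm_schwarzOuter (hu : Integrable fun t : ℝ => (1 + t ^ 2)⁻¹ • u t) {z : ℂ}
    (hz : z ∈ upperHalf) :
    ‖schwarzOuter u z‖ = Real.exp (∫ t, halfPlanePoisson z.re z.im t • u t) := by
  have hz' : z.im ≠ 0 := ne_of_gt hz
  rw [schwarzOuter, Complex.norm_exp, ← integral_const_mul]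
  congr 1
  refine (integral_re (𝕜 := ℂ)
    ((integrable_schwarz hu hz').const_mul (1 / (Real.pi * Complex.I)))).symm.trans ?_
  congr 1; ext t
  rw [RCLike.re_to_complex, re_schwarz_kernel t hz, smul_eq_mul]

lemma isHardyInfty_schwarzOuter (hu : Integrable fun t : ℝ => (1 + t ^ 2)⁻¹ • u t) {c : ℝ}
    (hc : ∀ᵐ t, u t ≤ c) : DifferentiableOn ℂ (schwarzOuter u) upperHalf ∧
      ∀ z ∈ upperHalf, ‖schwarzOuter u z‖ ≤ Real.exp c := by
  refine ⟨differentiableOn_schwarzOuter hu, fun z hz => ?_⟩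
  rw [norm_schwarzOuter hu hz]
  have hz' : 0 < z.im := hz
  gcongr
  calc _ ≤ ∫ t, halfPlanePoisson z.re z.im t * c := by
        refine integral_mono_ae (integrable_halfPlanePoisson_smul hu _ hz')
          ((integrable_halfPlanePoisson _ hz').mul_const _) ?_
        filter_upwards [hc] with t ht
        exact mul_le_mul_of_nonneg_left ht (halfPlanePoisson_nonneg _ hz' _)
    _ = c := by rw [integral_mul_const, integral_halfPlanePoisson _ hz', one_mul]

/-- The boundary values of an outer function have the prescribed modulus. -/
lemma exists_hasBoundaryValues_schwarzOuter
    (hu : Integrable fun t : ℝ => (1 + t ^ 2)⁻¹ • u t) {c : ℝ} (hc : ∀ᵐ t, u t ≤ c) :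
    ∃ o : ℝ → ℂ, AEMeasurable o ∧ HasBoundaryValues (schwarzOuter u) o ∧
      ∀ᵐ t, ‖o t‖ = Real.exp (u t) := by
  have hb : IsHardyInfty (schwarzOuter u) := by
    obtain ⟨h1, h2⟩ := isHardyInfty_schwarzOuter hu hc
    exact ⟨h1, _, h2⟩
  obtain ⟨o, ho⟩ := hb.exists_hasBoundaryValues
  refine ⟨o, ho.aemeasurable hb.1, ho, ?_⟩
  filter_upwards [ho, ae_tendsto_integral_halfPlanePoisson hu] with t h1 h2
  refine tendsto_nhds_unique h1.norm (((Real.continuous_exp.tendsto _).comp h2).congr' ?_)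
  filter_upwards [self_mem_nhdsWithin] with y hy
  have := norm_schwarzOuter hu (add_mul_I_mem_upperHalf t hy)
  rw [add_mul_I_re, add_mul_I_im] at this
  exact this.symm

end Outer

/-! ### Blaschke products with zeros on the imaginary axis. -/

section Blaschke

namespace ScatteringData

variable {Λ : Set ℂ}

/-- The weight in the Blaschke condition. -/
def blaschkeWeight (w : ℂ) : ℝ := if w.im ≤ 1 then w.im else w.im⁻¹

lemma summable_blaschkeWeight (D : ScatteringData Λ) : Summable fun w : Λ => blaschkeWeight (w : ℂ) := by
  rw [← summable_subtype_and_compl (s := {w : Λ | (w : ℂ).im ≤ 1})]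
  refine ⟨D.blaschke_small.congr fun w => ?_, ?_⟩
  · exact (if_pos w.2).symm
  · have e : ({w : Λ | (w : ℂ).im ≤ 1}ᶜ : Set Λ) = {w : Λ | 1 < (w : ℂ).im} := by
      ext w; simp
    rw [e]
    exact D.blaschke_large.congr fun w => (if_neg (not_le.2 w.2)).symm

lemma norm_blaschkeFactor_le_one {w z : ℂ} (hw : 0 < w.im) (hz : 0 < z.im) :
    ‖blaschkeFactor w z‖ ≤ 1 := by
  have h0 : ‖(z - w) / (z - conj w)‖ ≤ 1 := by
    rw [norm_div]
    refine div_le_one_of_le₀ ?_ (norm_nonneg _)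
    rw [← sq_le_sq₀ (norm_nonneg _) (norm_nonneg _), ← Complex.normSq_eq_norm_sq,
      ← Complex.normSq_eq_norm_sq, Complex.normSq_apply, Complex.normSq_apply]
    simp
    nlinarith [mul_pos hw hz]
  unfold blaschkeFactor
  split_ifs
  · exact h0
  · rwa [norm_neg]

lemma blaschkeFactor_self (w : ℂ) : blaschkeFactor w w = 0 := by
  simp [blaschkeFactor]

lemma sub_conj_ne_zero {w z : ℂ} (hw : 0 < w.im) (hz : 0 < z.im) : z - conj w ≠ 0 := by
  intro h
  have := congrArg Complex.im h
  simp at this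
  linarith

lemma conj_eq_neg (D : ScatteringData Λ) (w : Λ) : conj (w : ℂ) = -w := by
  apply Complex.ext <;> simp [D.re_eq_zero w w.2]

/-- As conj w = −w, the factor minus 1 equals −2w/(z + w) when Im w ≤ 1. The sign change for Im w >
1 turns it into −2z/(z + w). So the factors tend to 1 both as w → 0 and as w → ∞, at the rate of the
Blaschke weight. -/
lemma norm_blaschkeFactor_sub_one_le (D : ScatteringData Λ) (w : Λ) {z : ℂ} (hz : 0 < z.im) :
    ‖blaschkeFactor w z - 1‖ ≤ (2 / z.im + 2 * ‖z‖) * blaschkeWeight w := by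
  have hw := D.im_pos w w.2
  have hne := sub_conj_ne_zero hw hz
  have hwn : ‖(w : ℂ)‖ = (w : ℂ).im := by
    have : (w : ℂ) = ((w : ℂ).im : ℂ) * Complex.I := by
      apply Complex.ext <;> simp [D.re_eq_zero w w.2]
    rw [this, norm_mul, Complex.norm_I, mul_one, Complex.norm_real, Real.norm_of_nonneg]
    · simp
    · simpa using hw.le
  have him : z.im + (w : ℂ).im ≤ ‖z - conj (w : ℂ)‖ := by
    refine le_trans (le_of_eq ?_) (Complex.im_le_norm _)
    simp
  have hz2 : 0 ≤ ‖z‖ := norm_nonneg z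
  rw [D.conj_eq_neg] at hne him
  unfold blaschkeFactor blaschkeWeight
  rw [D.conj_eq_neg]
  split_ifs with h
  · have e : (z - w) / (z - -(w : ℂ)) - 1 = -(2 * w) / (z - -(w : ℂ)) := by
      field_simp; ring
    rw [e, norm_div, norm_neg, norm_mul, hwn, Complex.norm_ofNat, div_le_iff₀ (by linarith)]
    have h1 : 2 * (w : ℂ).im = 2 / z.im * (w : ℂ).im * z.im := by field_simp
    have h2 : 2 / z.im * (w : ℂ).im * z.im ≤
        (2 / z.im + 2 * ‖z‖) * (w : ℂ).im * ‖z - -(w : ℂ)‖ := by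
      gcongr
      · linarith
      · linarith
    linarith
  · have e : -((z - w) / (z - -(w : ℂ))) - 1 = -(2 * z) / (z - -(w : ℂ)) := by
      field_simp; ring
    rw [e, norm_div, norm_neg, norm_mul, Complex.norm_ofNat, div_le_iff₀ (by linarith)]
    have h1 : 2 * ‖z‖ = 2 * ‖z‖ * (w : ℂ).im⁻¹ * (w : ℂ).im := by field_simp
    have h2 : 2 * ‖z‖ * (w : ℂ).im⁻¹ * (w : ℂ).im ≤
        (2 / z.im + 2 * ‖z‖) * (w : ℂ).im⁻¹ * ‖z - -(w : ℂ)‖ := by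
      gcongr
      · have : 0 ≤ 2 / z.im := by positivity
        linarith
      · linarith
    linarith

lemma summable_norm_blaschkeFactor_sub_one (D : ScatteringData Λ) {z : ℂ} (hz : 0 < z.im) :
    Summable fun w : Λ => ‖blaschkeFactor w z - 1‖ :=
  (D.summable_blaschkeWeight.mul_left _).of_nonneg_of_le (fun _ => norm_nonneg _)
    fun w => D.norm_blaschkeFactor_sub_one_le w hz

lemma multipliable_blaschkeFactor (D : ScatteringData Λ) (E : Finset Λ) {z : ℂ} (hz : 0 < z.im) :
    Multipliable fun w : {w : Λ // w ∉ E} => blaschkeFactor ((w : Λ) : ℂ) z := by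
  have := multipliable_one_add_of_summable ((D.summable_norm_blaschkeFactor_sub_one hz).subtype
    (fun w => w ∉ E))
  refine this.congr fun w => ?_
  simp

lemma norm_blaschkeProd_le_one (D : ScatteringData Λ) (E : Finset Λ) {z : ℂ} (hz : 0 < z.im) :
    ‖blaschkeProd Λ E z‖ ≤ 1 := by
  have h := (D.multipliable_blaschkeFactor E hz).hasProd
  refine le_of_tendsto h.norm (Eventually.of_forall fun s => ?_)
  exact Finset.prod_le_one (fun _ _ => norm_nonneg _) fun w _ =>
    norm_blaschkeFactor_le_one (D.im_pos _ (w : Λ).2) hz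

lemma blaschkeProd_eq_zero {E : Finset Λ} {w : Λ} (hw : w ∉ E) : blaschkeProd Λ E w = 0 :=
  tprod_of_exists_eq_zero ⟨⟨w, hw⟩, blaschkeFactor_self _⟩

lemma differentiableOn_blaschkeProd (D : ScatteringData Λ) (E : Finset Λ) :
    DifferentiableOn ℂ (blaschkeProd Λ E) upperHalf := by
  intro z hz
  have hz' : 0 < z.im := hz
  set U := Metric.ball z (z.im / 2)
  have hU : ∀ ζ ∈ U, z.im / 2 < ζ.im ∧ ‖ζ‖ < ‖z‖ + z.im / 2 := by
    intro ζ hζ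
    have h1 := Complex.abs_im_le_norm (ζ - z)
    rw [Metric.mem_ball, dist_eq_norm] at hζ
    rw [Complex.sub_im] at h1
    have := neg_abs_le (ζ.im - z.im)
    have h2 := norm_sub_norm_le ζ z
    exact ⟨by linarith, by linarith⟩
  have hfd : ∀ w : {w : Λ // w ∉ E}, DifferentiableOn ℂ (blaschkeFactor ((w : Λ) : ℂ)) U := by
    intro w
    have h0 : DifferentiableOn ℂ
        (fun ζ => (ζ - ((w : Λ) : ℂ)) / (ζ - conj ((w : Λ) : ℂ))) U :=
      DifferentiableOn.div (by fun_prop) (by fun_prop) fun ζ hζ =>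
        sub_conj_ne_zero (D.im_pos _ (w : Λ).2) (by linarith [(hU ζ hζ).1])
    unfold blaschkeFactor
    split_ifs
    · exact h0
    · exact h0.neg
  -- Weierstrass M-test on a ball: the constant uses a lower bound for the height and an upper bound
  -- for the modulus over the ball.
  have hprod := Summable.hasProdLocallyUniformlyOn_one_add
    (f := fun (w : {w : Λ // w ∉ E}) ζ => blaschkeFactor ((w : Λ) : ℂ) ζ - 1)
    (u := fun w : {w : Λ // w ∉ E} => (2 / (z.im / 2) + 2 * (‖z‖ + z.im / 2)) * blaschkeWeight ((w : Λ) : ℂ))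
    (K := U) Metric.isOpen_ball ((D.summable_blaschkeWeight.subtype _).mul_left _)
    (Eventually.of_forall fun w ζ hζ => by
      have h3 := hU ζ hζ
      refine (D.norm_blaschkeFactor_sub_one_le w (by linarith)).trans ?_
      have : 0 ≤ blaschkeWeight ((w : Λ) : ℂ) := by
        have := D.im_pos _ (w : Λ).2
        unfold blaschkeWeight
        split_ifs <;> positivity
      gcongr
      · exact h3.1.le
      · exact h3.2.le)
    (fun w => (hfd w).continuousOn.sub continuousOn_const)
  simp only [add_sub_cancel] at hprod
  rw [hasProdLocallyUniformlyOn_iff_tendstoLocallyUniformlyOn] at hprod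
  have hd := hprod.differentiableOn (Eventually.of_forall fun s =>
    DifferentiableOn.fun_finsetProd fun w _ => hfd w) Metric.isOpen_ball
  exact (hd.differentiableAt (Metric.isOpen_ball.mem_nhds
    (Metric.mem_ball_self (half_pos hz')))).differentiableWithinAt

lemma isHardyInfty_blaschkeProd (D : ScatteringData Λ) (E : Finset Λ) : IsHardyInfty (blaschkeProd Λ E) :=
  ⟨D.differentiableOn_blaschkeProd E, 1, fun _ hz => D.norm_blaschkeProd_le_one E hz⟩

lemma isHardyInfty_blaschkeFactor (D : ScatteringData Λ) (w : Λ) : IsHardyInfty (blaschkeFactor (w : ℂ)) := by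
  refine ⟨?_, 1, fun z hz => norm_blaschkeFactor_le_one (D.im_pos _ w.2) hz⟩
  have h0 : DifferentiableOn ℂ (fun ζ => (ζ - (w : ℂ)) / (ζ - conj (w : ℂ))) upperHalf :=
    DifferentiableOn.div (by fun_prop) (by fun_prop) fun ζ hζ =>
      sub_conj_ne_zero (D.im_pos _ w.2) hζ
  unfold blaschkeFactor
  split_ifs
  · exact h0
  · exact h0.neg

/-- The quotient is the finite product over E' \ E. It lets two generators be written with the same
Blaschke product. -/
lemma blaschkeProd_eq_mul (D : ScatteringData Λ) {E E' : Finset Λ} (h : E ⊆ E') :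
    ∃ c : ℂ → ℂ, IsHardyInfty c ∧
      ∀ z ∈ upperHalf, blaschkeProd Λ E z = blaschkeProd Λ E' z * c z := by
  classical
  refine ⟨fun z => ∏ w ∈ E' \ E, blaschkeFactor (w : ℂ) z, ?_, fun z hz => ?_⟩
  · refine ⟨DifferentiableOn.fun_finsetProd fun w _ => (D.isHardyInfty_blaschkeFactor w).1, 1,
      fun z hz => ?_⟩
    rw [norm_prod]
    exact Finset.prod_le_one (fun _ _ => norm_nonneg _) fun w _ =>
      norm_blaschkeFactor_le_one (D.im_pos _ w.2) hz
  · set f : Λ → ℂ := fun w => blaschkeFactor (w : ℂ) z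
    have hind : ∀ E : Finset Λ, blaschkeProd Λ E z = ∏' w, {w : Λ | w ∉ E}.mulIndicator f w :=
      fun E => tprod_subtype {w : Λ | w ∉ E} f
    have hmul : ∀ E : Finset Λ, Multipliable ({w : Λ | w ∉ E}.mulIndicator f) := fun E =>
      multipliable_subtype_iff_mulIndicator.1 (D.multipliable_blaschkeFactor E hz)
    have hout : ∀ w ∉ E' \ E, (↑(E' \ E) : Set Λ).mulIndicator f w = 1 := fun w hw =>
      Set.mulIndicator_of_notMem (by simpa using hw) _
    have hfin : ∏ w ∈ E' \ E, f w = ∏' w, (↑(E' \ E) : Set Λ).mulIndicator f w := by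
      rw [tprod_eq_prod hout]
      exact Finset.prod_congr rfl fun w hw => (Set.mulIndicator_of_mem (by simpa using hw) _).symm
    change _ = _ * ∏ w ∈ E' \ E, f w
    rw [hind, hind, hfin, ← (hmul E').tprod_mul (multipliable_of_ne_finset_one hout)]
    congr 1; ext w
    by_cases h1 : w ∈ E
    · simp [Set.mulIndicator, h1, h h1]
    · by_cases h2 : w ∈ E' <;> simp [Set.mulIndicator, h1, h2]

/-- Bound |∏(1 + a_w) − 1| by exp(∑|a_w|) − 1, where the sum is the tail outside E. This makes the
value of the test function B'k̃ at z₀ close to that of k̃. -/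
lemma tendsto_blaschkeProd (D : ScatteringData Λ) {z : ℂ} (hz : 0 < z.im) :
    Tendsto (fun E : Finset Λ => blaschkeProd Λ E z) atTop (𝓝 1) := by
  have hs := D.summable_norm_blaschkeFactor_sub_one hz
  have hb : ∀ E : Finset Λ, ‖blaschkeProd Λ E z - 1‖ ≤
      Real.exp (∑' w : {w : Λ // w ∉ E}, ‖blaschkeFactor ((w : Λ) : ℂ) z - 1‖) - 1 := by
    intro E
    have h := (D.multipliable_blaschkeFactor E hz).hasProd
    refine le_of_tendsto (h.sub_const 1).norm (Eventually.of_forall fun s => ?_)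
    have h1 := s.norm_prod_one_add_sub_one_le
      fun w : {w : Λ // w ∉ E} => blaschkeFactor ((w : Λ) : ℂ) z - 1
    simp only [add_sub_cancel] at h1
    refine h1.trans ?_
    gcongr
    exact (hs.subtype _).sum_le_tsum s fun _ _ => norm_nonneg _
  rw [tendsto_iff_norm_sub_tendsto_zero]
  refine squeeze_zero (fun _ => norm_nonneg _) hb ?_
  have h2 := tendsto_tsum_compl_atTop_zero fun w : Λ => ‖blaschkeFactor (w : ℂ) z - 1‖
  have h3 := ((Real.continuous_exp.tendsto 0).comp h2).sub_const 1
  simpa using h3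

end ScatteringData

end Blaschke

/-! ### Vertical limits, reflections t ↦ −t and L² norms. -/

/-- The pointwise vertical limit on the real line of a function on the upper half-plane. -/
def verticalLimit (G : ℂ → ℂ) (t : ℝ) : ℂ :=
  limUnder (𝓝[>] (0 : ℝ)) fun y : ℝ => G (t + y * Complex.I)

lemma HasBoundaryValues.verticalLimit {G : ℂ → ℂ} {g : ℝ → ℂ} (hg : HasBoundaryValues G g) :
    HasBoundaryValues G (verticalLimit G) := by
  filter_upwards [hg] with t ht
  rwa [_root_.verticalLimit, ht.limUnder_eq]

lemma ae_comp_neg {p : ℝ → Prop} (h : ∀ᵐ t : ℝ, p t) : ∀ᵐ t : ℝ, p (-t) :=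
  (Measure.measurePreserving_neg (volume : Measure ℝ)).quasiMeasurePreserving.ae h

lemma AEMeasurable.comp_neg_real {f : ℝ → ℂ} (hf : AEMeasurable f) :
    AEMeasurable fun t => f (-t) :=
  hf.comp_quasiMeasurePreserving
    (Measure.measurePreserving_neg (volume : Measure ℝ)).quasiMeasurePreserving

lemma MeasureTheory.MemLp.comp_neg_real {f : ℝ → ℂ} (hf : MemLp f 2) : MemLp (fun t => f (-t)) 2 :=
  hf.comp_measurePreserving (Measure.measurePreserving_neg (volume : Measure ℝ))

lemma MeasureTheory.MemLp.bdd_mul_of_ae {f g : ℝ → ℂ} (hf : MemLp f 2) (hg : AEMeasurable g) {C : ℝ}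
    (hgC : ∀ᵐ t, ‖g t‖ ≤ C) : MemLp (fun t => g t * f t) 2 := by
  refine (hf.const_mul (C : ℂ)).of_le (hg.aestronglyMeasurable.mul hf.1) ?_
  filter_upwards [hgC] with t ht
  rw [norm_mul, norm_mul, Complex.norm_real]
  gcongr
  exact ht.trans (le_abs_self _)

lemma memLp_two_of_lintegral {f : ℝ → ℂ} (hf : AEMeasurable f)
    (h : ∫⁻ t, ENNReal.ofReal (‖f t‖ ^ 2) < ⊤) : MemLp f 2 := by
  rw [memLp_two_iff_integrable_sq_norm hf.aestronglyMeasurable,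
    ← lintegral_ofReal_ne_top_iff_integrable (hf.norm.pow_const 2).aestronglyMeasurable
      (Eventually.of_forall fun t => by positivity)]
  exact h.ne

lemma lintegral_norm_sq_eq {f : ℝ → ℂ} (hf : MemLp f 2) {η : Lp ℂ 2 (volume : Measure ℝ)}
    (hη : η =ᵐ[volume] f) : ∫⁻ t, ENNReal.ofReal (‖f t‖ ^ 2) = ENNReal.ofReal (‖η‖ ^ 2) := by
  have h1 : hf.toLp f = η := by
    apply Lp.ext
    exact hf.coeFn_toLp.trans hη.symm
  rw [← ofReal_integral_eq_lintegral_ofReal hf.integrable_norm_sq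
      (Eventually.of_forall fun t => by positivity), ← h1, ← @inner_self_eq_norm_sq ℂ,
      integral_toLp_inner]
  congr 1
  have : ∀ t, conj (f t) * f t = ((‖f t‖ ^ 2 : ℝ) : ℂ) := by
    intro t; rw [Complex.conj_mul']; push_cast; rfl
  simp_rw [this]
  rw [integral_complex_ofReal]; simp

lemma integral_norm_sq_eq {f : ℝ → ℂ} (hf : MemLp f 2) {η : Lp ℂ 2 (volume : Measure ℝ)}
    (hη : η =ᵐ[volume] f) : ∫ t, ‖f t‖ ^ 2 = ‖η‖ ^ 2 := by
  have h := lintegral_norm_sq_eq hf hη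
  rw [← ofReal_integral_eq_lintegral_ofReal hf.integrable_norm_sq
      (Eventually.of_forall fun t => by positivity)] at h
  exact (ENNReal.ofReal_eq_ofReal_iff (integral_nonneg fun _ => by positivity)
    (by positivity)).1 h

/-! ### Boundary values of s_e and the isometric embedding of the weighted space. -/

namespace ScatteringData

variable {Λ : Set ℂ}

/-- The logarithm of the boundary modulus of `s_e`. -/
def logModulus (D : ScatteringData Λ) (t : ℝ) : ℝ := 1 / 2 * Real.log (1 - ‖D.s t‖ ^ 2)

lemma outer_eq (D : ScatteringData Λ) : D.outer = schwarzOuter D.logModulus := rfl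

lemma integrable_logModulus (D : ScatteringData Λ) :
    Integrable fun t : ℝ => (1 + t ^ 2)⁻¹ • D.logModulus t := by
  refine (D.szego.const_mul (1 / 2)).congr (Eventually.of_forall fun t => ?_)
  simp only [logModulus, smul_eq_mul]
  ring

lemma one_sub_norm_sq_pos (D : ScatteringData Λ) : ∀ᵐ t, 0 < 1 - ‖D.s t‖ ^ 2 := by
  filter_upwards [D.norm_s_lt_one] with t ht
  nlinarith [norm_nonneg (D.s t)]

lemma logModulus_nonpos (D : ScatteringData Λ) : ∀ᵐ t, D.logModulus t ≤ 0 := by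
  filter_upwards [D.one_sub_norm_sq_pos] with t ht
  have : Real.log (1 - ‖D.s t‖ ^ 2) ≤ 0 := Real.log_nonpos ht.le (by linarith [sq_nonneg ‖D.s t‖])
  unfold logModulus
  linarith

/-- The boundary values of `s_e`. -/
def outerBoundary (D : ScatteringData Λ) : ℝ → ℂ := verticalLimit D.outer

lemma outer_facts (D : ScatteringData Λ) : AEMeasurable D.outerBoundary ∧
    HasBoundaryValues D.outer D.outerBoundary ∧
    ∀ᵐ t, ‖D.outerBoundary t‖ = Real.exp (D.logModulus t) := by
  obtain ⟨o, hom, ho, hn⟩ :=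
    exists_hasBoundaryValues_schwarzOuter D.integrable_logModulus D.logModulus_nonpos
  have h1 : HasBoundaryValues D.outer D.outerBoundary := HasBoundaryValues.verticalLimit ho
  refine ⟨h1.aemeasurable (differentiableOn_schwarzOuter D.integrable_logModulus), h1, ?_⟩
  filter_upwards [h1.ae_eq ho, hn] with t h2 h3
  rw [h2, h3]

lemma isHardyInfty_outer (D : ScatteringData Λ) : IsHardyInfty D.outer := by
  obtain ⟨h1, h2⟩ := isHardyInfty_schwarzOuter D.integrable_logModulus D.logModulus_nonpos
  exact ⟨h1, _, h2⟩

lemma outer_ne_zero (D : ScatteringData Λ) (z : ℂ) : D.outer z ≠ 0 := schwarzOuter_ne_zero _ _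

lemma aemeasurable_outerBoundary (D : ScatteringData Λ) : AEMeasurable D.outerBoundary :=
  D.outer_facts.1

lemma hasBoundaryValues_outer (D : ScatteringData Λ) :
    HasBoundaryValues D.outer D.outerBoundary :=
  D.outer_facts.2.1

lemma norm_outerBoundary_sq (D : ScatteringData Λ) :
    ∀ᵐ t, ‖D.outerBoundary t‖ ^ 2 = 1 - ‖D.s t‖ ^ 2 := by
  filter_upwards [D.outer_facts.2.2, D.one_sub_norm_sq_pos] with t h1 h2
  rw [h1, logModulus, ← Real.exp_nat_mul]
  push_cast
  rw [← mul_assoc]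
  norm_num
  exact Real.exp_log h2

lemma outerBoundary_ne_zero (D : ScatteringData Λ) : ∀ᵐ t, D.outerBoundary t ≠ 0 := by
  filter_upwards [D.outer_facts.2.2] with t h1
  rw [← norm_ne_zero_iff, h1]
  exact (Real.exp_pos _).ne'

lemma norm_outerBoundary_le_one (D : ScatteringData Λ) : ∀ᵐ t, ‖D.outerBoundary t‖ ≤ 1 := by
  filter_upwards [D.outer_facts.2.2, D.logModulus_nonpos] with t h1 h2
  rw [h1]
  exact Real.exp_le_one_iff.2 h2

lemma norm_s_le_one (D : ScatteringData Λ) : ∀ᵐ t, ‖D.s t‖ ≤ 1 :=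
  D.norm_s_lt_one.mono fun _ h => h.le

/-- Completing the square with |s_e|² = 1 − |s₊|². The form becomes a sum of two scalar products,
which is the source of the first two components of the embedding. -/
lemma form_eq (D : ScatteringData Λ) (f h : ℝ ⊕ Λ → ℂ) : ∀ᵐ t, D.form f h t =
    conj (D.outerBoundary t * h (Sum.inl t)) * (D.outerBoundary t * f (Sum.inl t)) +
    conj (D.s t * h (Sum.inl t) - h (Sum.inl (-t))) *
      (D.s t * f (Sum.inl t) - f (Sum.inl (-t))) := by
  filter_upwards [D.norm_outerBoundary_sq] with t ht
  have h1 : conj (D.outerBoundary t) * D.outerBoundary t = 1 - conj (D.s t) * D.s t := by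
    rw [Complex.conj_mul', Complex.conj_mul']
    exact_mod_cast ht
  simp only [form, dotProduct, Fin.sum_univ_two,
    Pi.star_apply, Matrix.cons_val_zero, Matrix.cons_val_one, RCLike.star_def, map_mul, map_sub,
    map_neg, Matrix.cons_val_fin_one, Matrix.mulVec, Matrix.of_apply]
  linear_combination (-(conj (h (Sum.inl t)) * f (Sum.inl t))) * h1

/-- The Hilbert space in which `L²_{s₊,ν₊}` is embedded. -/
abbrev Ambient (Λ : Set ℂ) : Type :=
  WithLp 2 (Lp ℂ 2 (volume : Measure ℝ) ×
    WithLp 2 (Lp ℂ 2 (volume : Measure ℝ) × lp (fun _ : Λ => ℂ) 2))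

/-- The normalizing factor `1 / √(4π)`. -/
def normFactor : ℝ := (√(4 * Real.pi))⁻¹

lemma normFactor_pos : 0 < normFactor := by
  have := Real.pi_pos
  unfold normFactor; positivity

lemma normFactor_sq : normFactor ^ 2 = 1 / (4 * Real.pi) := by
  have := Real.pi_pos
  rw [normFactor, inv_pow, Real.sq_sqrt (by positivity), one_div]

/-- `η` is the image of `f` under the isometric embedding
`f ↦ (s_e f, s₊ f - f(-·), √ν₊ f|_Λ)` of `L²_{s₊,ν₊}`. -/
structure Represents (D : ScatteringData Λ) (f : ℝ ⊕ Λ → ℂ) (η : Ambient Λ) : Prop where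
  fst : η.fst =ᵐ[volume] fun t => normFactor * (D.outerBoundary t * f (Sum.inl t))
  mid : η.snd.fst =ᵐ[volume] fun t => normFactor * (D.s t * f (Sum.inl t) - f (Sum.inl (-t)))
  lst : ∀ w, η.snd.snd w = √(D.ν w) * f (Sum.inr w)

section Represents

variable {D : ScatteringData Λ} {f h : ℝ ⊕ Λ → ℂ} {η θ : Ambient Λ}

lemma Represents.memLp_fst (hf : D.Represents f η) :
    MemLp (fun t => D.outerBoundary t * f (Sum.inl t)) 2 := by
  have h1 : MemLp (fun t => (normFactor : ℂ) * (D.outerBoundary t * f (Sum.inl t))) 2 :=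
    (memLp_congr_ae hf.fst).1 (Lp.memLp _)
  have h2 := h1.const_mul ((normFactor : ℂ)⁻¹)
  have h3 : (normFactor : ℂ) ≠ 0 := by exact_mod_cast normFactor_pos.ne'
  simpa [inv_mul_cancel_left₀ h3] using h2

lemma Represents.memLp_mid (hf : D.Represents f η) :
    MemLp (fun t => D.s t * f (Sum.inl t) - f (Sum.inl (-t))) 2 := by
  have h1 : MemLp (fun t => (normFactor : ℂ) * (D.s t * f (Sum.inl t) - f (Sum.inl (-t)))) 2 :=
    (memLp_congr_ae hf.mid).1 (Lp.memLp _)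
  have h2 := h1.const_mul ((normFactor : ℂ)⁻¹)
  have h3 : (normFactor : ℂ) ≠ 0 := by exact_mod_cast normFactor_pos.ne'
  simpa [inv_mul_cancel_left₀ h3] using h2

lemma Represents.aemeasurable (hf : D.Represents f η) : AEMeasurable fun t => f (Sum.inl t) := by
  have h1 : AEMeasurable fun t => (D.outerBoundary t)⁻¹ * (D.outerBoundary t * f (Sum.inl t)) :=
    D.aemeasurable_outerBoundary.inv.mul hf.memLp_fst.1.aemeasurable
  refine h1.congr ?_
  filter_upwards [D.outerBoundary_ne_zero] with t ht
  rw [inv_mul_cancel_left₀ ht]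

lemma Represents.add (hf : D.Represents f η) (hh : D.Represents h θ) :
    D.Represents (f + h) (η + θ) where
  fst := by
    filter_upwards [Lp.coeFn_add η.fst θ.fst, hf.fst, hh.fst] with t h1 h2 h3
    rw [WithLp.add_fst, h1, Pi.add_apply, h2, h3, Pi.add_apply]; ring
  mid := by
    filter_upwards [Lp.coeFn_add η.snd.fst θ.snd.fst, hf.mid, hh.mid] with t h1 h2 h3
    rw [WithLp.add_snd, WithLp.add_fst, h1, Pi.add_apply, h2, h3, Pi.add_apply, Pi.add_apply]; ring
  lst w := by
    rw [WithLp.add_snd, WithLp.add_snd, lp.coeFn_add, Pi.add_apply, hf.lst, hh.lst, Pi.add_apply]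
    ring

lemma Represents.smul (hf : D.Represents f η) (a : ℂ) : D.Represents (a • f) (a • η) where
  fst := by
    filter_upwards [Lp.coeFn_smul a η.fst, hf.fst] with t h1 h2
    rw [WithLp.smul_fst, h1, Pi.smul_apply, h2, Pi.smul_apply, smul_eq_mul, smul_eq_mul]; ring
  mid := by
    filter_upwards [Lp.coeFn_smul a η.snd.fst, hf.mid] with t h1 h2
    rw [WithLp.smul_snd, WithLp.smul_fst, h1, Pi.smul_apply, h2, Pi.smul_apply, Pi.smul_apply,
      smul_eq_mul, smul_eq_mul, smul_eq_mul]; ring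
  lst w := by
    rw [WithLp.smul_snd, WithLp.smul_snd, lp.coeFn_smul, Pi.smul_apply, hf.lst, Pi.smul_apply,
      smul_eq_mul, smul_eq_mul]
    ring

lemma Represents.sub (hf : D.Represents f η) (hh : D.Represents h θ) :
    D.Represents (f - h) (η - θ) := by
  have := hf.add (hh.smul (-1))
  simpa [sub_eq_add_neg] using this

lemma Represents.normSq_eq (hf : D.Represents f η) :
    D.normSq f = ENNReal.ofReal (‖η‖ ^ 2) := by
  have e1 : ∑' w : Λ, ENNReal.ofReal (‖f (Sum.inr w)‖ ^ 2 * D.ν w) =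
      ENNReal.ofReal (‖η.snd.snd‖ ^ 2) := by
    have h1 := lp.hasSum_norm (p := 2) (by norm_num) η.snd.snd
    simp only [ENNReal.toReal_ofNat, Real.rpow_two] at h1
    rw [← h1.tsum_eq, ENNReal.ofReal_tsum_of_nonneg (fun w => by positivity) h1.summable]
    congr 1; ext w
    rw [hf.lst, norm_mul, Complex.norm_real, mul_pow, Real.norm_of_nonneg (Real.sqrt_nonneg _),
      Real.sq_sqrt (D.ν_pos w).le, mul_comm]
  have e2 : ENNReal.ofReal (1 / (4 * Real.pi)) * ∫⁻ t, ENNReal.ofReal (D.form f f t).re =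
      ENNReal.ofReal (‖η.fst‖ ^ 2) + ENNReal.ofReal (‖η.snd.fst‖ ^ 2) := by
    have hpt : ∀ᵐ t, ENNReal.ofReal (D.form f f t).re =
        ENNReal.ofReal (‖D.outerBoundary t * f (Sum.inl t)‖ ^ 2) +
        ENNReal.ofReal (‖D.s t * f (Sum.inl t) - f (Sum.inl (-t))‖ ^ 2) := by
      filter_upwards [D.form_eq f f] with t ht
      rw [ht, Complex.conj_mul', Complex.conj_mul', ← ENNReal.ofReal_add (by positivity)
        (by positivity)]
      norm_cast
    have hc : ∀ c : ℂ, ENNReal.ofReal (‖(normFactor : ℂ) * c‖ ^ 2) =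
        ENNReal.ofReal (1 / (4 * Real.pi)) * ENNReal.ofReal (‖c‖ ^ 2) := by
      intro c
      have := Real.pi_pos
      rw [norm_mul, mul_pow, Complex.norm_real, Real.norm_of_nonneg normFactor_pos.le,
        normFactor_sq, ENNReal.ofReal_mul (by positivity)]
    rw [lintegral_congr_ae hpt, lintegral_add_left'
      (hf.memLp_fst.1.aemeasurable.norm.pow_const 2).ennreal_ofReal, mul_add,
      ← lintegral_const_mul' _ _ ENNReal.ofReal_ne_top,
      ← lintegral_const_mul' _ _ ENNReal.ofReal_ne_top]
    simp_rw [← hc]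
    rw [lintegral_norm_sq_eq (hf.memLp_fst.const_mul _) hf.fst,
      lintegral_norm_sq_eq (hf.memLp_mid.const_mul _) hf.mid]
  rw [normSq, e1, e2, WithLp.prod_norm_sq_eq_of_L2, WithLp.prod_norm_sq_eq_of_L2,
    ENNReal.ofReal_add (by positivity) (by positivity),
    ENNReal.ofReal_add (by positivity) (by positivity)]
  ring

lemma Represents.norm_eq (hf : D.Represents f η) : D.norm f = ENNReal.ofReal ‖η‖ := by
  rw [ScatteringData.norm, hf.normSq_eq, ENNReal.ofReal_rpow_of_nonneg (by positivity) (by norm_num),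
    ← Real.sqrt_eq_rpow, Real.sqrt_sq (norm_nonneg _)]

lemma Represents.mem_L2 (hf : D.Represents f η) : f ∈ D.L2 :=
  ⟨hf.aemeasurable, by rw [hf.normSq_eq]; exact ENNReal.ofReal_lt_top⟩

/-- Every element of `L²_{s₊,ν₊}` is represented in the ambient Hilbert space. -/
theorem exists_represents (hf : f ∈ D.L2) : ∃ η, D.Represents f η := by
  obtain ⟨hm, hfin⟩ := hf
  rw [normSq, ENNReal.add_lt_top] at hfin
  have hpt : ∀ᵐ t, ENNReal.ofReal (D.form f f t).re =
      ENNReal.ofReal (‖D.outerBoundary t * f (Sum.inl t)‖ ^ 2) +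
      ENNReal.ofReal (‖D.s t * f (Sum.inl t) - f (Sum.inl (-t))‖ ^ 2) := by
    filter_upwards [D.form_eq f f] with t ht
    rw [ht, Complex.conj_mul', Complex.conj_mul', ← ENNReal.ofReal_add (by positivity)
      (by positivity)]
    norm_cast
  have hm1 : AEMeasurable fun t => D.outerBoundary t * f (Sum.inl t) :=
    D.aemeasurable_outerBoundary.mul hm
  have hm2 : AEMeasurable fun t => D.s t * f (Sum.inl t) - f (Sum.inl (-t)) :=
    (D.aemeasurable_s.mul hm).sub hm.comp_neg_real
  have hlt : ∫⁻ t, ENNReal.ofReal (D.form f f t).re < ⊤ := by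
    refine lt_of_le_of_ne le_top fun htop => ?_
    rw [htop, ENNReal.mul_top] at hfin
    · exact lt_irrefl _ hfin.2
    · have := Real.pi_pos
      exact (ENNReal.ofReal_pos.2 (by positivity)).ne'
  rw [lintegral_congr_ae hpt, lintegral_add_left' (hm1.norm.pow_const 2).ennreal_ofReal,
    ENNReal.add_lt_top] at hlt
  have l1 := (memLp_two_of_lintegral hm1 hlt.1).const_mul (normFactor : ℂ)
  have l2 := (memLp_two_of_lintegral hm2 hlt.2).const_mul (normFactor : ℂ)
  have l3 : Memℓp (fun w : Λ => (√(D.ν w) : ℂ) * f (Sum.inr w)) 2 := by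
    refine memℓp_gen ?_
    simp only [ENNReal.toReal_ofNat, Real.rpow_two]
    have h1 : ∀ w : Λ, ‖(√(D.ν w) : ℂ) * f (Sum.inr w)‖ ^ 2 = ‖f (Sum.inr w)‖ ^ 2 * D.ν w := by
      intro w
      rw [norm_mul, Complex.norm_real, mul_pow, Real.norm_of_nonneg (Real.sqrt_nonneg _),
        Real.sq_sqrt (D.ν_pos w).le, mul_comm]
    simp_rw [h1]
    have h2 := ENNReal.summable_toReal hfin.1.ne
    refine h2.congr fun w => ?_
    rw [ENNReal.toReal_ofReal]
    have := D.ν_pos w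
    positivity
  exact ⟨WithLp.toLp 2 (l1.toLp, WithLp.toLp 2 (l2.toLp, ⟨_, l3⟩)),
    ⟨l1.coeFn_toLp, l2.coeFn_toLp, fun w => rfl⟩⟩

lemma inner_eq_integral {f g : ℝ → ℂ} {η θ : Lp ℂ 2 (volume : Measure ℝ)} (hf : η =ᵐ[volume] f)
    (hg : θ =ᵐ[volume] g) : Inner.inner ℂ θ η = ∫ t, conj (g t) * f t := by
  rw [L2.inner_def]
  refine integral_congr_ae ?_
  filter_upwards [hf, hg] with t h1 h2
  rw [h1, h2, RCLike.inner_apply, mul_comm]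

/-- The arguments change places because `D.inner` is linear in its first argument and `Inner.inner`
in its second. -/
theorem Represents.inner_eq (hf : D.Represents f η) (hh : D.Represents h θ) :
    D.inner f h = Inner.inner ℂ θ η := by
  have e1 : ∑' w : Λ, f (Sum.inr w) * conj (h (Sum.inr w)) * (D.ν w : ℂ) =
      Inner.inner ℂ θ.snd.snd η.snd.snd := by
    rw [lp.inner_eq_tsum]
    congr 1; ext w
    have : ((√(D.ν w) : ℝ) : ℂ) * ((√(D.ν w) : ℝ) : ℂ) = D.ν w := by
      rw [← Complex.ofReal_mul, Real.mul_self_sqrt (D.ν_pos w).le]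
    rw [hf.lst, hh.lst, RCLike.inner_apply, map_mul, Complex.conj_ofReal, ← this]
    ring
  have i1 : Integrable fun t => conj (D.outerBoundary t * h (Sum.inl t)) *
      (D.outerBoundary t * f (Sum.inl t)) := hh.memLp_fst.star.integrable_mul hf.memLp_fst
  have i2 : Integrable fun t => conj (D.s t * h (Sum.inl t) - h (Sum.inl (-t))) *
      (D.s t * f (Sum.inl t) - f (Sum.inl (-t))) := hh.memLp_mid.star.integrable_mul hf.memLp_mid
  have hc : (normFactor : ℂ) * normFactor = 1 / (4 * Real.pi) := by
    have := normFactor_sq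
    rw [← Complex.ofReal_mul, ← sq, this]; push_cast; rfl
  rw [ScatteringData.inner, e1, integral_congr_ae (D.form_eq f h), integral_add i1 i2, mul_add,
    WithLp.prod_inner_apply, WithLp.prod_inner_apply]
  change _ = Inner.inner ℂ θ.fst η.fst + (Inner.inner ℂ θ.snd.fst η.snd.fst + Inner.inner ℂ θ.snd.snd η.snd.snd)
  rw [inner_eq_integral hf.fst hh.fst, inner_eq_integral hf.mid hh.mid, ← integral_const_mul,
    ← integral_const_mul, ← hc]
  simp only [map_mul, Complex.conj_ofReal]
  have c1 : ∀ a b : ℂ, (normFactor : ℂ) * a * (normFactor * b) = normFactor * normFactor * (a * b) :=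
    fun a b => by ring
  simp only [c1]
  ring

end Represents

end ScatteringData

/-! ### Closed subspaces of the ambient space and existence of reproducing kernels. -/

/-- The bilinear pairing of `L²(ℝ)` with a fixed square-integrable function. -/
def lpPairing (m : ℝ → ℂ) (hm : MemLp m 2) : Lp ℂ 2 (volume : Measure ℝ) →L[ℂ] ℂ :=
  innerSL ℂ (hm.star.toLp _)

lemma lpPairing_apply {m : ℝ → ℂ} (hm : MemLp m 2) {η : Lp ℂ 2 (volume : Measure ℝ)} {f : ℝ → ℂ}
    (hf : η =ᵐ[volume] f) : lpPairing m hm η = ∫ t, m t * f t := by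
  rw [lpPairing, innerSL_apply_apply, ScatteringData.inner_eq_integral hf hm.star.coeFn_toLp]
  simp

lemma HasBoundaryValues.div {F G : ℂ → ℂ} {f g : ℝ → ℂ} (hf : HasBoundaryValues F f)
    (hg : HasBoundaryValues G g) (h0 : ∀ᵐ t, g t ≠ 0) :
    HasBoundaryValues (fun z => F z / G z) fun t => f t / g t := by
  filter_upwards [hf, hg, h0] with t h1 h2 h3 using h1.div h2 h3

namespace ScatteringData

variable {Λ : Set ℂ} {D : ScatteringData Λ} {f h : ℝ ⊕ Λ → ℂ} {η θ : Ambient Λ}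

lemma two_pi_I_ne_zero : (2 * Real.pi * Complex.I : ℂ) ≠ 0 := by simp [Real.pi_ne_zero]

/-- Cauchy's formula for the values of an analytic continuation. -/
lemma IsContinuation.cauchy {F : ℂ → ℂ} (hF : D.IsContinuation f F) :
    (∀ z ∈ upperHalf, ∫ t : ℝ, D.outerBoundary t * f (Sum.inl t) / (t - z) =
      2 * Real.pi * Complex.I * (D.outer z * F z)) ∧
    ∀ z : ℂ, z.im < 0 → ∫ t : ℝ, D.outerBoundary t * f (Sum.inl t) / (t - z) = 0 :=
  (hF.2.1.cauchy (D.hasBoundaryValues_outer.mul hF.2.2)).2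

/-- Vanishing Cauchy integrals in the lower half-plane make s_e f the boundary function of some G ∈
H², and s_e has no zeros to divide by. -/
lemma exists_isContinuation (hf : MemLp (fun t => D.outerBoundary t * f (Sum.inl t)) 2)
    (h : ∀ z : ℂ, z.im < 0 → ∫ t : ℝ, D.outerBoundary t * f (Sum.inl t) / (t - z) = 0) :
    ∃ F, D.IsContinuation f F := by
  set G : ℂ → ℂ := fun z => (2 * Real.pi * Complex.I : ℂ)⁻¹ *
    ∫ t : ℝ, D.outerBoundary t * f (Sum.inl t) / (t - z) with hG
  have h1 : ∀ z ∈ upperHalf, ∫ t : ℝ, D.outerBoundary t * f (Sum.inl t) / (t - z) =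
      2 * Real.pi * Complex.I * G z := fun z _ => by
    rw [hG, mul_inv_cancel_left₀ two_pi_I_ne_zero]
  have hH := isHardyTwo_of_cauchy hf h1 h
  have hB := hasBoundaryValues_of_cauchy hf h1 h
  have hmul : (fun z => D.outer z * (G z / D.outer z)) = G := by
    ext z; rw [mul_div_cancel₀ _ (D.outer_ne_zero z)]
  refine ⟨fun z => G z / D.outer z, hH.1.div D.isHardyInfty_outer.1
    (fun z _ => D.outer_ne_zero z), by rwa [hmul], ?_⟩
  refine (hB.div D.hasBoundaryValues_outer D.outerBoundary_ne_zero).congr_ae ?_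
  filter_upwards [D.outerBoundary_ne_zero] with t ht
  rw [mul_div_cancel_left₀ _ ht]

/-- Membership in `Ĥ²` in terms of Cauchy integrals. -/
lemma Represents.mem_H2hat_iff (hf : D.Represents f η) : f ∈ D.H2hat ↔
    (∀ z : ℂ, z.im < 0 → ∫ t : ℝ, D.outerBoundary t * f (Sum.inl t) / (t - z) = 0) ∧
    ∀ w : Λ, ∫ t : ℝ, D.outerBoundary t * f (Sum.inl t) / (t - w) =
      2 * Real.pi * Complex.I * (D.outer w * f (Sum.inr w)) := by
  constructor
  · rintro ⟨-, F, hF, hFw⟩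
    refine ⟨hF.cauchy.2, fun w => ?_⟩
    rw [hFw]
    exact hF.cauchy.1 _ (D.im_pos _ w.2)
  · rintro ⟨h1, h2⟩
    obtain ⟨F, hF⟩ := exists_isContinuation hf.memLp_fst h1
    refine ⟨hf.mem_L2, F, hF, fun w => ?_⟩
    have := (h2 w).symm.trans (hF.cauchy.1 _ (D.im_pos _ w.2))
    exact mul_left_cancel₀ (D.outer_ne_zero w) (mul_left_cancel₀ two_pi_I_ne_zero this)

lemma norm_s_neg (D : ScatteringData Λ) : ∀ᵐ t, ‖D.s (-t)‖ = ‖D.s t‖ := by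
  filter_upwards [D.symm_s] with t ht
  rw [ht, RCLike.norm_conj]

lemma norm_outerBoundary_neg (D : ScatteringData Λ) :
    ∀ᵐ t, ‖D.outerBoundary (-t)‖ = ‖D.outerBoundary t‖ := by
  filter_upwards [D.norm_s_neg, D.norm_outerBoundary_sq, ae_comp_neg D.norm_outerBoundary_sq]
    with t h1 h2 h3
  rw [← sq_eq_sq₀ (norm_nonneg _) (norm_nonneg _), h2, h3, h1]

lemma conj_mul_outerBoundary_neg (D : ScatteringData Λ) :
    ∀ᵐ t, conj (D.outerBoundary (-t)) * D.outerBoundary (-t) =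
      conj (D.outerBoundary t) * D.outerBoundary t := by
  filter_upwards [D.norm_outerBoundary_neg] with t h1
  rw [Complex.conj_mul', Complex.conj_mul', h1]

lemma memLp_conj_outer_mul (D : ScatteringData Λ) {φ : ℝ → ℂ} (hφ : MemLp φ 2) :
    MemLp (fun t => conj (D.outerBoundary t) * φ t) 2 :=
  hφ.bdd_mul_of_ae (Complex.continuous_conj.measurable.comp_aemeasurable D.aemeasurable_outerBoundary)
    (C := 1) (by
      filter_upwards [D.norm_outerBoundary_le_one] with t ht
      rwa [RCLike.norm_conj])

lemma memLp_outer_mul (D : ScatteringData Λ) {φ : ℝ → ℂ} (hφ : MemLp φ 2) :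
    MemLp (fun t => D.outerBoundary t * φ t) 2 :=
  hφ.bdd_mul_of_ae D.aemeasurable_outerBoundary D.norm_outerBoundary_le_one

lemma memLp_s_mul (D : ScatteringData Λ) {φ : ℝ → ℂ} (hφ : MemLp φ 2) :
    MemLp (fun t => D.s t * φ t) 2 :=
  hφ.bdd_mul_of_ae D.aemeasurable_s D.norm_s_le_one

/-- The relation between the first two components of a represented function, in weak form. -/
lemma weak_relation_iff (D : ScatteringData Λ) {a b : ℝ → ℂ} (ha : MemLp a 2) (hb : MemLp b 2) :
    (∀ φ : ℝ → ℂ, MemLp φ 2 →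
      ∫ t, (conj (D.outerBoundary t) * (D.outerBoundary t * φ t)) * b t =
      ∫ t, (D.s t * (conj (D.outerBoundary t) * φ t) - conj (D.outerBoundary t) * φ (-t)) * a t) ↔
    ∀ᵐ t, conj (D.outerBoundary t) * (D.outerBoundary t * b t) =
      D.s t * (conj (D.outerBoundary t) * a t) - conj (D.outerBoundary (-t)) * a (-t) := by
  -- For a = s_e f and b = s₊f − f(−·), multiply b by |s_e|², which is even in t: every f is then
  -- absorbed into an a, with bounded coefficients and no division. X is the defect of the resulting
  -- identity.
  set X : ℝ → ℂ := fun t => conj (D.outerBoundary t) * (D.outerBoundary t * b t) -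
    (D.s t * (conj (D.outerBoundary t) * a t) - conj (D.outerBoundary (-t)) * a (-t)) with hX
  have hb' := D.memLp_conj_outer_mul (D.memLp_outer_mul hb)
  have ha1 := D.memLp_s_mul (D.memLp_conj_outer_mul ha)
  have ha2 := (D.memLp_conj_outer_mul ha).comp_neg_real
  have hXm : MemLp X 2 := hb'.sub (ha1.sub ha2)
  have hdiff : ∀ φ : ℝ → ℂ, MemLp φ 2 →
      (∫ t, (conj (D.outerBoundary t) * (D.outerBoundary t * φ t)) * b t) -
      (∫ t, (D.s t * (conj (D.outerBoundary t) * φ t) - conj (D.outerBoundary t) * φ (-t)) * a t) =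
      ∫ t, φ t * X t := by
    intro φ hφ
    have i1 : Integrable fun t => φ t * (conj (D.outerBoundary t) * (D.outerBoundary t * b t)) :=
      hφ.integrable_mul hb'
    have i2 : Integrable fun t => φ t * (D.s t * (conj (D.outerBoundary t) * a t)) :=
      hφ.integrable_mul ha1
    have i3 : Integrable fun t => φ t * (conj (D.outerBoundary (-t)) * a (-t)) :=
      hφ.integrable_mul ha2
    have i4 : Integrable fun t => φ (-t) * (conj (D.outerBoundary t) * a t) :=
      hφ.comp_neg_real.integrable_mul (D.memLp_conj_outer_mul ha)
    have e3 : ∫ t, φ t * (conj (D.outerBoundary (-t)) * a (-t)) =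
        ∫ t, φ (-t) * (conj (D.outerBoundary t) * a t) := by
      rw [← integral_neg_eq_self]
      simp
    have e1 : ∫ t, φ t * X t =
        (∫ t, φ t * (conj (D.outerBoundary t) * (D.outerBoundary t * b t))) -
        ((∫ t, φ t * (D.s t * (conj (D.outerBoundary t) * a t))) -
        ∫ t, φ t * (conj (D.outerBoundary (-t)) * a (-t))) := by
      have i23 : Integrable fun t => φ t * (D.s t * (conj (D.outerBoundary t) * a t)) -
          φ t * (conj (D.outerBoundary (-t)) * a (-t)) := i2.sub i3
      rw [← integral_sub i2 i3, ← integral_sub i1 i23]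
      congr 1; ext t
      simp only [hX]; ring
    rw [e1, e3, ← integral_sub i2 i4]
    congr 1
    · congr 1; ext t; ring
    · congr 1; ext t; ring
  constructor
  · intro h0
    -- Testing with φ = conj X gives ∫ |X|² = 0.
    have h1 := hdiff _ hXm.star
    rw [h0 _ hXm.star, sub_self] at h1
    have h2 : ∀ t, star X t * X t = ((‖X t‖ ^ 2 : ℝ) : ℂ) := by
      intro t
      rw [Pi.star_apply, RCLike.star_def, Complex.conj_mul']; push_cast; rfl
    simp_rw [h2] at h1
    rw [integral_complex_ofReal, eq_comm, Complex.ofReal_eq_zero,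
      integral_eq_zero_iff_of_nonneg (fun t => by positivity) hXm.integrable_norm_sq] at h1
    filter_upwards [h1] with t ht
    have h3 : ‖X t‖ = 0 := by simpa using ht
    exact sub_eq_zero.1 (norm_eq_zero.1 h3)
  · intro h0 φ hφ
    rw [← sub_eq_zero, hdiff φ hφ]
    refine integral_eq_zero_of_ae ?_
    filter_upwards [h0] with t ht
    have : X t = 0 := sub_eq_zero.2 ht
    simp [this]

/-- The conditions that characterize the image of `Ĥ²_{s₊,ν₊}` in the ambient Hilbert space. -/
structure IsHatElement (D : ScatteringData Λ) (η : Ambient Λ) : Prop where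
  weak : ∀ φ : ℝ → ℂ, MemLp φ 2 →
    ∫ t, (conj (D.outerBoundary t) * (D.outerBoundary t * φ t)) * η.snd.fst t =
    ∫ t, (D.s t * (conj (D.outerBoundary t) * φ t) - conj (D.outerBoundary t) * φ (-t)) * η.fst t
  lower : ∀ z : ℂ, z.im < 0 → ∫ t : ℝ, ((t : ℂ) - z)⁻¹ * η.fst t = 0
  upper : ∀ w : Λ, √(D.ν w) * ∫ t : ℝ, ((t : ℂ) - w)⁻¹ * η.fst t =
    normFactor * (2 * Real.pi * Complex.I * D.outer w) * η.snd.snd w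

/-- Every condition says that one functional vanishes, and each is bounded since it pairs with an L²
function or evaluates at a point of Λ. This is why the relation between the components is kept in
weak form. -/
theorem exists_hatSubmodule (D : ScatteringData Λ) :
    ∃ S : Submodule ℂ (Ambient Λ), IsClosed (S : Set (Ambient Λ)) ∧
      ∀ η, η ∈ S ↔ D.IsHatElement η := by
  let p₁ : Ambient Λ →L[ℂ] Lp ℂ 2 (volume : Measure ℝ) := WithLp.fstL 2 ℂ _ _
  let p₂ : Ambient Λ →L[ℂ] Lp ℂ 2 (volume : Measure ℝ) :=
    (WithLp.fstL 2 ℂ _ _).comp (WithLp.sndL 2 ℂ _ _)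
  let p₃ : Λ → Ambient Λ →L[ℂ] ℂ := fun w =>
    (lp.evalCLM ℂ (fun _ : Λ => ℂ) 2 w).comp
      ((WithLp.sndL 2 ℂ _ _).comp (WithLp.sndL 2 ℂ _ _))
  have hm1 : ∀ φ : {φ : ℝ → ℂ // MemLp φ 2},
      MemLp (fun t => conj (D.outerBoundary t) * (D.outerBoundary t * φ.1 t)) 2 := fun φ =>
    D.memLp_conj_outer_mul (D.memLp_outer_mul φ.2)
  have hm2 : ∀ φ : {φ : ℝ → ℂ // MemLp φ 2},
      MemLp (fun t => D.s t * (conj (D.outerBoundary t) * φ.1 t) -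
        conj (D.outerBoundary t) * φ.1 (-t)) 2 := fun φ =>
    (D.memLp_s_mul (D.memLp_conj_outer_mul φ.2)).sub (D.memLp_conj_outer_mul φ.2.comp_neg_real)
  let Q : {φ : ℝ → ℂ // MemLp φ 2} → Ambient Λ →L[ℂ] ℂ := fun φ =>
    (lpPairing _ (hm1 φ)).comp p₂ - (lpPairing _ (hm2 φ)).comp p₁
  let R : {z : ℂ // z.im < 0} → Ambient Λ →L[ℂ] ℂ := fun z =>
    (lpPairing _ (memLp_inv_ofReal_sub (ne_of_lt z.2))).comp p₁
  let T : Λ → Ambient Λ →L[ℂ] ℂ := fun w =>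
    (√(D.ν w) : ℂ) • (lpPairing _ (memLp_inv_ofReal_sub (ne_of_gt (D.im_pos w w.2)))).comp p₁ -
      (normFactor * (2 * Real.pi * Complex.I * D.outer w) : ℂ) • p₃ w
  refine ⟨(⨅ φ, LinearMap.ker (Q φ).toLinearMap) ⊓ (⨅ z, LinearMap.ker (R z).toLinearMap) ⊓
    ⨅ w, LinearMap.ker (T w).toLinearMap, ?_, fun η => ?_⟩
  · simp only [Submodule.coe_inf, Submodule.coe_iInf]
    refine ((isClosed_iInter fun φ => ?_).inter (isClosed_iInter fun z => ?_)).inter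
      (isClosed_iInter fun w => ?_)
    · exact (Q φ).isClosed_ker
    · exact (R z).isClosed_ker
    · exact (T w).isClosed_ker
  · have hQ : ∀ φ, Q φ η = (∫ t, (conj (D.outerBoundary t) * (D.outerBoundary t * φ.1 t)) *
        η.snd.fst t) - ∫ t, (D.s t * (conj (D.outerBoundary t) * φ.1 t) -
        conj (D.outerBoundary t) * φ.1 (-t)) * η.fst t := fun φ => by
      rw [← lpPairing_apply (hm1 φ) (ae_eq_refl (η.snd.fst : ℝ → ℂ)),
        ← lpPairing_apply (hm2 φ) (ae_eq_refl (η.fst : ℝ → ℂ))]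
      rfl
    have hR : ∀ z, R z η = ∫ t : ℝ, ((t : ℂ) - z)⁻¹ * η.fst t := fun z =>
      lpPairing_apply (memLp_inv_ofReal_sub (ne_of_lt z.2)) (ae_eq_refl (η.fst : ℝ → ℂ))
    have hT : ∀ w, T w η = √(D.ν w) * (∫ t : ℝ, ((t : ℂ) - w)⁻¹ * η.fst t) -
        normFactor * (2 * Real.pi * Complex.I * D.outer w) * η.snd.snd w := fun w => by
      rw [← lpPairing_apply (memLp_inv_ofReal_sub (ne_of_gt (D.im_pos w w.2)))
        (ae_eq_refl (η.fst : ℝ → ℂ))]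
      rfl
    simp only [Submodule.mem_inf, Submodule.mem_iInf, LinearMap.mem_ker,
      ContinuousLinearMap.coe_coe, hQ, hR, hT, sub_eq_zero]
    exact ⟨fun h => ⟨fun φ hφ => h.1.1 ⟨φ, hφ⟩, fun z hz => h.1.2 ⟨z, hz⟩, h.2⟩,
      fun h => ⟨⟨fun φ => h.weak φ.1 φ.2, fun z => h.lower z.1 z.2⟩, h.upper⟩⟩

lemma normFactor_ne_zero : (normFactor : ℂ) ≠ 0 := by exact_mod_cast normFactor_pos.ne'

lemma Represents.integral_cauchy (hf : D.Represents f η) (z : ℂ) :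
    ∫ t : ℝ, ((t : ℂ) - z)⁻¹ * η.fst t =
      normFactor * ∫ t : ℝ, D.outerBoundary t * f (Sum.inl t) / (t - z) := by
  rw [← integral_const_mul]
  refine integral_congr_ae ?_
  filter_upwards [hf.fst] with t ht
  rw [ht]; ring

lemma Represents.isHatElement (hf : D.Represents f η) (hfm : f ∈ D.H2hat) :
    D.IsHatElement η := by
  obtain ⟨h1, h2⟩ := hf.mem_H2hat_iff.1 hfm
  refine ⟨(D.weak_relation_iff (Lp.memLp _) (Lp.memLp _)).2 ?_, fun z hz => ?_, fun w => ?_⟩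
  · filter_upwards [hf.fst, hf.mid, ae_comp_neg hf.fst, D.conj_mul_outerBoundary_neg]
      with t h1 h2 h3 h4
    rw [h1, h2, h3]
    linear_combination (normFactor : ℂ) * f (Sum.inl (-t)) * h4
  · rw [hf.integral_cauchy, h1 z hz, mul_zero]
  · rw [hf.integral_cauchy, h2, hf.lst]
    ring

lemma sqrt_ν_ne_zero (D : ScatteringData Λ) (w : Λ) : ((√(D.ν w) : ℝ) : ℂ) ≠ 0 := by
  exact_mod_cast (Real.sqrt_pos.2 (D.ν_pos w)).ne'

lemma Represents.mem_H2hat (hf : D.Represents f η) (hη : D.IsHatElement η) : f ∈ D.H2hat := by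
  refine hf.mem_H2hat_iff.2 ⟨fun z hz => ?_, fun w => ?_⟩
  · have := hη.lower z hz
    rw [hf.integral_cauchy] at this
    exact (mul_eq_zero.1 this).resolve_left normFactor_ne_zero
  · have := hη.upper w
    rw [hf.integral_cauchy, hf.lst] at this
    refine mul_left_cancel₀ (mul_ne_zero normFactor_ne_zero (D.sqrt_ν_ne_zero w)) ?_
    linear_combination this

/-- Elements of the ambient space that satisfy the conditions represent functions in `Ĥ²`. -/
lemma IsHatElement.exists_represents (hη : D.IsHatElement η) :
    ∃ f, D.Represents f η ∧ f ∈ D.H2hat := by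
  -- f is read off from the first and last components; the middle component is then forced by the
  -- weak relation, after cancelling |s_e|² ≠ 0.
  set f : ℝ ⊕ Λ → ℂ := Sum.elim (fun t => η.fst t / (normFactor * D.outerBoundary t))
    (fun w => η.snd.snd w / √(D.ν w)) with hf
  have hν := D.sqrt_ν_ne_zero
  have hn := normFactor_ne_zero
  have hrep : D.Represents f η := by
    refine ⟨?_, ?_, fun w => ?_⟩
    · filter_upwards [D.outerBoundary_ne_zero] with t ht
      simp only [hf, Sum.elim_inl]
      field_simp
    · filter_upwards [(D.weak_relation_iff (Lp.memLp _) (Lp.memLp _)).1 hη.weak,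
        D.outerBoundary_ne_zero, ae_comp_neg D.outerBoundary_ne_zero,
        D.conj_mul_outerBoundary_neg] with t h1 h2 h3 h4
      have h5 : conj (D.outerBoundary t) ≠ 0 := by simpa using h2
      have h6 : conj (D.outerBoundary t) * D.outerBoundary t ≠ 0 := mul_ne_zero h5 h2
      simp only [hf, Sum.elim_inl]
      refine mul_left_cancel₀ h6 ?_
      have h7 : conj (D.outerBoundary (-t)) =
          conj (D.outerBoundary t) * D.outerBoundary t / D.outerBoundary (-t) := by
        rw [← h4, mul_div_cancel_right₀ _ h3]
      rw [h7] at h1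
      rw [mul_assoc, h1]
      field_simp
    · simp only [hf, Sum.elim_inr]
      rw [mul_div_cancel₀ _ (hν w)]
  exact ⟨f, hrep, hrep.mem_H2hat hη⟩

/-- Point evaluation is represented by a vector of the ambient space. -/
lemma exists_evaluation_vector (D : ScatteringData Λ) {z₀ : ℂ} (hz₀ : 0 < z₀.im) :
    ∃ κ : Ambient Λ, ∀ f η F, D.Represents f η → D.IsContinuation f F →
      Inner.inner ℂ κ η = F z₀ := by
  -- The normalization in Cauchy's formula for s_e F at z₀; only the first component of η is needed
  -- to evaluate F.
  set a : ℂ := (normFactor * (2 * Real.pi * Complex.I * D.outer z₀))⁻¹ with ha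
  have hne : normFactor * (2 * Real.pi * Complex.I * D.outer z₀) ≠ 0 :=
    mul_ne_zero normFactor_ne_zero (mul_ne_zero two_pi_I_ne_zero (D.outer_ne_zero z₀))
  have hm := (memLp_inv_ofReal_sub (z := z₀) hz₀.ne').const_mul a
  refine ⟨WithLp.toLp 2 (hm.star.toLp _, 0), fun f η F hf hF => ?_⟩
  rw [WithLp.prod_inner_apply]
  change Inner.inner ℂ (hm.star.toLp _) η.fst + Inner.inner ℂ 0 η.snd = _
  rw [inner_zero_left, add_zero]
  have h1 := lpPairing_apply hm (ae_eq_refl (η.fst : ℝ → ℂ))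
  rw [lpPairing, innerSL_apply_apply] at h1
  simp_rw [mul_assoc] at h1
  rw [integral_const_mul, hf.integral_cauchy, hF.cauchy.1 z₀ hz₀] at h1
  refine h1.trans ?_
  rw [ha, inv_mul_eq_iff_eq_mul₀ hne]
  ring

/-- A space of functions whose image in the ambient space is a closed subspace of the image of `Ĥ²`
has reproducing kernels. -/
theorem exists_kernel_of_closed (D : ScatteringData Λ) {M : Set (ℝ ⊕ Λ → ℂ)}
    (S : Submodule ℂ (Ambient Λ)) (hS : IsClosed (S : Set (Ambient Λ)))
    (hSS : ∀ η ∈ S, D.IsHatElement η) (hMS : ∀ f ∈ M, ∃ η ∈ S, D.Represents f η)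
    (hSM : ∀ η ∈ S, ∀ f, D.Represents f η → f ∈ M) {z₀ : ℂ} (hz₀ : 0 < z₀.im) :
    ∃ k, D.IsReproducingKernel M z₀ k := by
  obtain ⟨κ, hκ⟩ := D.exists_evaluation_vector hz₀
  have : CompleteSpace S := hS.completeSpace_coe
  -- κ represents evaluation at z₀ on the ambient space but need not lie in S; its orthogonal
  -- projection has the same scalar products with S.
  have hmem := Submodule.starProjection_apply_mem S κ
  obtain ⟨k, hk, -⟩ := (hSS _ hmem).exists_represents
  refine ⟨k, hSM _ hmem k hk, fun f hf => ?_⟩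
  obtain ⟨η, hη, hfη⟩ := hMS f hf
  obtain ⟨-, F, hF, -⟩ := hfη.mem_H2hat (hSS η hη)
  refine ⟨F, hF, ?_⟩
  have h0 := Submodule.starProjection_inner_eq_zero (K := S) κ η hη
  rw [inner_sub_left, sub_eq_zero] at h0
  rw [hfη.inner_eq hk, ← h0, hκ f η F hfη hF]

theorem exists_kernel_H2hat (D : ScatteringData Λ) {z₀ : ℂ} (hz₀ : 0 < z₀.im) :
    ∃ k, D.IsReproducingKernel D.H2hat z₀ k := by
  obtain ⟨S, hS, hSiff⟩ := D.exists_hatSubmodule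
  refine D.exists_kernel_of_closed S hS (fun η hη => (hSiff η).1 hη) (fun f hf => ?_)
    (fun η hη f hf => hf.mem_H2hat ((hSiff η).1 hη)) hz₀
  obtain ⟨η, hη⟩ := exists_represents hf.1
  exact ⟨η, (hSiff η).2 (hη.isHatElement hf), hη⟩

lemma mem_H2hat_of_generator (D : ScatteringData Λ) (hf : f ∈ generators Λ) (hf2 : f ∈ D.L2) :
    f ∈ D.H2hat := by
  obtain ⟨E, g, -, hg, hb, hv⟩ := hf
  refine ⟨hf2, fun z => blaschkeProd Λ E z * g z, ⟨?_, ?_, hb⟩, hv⟩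
  · exact (D.differentiableOn_blaschkeProd E).mul hg.1
  · exact (hg.bdd_mul (D.isHardyInfty_blaschkeProd E)).bdd_mul D.isHardyInfty_outer

lemma generators_add (D : ScatteringData Λ) (hf : f ∈ generators Λ) (hh : h ∈ generators Λ) :
    f + h ∈ generators Λ := by
  classical
  obtain ⟨E, g, hg1, hg2, hgb, hgv⟩ := hf
  obtain ⟨E', g', hg1', hg2', hgb', hgv'⟩ := hh
  obtain ⟨c, hc, hce⟩ := D.blaschkeProd_eq_mul (E := E) (E' := E ∪ E') Finset.subset_union_left
  obtain ⟨c', hc', hce'⟩ := D.blaschkeProd_eq_mul (E := E') (E' := E ∪ E') Finset.subset_union_right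
  have hsum : ∀ z ∈ upperHalf, blaschkeProd Λ E z * g z + blaschkeProd Λ E' z * g' z =
      blaschkeProd Λ (E ∪ E') z * (c z * g z + c' z * g' z) := fun z hz => by
    rw [hce z hz, hce' z hz]; ring
  refine ⟨E ∪ E', fun z => c z * g z + c' z * g' z, (hc.mul hg1).add (hc'.mul hg1'),
    (hg2.bdd_mul hc).add (hg2'.bdd_mul hc'), (hgb.add hgb').congr hsum, fun w => ?_⟩
  rw [Pi.add_apply, hgv, hgv', hsum _ (D.im_pos w w.2)]

lemma generators_smul (hf : f ∈ generators Λ) (a : ℂ) : a • f ∈ generators Λ := by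
  obtain ⟨E, g, hg1, hg2, hgb, hgv⟩ := hf
  have hb : HasBoundaryValues (fun _ => a) (fun _ => a) :=
    Eventually.of_forall fun _ => tendsto_const_nhds
  refine ⟨E, fun z => a * g z, (isHardyInfty_const a).mul hg1, hg2.bdd_mul (isHardyInfty_const a),
    (hb.mul hgb).congr fun z _ => by ring, fun w => ?_⟩
  rw [Pi.smul_apply, hgv, smul_eq_mul]; ring

lemma zero_mem_generators : (0 : ℝ ⊕ Λ → ℂ) ∈ generators Λ := by
  have h : IsHardyTwo fun _ => (0 : ℂ) := ⟨differentiableOn_const 0, 0, fun y _ => by simp⟩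
  refine ⟨∅, fun _ => 0, isHardyInfty_const 0, h, Eventually.of_forall fun t => ?_, fun w => ?_⟩
  · simp
  · simp

lemma represents_zero (D : ScatteringData Λ) : D.Represents 0 0 where
  fst := by
    filter_upwards [Lp.coeFn_zero ℂ 2 (volume : Measure ℝ)] with t ht
    rw [WithLp.zero_fst, ht]; simp
  mid := by
    filter_upwards [Lp.coeFn_zero ℂ 2 (volume : Measure ℝ)] with t ht
    rw [WithLp.zero_snd, WithLp.zero_fst, ht]; simp
  lst w := by simp

/-- The images in the ambient space of the generators. -/
def generatorSubmodule (D : ScatteringData Λ) : Submodule ℂ (Ambient Λ) where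
  carrier := {η | ∃ f ∈ generators Λ, D.Represents f η}
  add_mem' := by
    rintro η θ ⟨f, hf, hfη⟩ ⟨h, hh, hhθ⟩
    exact ⟨f + h, D.generators_add hf hh, hfη.add hhθ⟩
  zero_mem' := ⟨0, zero_mem_generators, D.represents_zero⟩
  smul_mem' := by
    rintro a η ⟨f, hf, hfη⟩
    exact ⟨a • f, generators_smul hf a, hfη.smul a⟩

/-- Generators in L² lie in Ĥ², whose image is closed, so the closure of their images stays inside
it and the general existence argument applies. -/
theorem exists_kernel_H2 (D : ScatteringData Λ) {z₀ : ℂ} (hz₀ : 0 < z₀.im) :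
    ∃ k, D.IsReproducingKernel D.H2 z₀ k := by
  obtain ⟨S, hS, hSiff⟩ := D.exists_hatSubmodule
  refine D.exists_kernel_of_closed (M := D.H2) D.generatorSubmodule.topologicalClosure
    (Submodule.isClosed_topologicalClosure _) (fun η hη => ?_) (fun f hf => ?_)
    (fun η hη f hf => ⟨hf.mem_L2, fun ε hε => ?_⟩) hz₀
  · refine (hSiff η).1 (Submodule.topologicalClosure_minimal _ ?_ hS hη)
    rintro θ ⟨f, hf, hfθ⟩
    exact (hSiff θ).2 (hfθ.isHatElement (D.mem_H2hat_of_generator hf hfθ.mem_L2))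
  · obtain ⟨η, hη⟩ := exists_represents hf.1
    refine ⟨η, ?_, hη⟩
    rw [← SetLike.mem_coe, Submodule.topologicalClosure_coe, Metric.mem_closure_iff]
    intro ε hε
    obtain ⟨h, hh, hh2, hlt⟩ := hf.2 (ENNReal.ofReal ε) (ENNReal.ofReal_pos.2 hε)
    obtain ⟨θ, hθ⟩ := exists_represents hh2
    refine ⟨θ, ⟨h, hh, hθ⟩, ?_⟩
    rw [(hη.sub hθ).norm_eq, ENNReal.ofReal_lt_ofReal_iff hε] at hlt
    rwa [dist_eq_norm]
  · rw [← SetLike.mem_coe, Submodule.topologicalClosure_coe, EMetric.mem_closure_iff] at hη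
    obtain ⟨θ, ⟨h, hh, hθ⟩, hlt⟩ := hη ε hε
    refine ⟨h, hh, hθ.mem_L2, ?_⟩
    rw [(hf.sub hθ).norm_eq]
    rwa [edist_dist, dist_eq_norm] at hlt

end ScatteringData

/-! ### Oscillating integrals on H². -/

lemma MeasureTheory.MemLp.integrable_fun_mul {f g : ℝ → ℂ} (hf : MemLp f 2) (hg : MemLp g 2) :
    Integrable fun t => f t * g t :=
  hf.integrable_mul hg

/-- The **Riemann–Lebesgue lemma**. -/
lemma tendsto_integral_exp_mul (φ : ℝ → ℂ) :
    Tendsto (fun x : ℝ => ∫ t : ℝ, Complex.exp (2 * Complex.I * t * x) * φ t) atTop (𝓝 0) := by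
  have h := Real.tendsto_integral_exp_smul_cocompact φ
  -- The Fourier character at frequency ξ is e^{−2πitξ}; ξ = −x/π gives e^{2itx}.
  have h1 : Tendsto (fun x : ℝ => -(x / Real.pi)) atTop (cocompact ℝ) :=
    (tendsto_neg_atTop_atBot.comp (tendsto_id.atTop_div_const Real.pi_pos)).mono_right
      atBot_le_cocompact
  refine (h.comp h1).congr fun x => ?_
  refine integral_congr_ae (Eventually.of_forall fun t => ?_)
  have hpi : (Real.pi : ℂ) ≠ 0 := by exact_mod_cast Real.pi_ne_zero
  have e : ((2 * Real.pi * -(t * -(x / Real.pi)) : ℝ) : ℂ) * Complex.I = 2 * Complex.I * t * x := by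
    push_cast
    field_simp
  simp only [Circle.smul_def, Real.fourierChar_apply, smul_eq_mul, e]

lemma norm_exp_two_I_mul (z : ℂ) (x : ℝ) :
    ‖Complex.exp (2 * Complex.I * z * x)‖ = Real.exp (-(2 * z.im * x)) := by
  rw [Complex.norm_exp]
  congr 1
  simp [Complex.mul_re, Complex.mul_im]

lemma norm_exp_two_I_ofReal_mul (t x : ℝ) : ‖Complex.exp (2 * Complex.I * t * x)‖ = 1 := by
  rw [norm_exp_two_I_mul]; simp

lemma isHardyInfty_exp {x : ℝ} (hx : 0 ≤ x) :
    IsHardyInfty fun z => Complex.exp (2 * Complex.I * z * x) := by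
  refine ⟨by fun_prop, 1, fun z hz => ?_⟩
  have hz' : 0 < z.im := hz
  rw [norm_exp_two_I_mul, Real.exp_le_one_iff]
  have : 0 ≤ 2 * z.im * x := by positivity
  linarith

lemma hasBoundaryValues_exp (x : ℝ) :
    HasBoundaryValues (fun z => Complex.exp (2 * Complex.I * z * x))
      fun t => Complex.exp (2 * Complex.I * t * x) :=
  hasBoundaryValues_of_continuousAt (F := fun z => Complex.exp (2 * Complex.I * z * x))
    fun t => by fun_prop

lemma MeasureTheory.MemLp.exp_mul {g : ℝ → ℂ} (hg : MemLp g 2) (x : ℝ) :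
    MemLp (fun t : ℝ => Complex.exp (2 * Complex.I * t * x) * g t) 2 :=
  hg.bdd_mul_of_ae (by fun_prop) (Eventually.of_forall fun t => (norm_exp_two_I_ofReal_mul t x).le)

/-- Point evaluations are bounded on `H²`. -/
lemma IsHardyTwo.norm_le {G : ℂ → ℂ} (hG : IsHardyTwo G) {g : ℝ → ℂ} (hGg : HasBoundaryValues G g)
    {z : ℂ} (hz : 0 < z.im) :
    ‖2 * Real.pi * Complex.I * G z‖ ≤ √(Real.pi / z.im) * √(∫ t, ‖g t‖ ^ 2) := by
  obtain ⟨hg, h1, -⟩ := hG.cauchy hGg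
  have h2 := norm_integral_mul_le (memLp_inv_ofReal_sub hz.ne') hg
  rw [integral_norm_inv_ofReal_sub_sq hz.ne', abs_of_pos hz] at h2
  rw [← h1 z hz]
  simpa only [div_eq_inv_mul] using h2

/-- For x ≥ 0 the function e^{2izx}G is again in H². Cauchy's formula makes the integral zero for a
pole in the lower half-plane, and for one in the upper half-plane bounds it by e^{−2x Im z} times
the norm of a point evaluation. -/
lemma eventually_norm_integral_inv_sub_mul_exp_le {z : ℂ} (hz : z.im ≠ 0) {ε : ℝ} (hε : 0 < ε) :
    ∀ᶠ x : ℝ in atTop, ∀ G g, IsHardyTwo G → HasBoundaryValues G g →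
      ‖∫ t : ℝ, ((t : ℂ) - z)⁻¹ * (Complex.exp (2 * Complex.I * t * x) * g t)‖ ≤
        ε * √(∫ t, ‖g t‖ ^ 2) := by
  rcases lt_or_gt_of_ne hz with hz | hz
  · filter_upwards [eventually_ge_atTop 0] with x hx G g hG hg
    obtain ⟨-, -, h⟩ := (hG.bdd_mul (isHardyInfty_exp hx)).cauchy ((hasBoundaryValues_exp x).mul hg)
    have h1 := h z hz
    simp only [div_eq_inv_mul] at h1
    rw [h1, norm_zero]
    positivity
  · have hlim : Tendsto (fun x : ℝ => Real.exp (-(2 * z.im * x)) * √(Real.pi / z.im)) atTop (𝓝 0) := by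
      have : Tendsto (fun x : ℝ => Real.exp (-(2 * z.im * x))) atTop (𝓝 0) :=
        Real.tendsto_exp_neg_atTop_nhds_zero.comp (tendsto_id.const_mul_atTop (by positivity))
      simpa using this.mul_const (√(Real.pi / z.im))
    filter_upwards [eventually_ge_atTop 0, hlim.eventually_le_const hε] with x hx hxε G g hG hg
    obtain ⟨-, h, -⟩ := (hG.bdd_mul (isHardyInfty_exp hx)).cauchy ((hasBoundaryValues_exp x).mul hg)
    have h1 := h z hz
    simp only [div_eq_inv_mul] at h1
    have h2 : 2 * Real.pi * Complex.I * (Complex.exp (2 * Complex.I * z * x) * G z) =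
        Complex.exp (2 * Complex.I * z * x) * (2 * Real.pi * Complex.I * G z) := by ring
    rw [h1, h2, norm_mul, norm_exp_two_I_mul]
    calc _ ≤ Real.exp (-(2 * z.im * x)) * (√(Real.pi / z.im) * √(∫ t, ‖g t‖ ^ 2)) := by
          gcongr; exact hG.norm_le hg hz
      _ ≤ ε * √(∫ t, ‖g t‖ ^ 2) := by rw [← mul_assoc]; gcongr

/-- The Cauchy kernels span a dense subspace of `L²(ℝ)`. -/
lemma dense_span_inv_sub : (Submodule.span ℂ (Set.range fun z : {z : ℂ // z.im ≠ 0} =>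
    (memLp_inv_ofReal_sub z.2).toLp)).topologicalClosure = ⊤ := by
  rw [Submodule.topologicalClosure_eq_top_iff, Submodule.eq_bot_iff]
  intro η hη
  rw [Submodule.mem_orthogonal] at hη
  have h0 : ∀ z : ℂ, z.im ≠ 0 → ∫ t : ℝ, η t / (t - z) = 0 := by
    intro z hz
    have hz' : (conj z).im ≠ 0 := by simpa using hz
    have h := hη _ (Submodule.subset_span ⟨⟨conj z, hz'⟩, rfl⟩)
    rw [ScatteringData.inner_eq_integral (ae_eq_refl _) (MemLp.coeFn_toLp _)] at h
    rw [← h]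
    congr 1; ext t
    simp [div_eq_inv_mul]
  -- η is orthogonal to all Cauchy kernels, so the zero function satisfies Cauchy's formula with
  -- boundary data η; by Fatou its boundary values are η, hence η = 0.
  have h1 : HasBoundaryValues (fun _ => 0) η := by
    refine hasBoundaryValues_of_cauchy (Lp.memLp η) (fun z hz => ?_) fun z hz => h0 z hz.ne
    rw [h0 z (ne_of_gt hz), mul_zero]
  have h2 : HasBoundaryValues (fun _ => 0) (fun _ => 0) :=
    Eventually.of_forall fun _ => tendsto_const_nhds
  exact (Lp.eq_zero_iff_ae_eq_zero).2 (h1.ae_eq h2)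

/-- The functionals `g ↦ ∫ χ e^{2itx} g` on `H²` tend to zero in norm. -/
theorem eventually_norm_integral_mul_exp_le {χ : ℝ → ℂ} (hχ : MemLp χ 2) {ε : ℝ} (hε : 0 < ε) :
    ∀ᶠ x : ℝ in atTop, ∀ G g, IsHardyTwo G → HasBoundaryValues G g →
      ‖∫ t : ℝ, χ t * (Complex.exp (2 * Complex.I * t * x) * g t)‖ ≤ ε * √(∫ t, ‖g t‖ ^ 2) := by
  have hspan : ∀ ξ ∈ Submodule.span ℂ (Set.range fun z : {z : ℂ // z.im ≠ 0} =>
      (memLp_inv_ofReal_sub z.2).toLp), ∀ ε : ℝ, 0 < ε → ∀ᶠ x : ℝ in atTop,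
      ∀ G g, IsHardyTwo G → HasBoundaryValues G g →
      ‖∫ t : ℝ, ξ t * (Complex.exp (2 * Complex.I * t * x) * g t)‖ ≤ ε * √(∫ t, ‖g t‖ ^ 2) := by
    intro ξ hξ
    induction hξ using Submodule.span_induction with
    | mem ξ hξ =>
      intro ε hε
      obtain ⟨z, rfl⟩ := hξ
      filter_upwards [eventually_norm_integral_inv_sub_mul_exp_le z.2 hε] with x hx G g hG hg
      refine le_of_eq_of_le ?_ (hx G g hG hg)
      congr 1
      refine integral_congr_ae ?_
      filter_upwards [(memLp_inv_ofReal_sub z.2).coeFn_toLp] with t ht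
      rw [ht]
    | zero =>
      refine fun ε hε => Eventually.of_forall fun x G g _ _ => ?_
      rw [integral_eq_zero_of_ae, norm_zero]
      · positivity
      · filter_upwards [Lp.coeFn_zero ℂ 2 (volume : Measure ℝ)] with t ht
        rw [ht]; simp
    | add ξ θ _ _ h1 h2 =>
      intro ε hε
      filter_upwards [h1 (ε / 2) (half_pos hε), h2 (ε / 2) (half_pos hε)] with x hx1 hx2 G g hG hg
      have hgm := (hG.cauchy hg).1.exp_mul x
      have e : ∫ t : ℝ, (ξ + θ) t * (Complex.exp (2 * Complex.I * t * x) * g t) =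
          (∫ t : ℝ, ξ t * (Complex.exp (2 * Complex.I * t * x) * g t)) +
          ∫ t : ℝ, θ t * (Complex.exp (2 * Complex.I * t * x) * g t) := by
        rw [← integral_add ((Lp.memLp ξ).integrable_fun_mul hgm) ((Lp.memLp θ).integrable_fun_mul hgm)]
        refine integral_congr_ae ?_
        filter_upwards [Lp.coeFn_add ξ θ] with t ht
        rw [ht, Pi.add_apply, add_mul]
      rw [e]
      refine (norm_add_le _ _).trans ((add_le_add (hx1 G g hG hg) (hx2 G g hG hg)).trans_eq ?_)
      ring
    | smul a ξ _ h1 =>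
      intro ε hε
      have ha : 0 < ‖a‖ + 1 := by positivity
      filter_upwards [h1 (ε / (‖a‖ + 1)) (div_pos hε ha)] with x hx G g hG hg
      have e : ∫ t : ℝ, (a • ξ) t * (Complex.exp (2 * Complex.I * t * x) * g t) =
          a * ∫ t : ℝ, ξ t * (Complex.exp (2 * Complex.I * t * x) * g t) := by
        rw [← integral_const_mul]
        refine integral_congr_ae ?_
        filter_upwards [Lp.coeFn_smul a ξ] with t ht
        rw [ht, Pi.smul_apply, smul_eq_mul, mul_assoc]
      rw [e, norm_mul]
      calc _ ≤ (‖a‖ + 1) * (ε / (‖a‖ + 1) * √(∫ t, ‖g t‖ ^ 2)) := by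
            gcongr
            · linarith
            · exact hx G g hG hg
        _ = _ := by field_simp
  have hmem : hχ.toLp ∈ (Submodule.span ℂ (Set.range fun z : {z : ℂ // z.im ≠ 0} =>
      (memLp_inv_ofReal_sub z.2).toLp)).topologicalClosure := by
    rw [dense_span_inv_sub]; trivial
  rw [← SetLike.mem_coe, Submodule.topologicalClosure_coe, Metric.mem_closure_iff] at hmem
  -- The remainder χ − ξ is controlled by Cauchy–Schwarz uniformly in x, since the exponential is
  -- unimodular on the line.
  obtain ⟨ξ, hξ, hd⟩ := hmem (ε / 2) (half_pos hε)
  filter_upwards [hspan ξ hξ (ε / 2) (half_pos hε)] with x hx G g hG hg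
  have hgm := (hG.cauchy hg).1.exp_mul x
  have hχξ : MemLp (fun t => χ t - ξ t) 2 := hχ.sub (Lp.memLp ξ)
  have e : ∫ t : ℝ, χ t * (Complex.exp (2 * Complex.I * t * x) * g t) =
      (∫ t : ℝ, (χ t - ξ t) * (Complex.exp (2 * Complex.I * t * x) * g t)) +
      ∫ t : ℝ, ξ t * (Complex.exp (2 * Complex.I * t * x) * g t) := by
    rw [← integral_add (hχξ.integrable_fun_mul hgm) ((Lp.memLp ξ).integrable_fun_mul hgm)]
    congr 1; ext t
    ring
  have hn : ∫ t, ‖χ t - ξ t‖ ^ 2 = ‖hχ.toLp - ξ‖ ^ 2 := by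
    refine integral_norm_sq_eq hχξ ?_
    filter_upwards [Lp.coeFn_sub hχ.toLp ξ, hχ.coeFn_toLp] with t h1 h2
    rw [h1, Pi.sub_apply, h2]
  have h1 := norm_integral_mul_le hχξ hgm
  simp only [norm_mul, norm_exp_two_I_ofReal_mul, one_mul] at h1
  rw [hn, Real.sqrt_sq (norm_nonneg _), ← dist_eq_norm] at h1
  rw [e]
  calc _ ≤ ε / 2 * √(∫ t, ‖g t‖ ^ 2) + ε / 2 * √(∫ t, ‖g t‖ ^ 2) := by
        refine (norm_add_le _ _).trans (add_le_add (h1.trans ?_) (hx G g hG hg))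
        gcongr
    _ = _ := by ring

/-! ### Bounded analytic approximations of 1/s_e. -/

namespace ScatteringData

variable {Λ : Set ℂ}

lemma aemeasurable_logModulus (D : ScatteringData Λ) : AEMeasurable D.logModulus := by
  have := D.aemeasurable_s
  unfold logModulus
  exact (Real.measurable_log.comp_aemeasurable ((this.norm.pow_const 2).const_sub 1)).const_mul _

/-- There are bounded analytic functions `b` for which `s_e b` is contractive and close to `1` at a
given point. -/
theorem exists_approx_inv_outer (D : ScatteringData Λ) {z₀ : ℂ} (hz₀ : 0 < z₀.im) {δ : ℝ}
    (hδ : 0 < δ) : ∃ (b : ℂ → ℂ) (ω : ℝ → ℂ) (C : ℝ), IsHardyInfty b ∧ HasBoundaryValues b ω ∧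
      AEMeasurable ω ∧ (∀ᵐ t, ‖ω t‖ ≤ C) ∧ (∀ᵐ t, ‖D.outerBoundary t * ω t‖ ≤ 1) ∧
      ‖D.outer z₀ * b z₀ - 1‖ < δ := by
  -- b is the outer function with log-modulus −log|s_e| truncated at n: bounded, with |s_e b| ≤ 1 on
  -- the line, and converging to 1/s_e at z₀ by dominated convergence.
  set p : ℕ → ℝ → ℝ := fun n t => min (-D.logModulus t) n with hp
  have hu := D.integrable_logModulus
  have hbound : ∀ n, ∀ᵐ t, |p n t| ≤ |D.logModulus t| := by
    intro n
    filter_upwards [D.logModulus_nonpos] with t ht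
    have h0 : 0 ≤ p n t := le_min (by linarith) n.cast_nonneg
    rw [abs_of_nonneg h0, abs_of_nonpos ht]
    exact min_le_left _ _
  have hpm : ∀ n, AEMeasurable (p n) := fun n => D.aemeasurable_logModulus.neg.min aemeasurable_const
  have hpi : ∀ n, Integrable fun t : ℝ => (1 + t ^ 2)⁻¹ • p n t := by
    intro n
    have hm : AEMeasurable fun t : ℝ => (1 + t ^ 2)⁻¹ • p n t :=
      (show Measurable fun t : ℝ => (1 + t ^ 2)⁻¹ by fun_prop).aemeasurable.smul (hpm n)
    refine hu.mono hm.aestronglyMeasurable ?_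
    filter_upwards [hbound n] with t ht
    rw [norm_smul, norm_smul]
    gcongr
    exact ht
  have hz : z₀ ∈ upperHalf := hz₀
  have hprod : schwarzOuter D.logModulus z₀ * schwarzOuter (fun t => -D.logModulus t) z₀ = 1 := by
    rw [← schwarzOuter_add hu (hu.neg.congr (Eventually.of_forall fun t => by simp)) hz]
    simp [schwarzOuter]
  have hlim : Tendsto (fun n => schwarzOuter (p n) z₀) atTop
      (𝓝 (schwarzOuter (fun t => -D.logModulus t) z₀)) := by
    unfold schwarzOuter
    refine (Complex.continuous_exp.tendsto _).comp (Tendsto.const_mul _ ?_)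
    refine tendsto_integral_of_dominated_convergence _ (fun n => (integrable_schwarz (hpi n)
      hz₀.ne').aestronglyMeasurable) (integrable_schwarz hu hz₀.ne').norm (fun n => ?_) ?_
    · filter_upwards [hbound n] with t ht
      rw [norm_mul, norm_mul]
      gcongr
      simpa using ht
    · refine Eventually.of_forall fun t => Tendsto.const_mul _ (tendsto_const_nhds.congr' ?_)
      filter_upwards [eventually_ge_atTop ⌈-D.logModulus t⌉₊] with n hn
      rw [hp]
      simp only
      rw [min_eq_left (Nat.ceil_le.1 hn)]
  have hlim2 := hlim.const_mul (D.outer z₀)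
  rw [outer_eq, hprod] at hlim2
  obtain ⟨n, hn⟩ := (hlim2.eventually (Metric.ball_mem_nhds 1 hδ)).exists
  have hc : ∀ᵐ t, p n t ≤ n := Eventually.of_forall fun t => min_le_right _ _
  obtain ⟨hd, hb⟩ := isHardyInfty_schwarzOuter (hpi n) hc
  obtain ⟨ω, hωm, hω, hωn⟩ := exists_hasBoundaryValues_schwarzOuter (hpi n) hc
  refine ⟨schwarzOuter (p n), ω, Real.exp n, ⟨hd, _, hb⟩, hω, hωm, ?_, ?_, ?_⟩
  · filter_upwards [hωn] with t ht
    rw [ht]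
    exact Real.exp_le_exp.2 (min_le_right _ _)
  · filter_upwards [hωn, D.outer_facts.2.2] with t h1 h2
    rw [norm_mul, h1, h2, ← Real.exp_add, Real.exp_le_one_iff]
    have : p n t ≤ -D.logModulus t := min_le_left _ _
    linarith
  · rw [← dist_eq_norm]
    exact hn

/-- If `s_e b` is contractive and close to `1` at `z₀`, then it is close to `1` on the real line with
respect to the Poisson kernel at `z₀`. -/
lemma integral_norm_outer_mul_sub_one_le (D : ScatteringData Λ) {z₀ : ℂ} (hz₀ : 0 < z₀.im) {δ : ℝ}
    {b : ℂ → ℂ} {ω : ℝ → ℂ} (hb : IsHardyInfty b) (hω : HasBoundaryValues b ω)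
    (h1 : ∀ᵐ t, ‖D.outerBoundary t * ω t‖ ≤ 1) (hδ : ‖D.outer z₀ * b z₀ - 1‖ ≤ δ) :
    ∫ t : ℝ, ‖(D.outerBoundary t * ω t - 1) * ((t : ℂ) - z₀)⁻¹‖ ^ 2 ≤ 2 * (Real.pi / z₀.im) * δ := by
  have hc : (conj z₀).im < 0 := by simpa using hz₀
  -- Cauchy's formula at z₀ for s_e b/(z − conj z₀) says that the average of s_e ω against |t −
  -- z₀|^{-2} is (π / Im z₀) s_e b(z₀).
  have hG : IsHardyTwo fun z => D.outer z * b z * (z - conj z₀)⁻¹ :=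
    (isHardyTwo_inv_sub hc).bdd_mul (D.isHardyInfty_outer.mul hb)
  have hbv : HasBoundaryValues (fun z => D.outer z * b z * (z - conj z₀)⁻¹)
      fun t => D.outerBoundary t * ω t * ((t : ℂ) - conj z₀)⁻¹ := by
    refine (D.hasBoundaryValues_outer.mul hω).mul
      (hasBoundaryValues_of_continuousAt (F := fun z => (z - conj z₀)⁻¹) fun t => ?_)
    exact ContinuousAt.inv₀ (by fun_prop) (ofReal_sub_ne_zero t hc.ne)
  obtain ⟨hm, hcauchy, -⟩ := hG.cauchy hbv
  have hcz := hcauchy z₀ hz₀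
  have hint := integrable_div_of_memLp hm hz₀.ne'
  have hker : ∀ t : ℝ, ((t : ℂ) - conj z₀)⁻¹ * ((t : ℂ) - z₀)⁻¹ =
      ((‖((t : ℂ) - z₀)⁻¹‖ ^ 2 : ℝ) : ℂ) := by
    intro t
    have : ((t : ℂ) - conj z₀)⁻¹ = conj (((t : ℂ) - z₀)⁻¹) := by simp
    rw [this, Complex.conj_mul']; push_cast; rfl
  have hfun : ∀ t : ℝ, D.outerBoundary t * ω t * ((t : ℂ) - conj z₀)⁻¹ / (t - z₀) =
      ((‖((t : ℂ) - z₀)⁻¹‖ ^ 2 : ℝ) : ℂ) * (D.outerBoundary t * ω t) := by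
    intro t
    rw [← hker]; ring
  simp_rw [hfun] at hcz hint
  have hP := (memLp_inv_ofReal_sub hz₀.ne').integrable_norm_sq
  have hval : (∫ t : ℝ, ‖((t : ℂ) - z₀)⁻¹‖ ^ 2 * (D.outerBoundary t * ω t).re) =
      Real.pi / z₀.im * (D.outer z₀ * b z₀).re := by
    have h2 := integral_re hint
    simp only [RCLike.re_to_complex, Complex.re_ofReal_mul] at h2
    rw [h2, hcz, two_I_im]
    have h3 : 2 * Real.pi * Complex.I * (D.outer z₀ * b z₀ * (2 * Complex.I * z₀.im)⁻¹) =
        ((Real.pi / z₀.im : ℝ) : ℂ) * (D.outer z₀ * b z₀) := by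
      have : (z₀.im : ℂ) ≠ 0 := by exact_mod_cast hz₀.ne'
      push_cast
      field_simp
    rw [h3, Complex.re_ofReal_mul]
  have hre : Integrable fun t : ℝ => ‖((t : ℂ) - z₀)⁻¹‖ ^ 2 * (D.outerBoundary t * ω t).re := by
    have := hint.re
    simpa only [RCLike.re_to_complex, Complex.re_ofReal_mul] using this
  have hpt : ∀ᵐ t : ℝ, ‖(D.outerBoundary t * ω t - 1) * ((t : ℂ) - z₀)⁻¹‖ ^ 2 ≤
      2 * (‖((t : ℂ) - z₀)⁻¹‖ ^ 2 - ‖((t : ℂ) - z₀)⁻¹‖ ^ 2 * (D.outerBoundary t * ω t).re) := by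
    filter_upwards [h1] with t ht
    set v := D.outerBoundary t * ω t
    -- For |v| ≤ 1 the distance to 1 is controlled linearly by Re v, so closeness of the average to
    -- 1 gives closeness in mean square.
    have h4 : ‖v - 1‖ ^ 2 ≤ 2 * (1 - v.re) := by
      have h5 : ‖v‖ ^ 2 ≤ 1 := pow_le_one₀ (norm_nonneg _) ht
      rw [← Complex.normSq_eq_norm_sq, Complex.normSq_apply] at h5 ⊢
      simp only [Complex.sub_re, Complex.sub_im, Complex.one_re, Complex.one_im]
      linarith
    rw [norm_mul, mul_pow]
    have h6 := mul_le_mul_of_nonneg_right h4 (sq_nonneg ‖((t : ℂ) - z₀)⁻¹‖)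
    linarith
  have h7 : ∫ t : ℝ, 2 * (‖((t : ℂ) - z₀)⁻¹‖ ^ 2 -
      ‖((t : ℂ) - z₀)⁻¹‖ ^ 2 * (D.outerBoundary t * ω t).re) =
      2 * (Real.pi / z₀.im) * (1 - (D.outer z₀ * b z₀).re) := by
    rw [integral_const_mul, integral_sub hP hre, hval, integral_norm_inv_ofReal_sub_sq hz₀.ne',
      abs_of_pos hz₀]
    ring
  have h8 : 1 - (D.outer z₀ * b z₀).re ≤ δ := by
    have := (Complex.abs_re_le_norm (D.outer z₀ * b z₀ - 1)).trans hδ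
    rw [Complex.sub_re, Complex.one_re] at this
    linarith [neg_abs_le ((D.outer z₀ * b z₀).re - 1)]
  refine (integral_mono_of_nonneg (Eventually.of_forall fun t => by positivity)
    ((hP.sub hre).const_mul 2) hpt).trans ?_
  refine (le_of_eq h7).trans ?_
  have := Real.pi_pos
  gcongr

end ScatteringData
-- Twisted data: norms and scalar products.
namespace ScatteringData

variable {Λ : Set ℂ} {D : ScatteringData Λ} {f h : ℝ ⊕ Λ → ℂ} {F : ℂ → ℂ} {η θ τ : Ambient Λ}

lemma norm_twist_s (D : ScatteringData Λ) (x t : ℝ) : ‖(D.twist x).s t‖ = ‖D.s t‖ := by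
  change ‖D.s t * Complex.exp (2 * Complex.I * t * x)‖ = _
  rw [norm_mul, norm_exp_two_I_ofReal_mul, mul_one]

lemma logModulus_twist (D : ScatteringData Λ) (x : ℝ) :
    (D.twist x).logModulus = D.logModulus := by
  ext t; simp only [logModulus, norm_twist_s]

lemma outer_twist (D : ScatteringData Λ) (x : ℝ) : (D.twist x).outer = D.outer := by
  rw [outer_eq, outer_eq, logModulus_twist]

lemma outerBoundary_twist (D : ScatteringData Λ) (x : ℝ) :
    (D.twist x).outerBoundary = D.outerBoundary := by
  rw [outerBoundary, outerBoundary, outer_twist]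

/-- Diagonal terms keep their modulus, while in the cross term the phases at t and −t combine into
e^{2itx}; on Λ the exponential has squared modulus e^{−2x Im w}. These are exactly the changes made
by the twist. -/
lemma norm_expMul (D : ScatteringData Λ) (x : ℝ) (f : ℝ ⊕ Λ → ℂ) :
    D.norm (expMul x f) = (D.twist x).norm f := by
  have h1 : ∀ t, D.form (expMul x f) (expMul x f) t = (D.twist x).form f f t := by
    intro t
    have e1 : Complex.exp (Complex.I * (-t : ℝ) * x) = conj (Complex.exp (Complex.I * t * x)) := by
      rw [← Complex.exp_conj]; simp
    have e2 : conj (Complex.exp (Complex.I * t * x)) * Complex.exp (Complex.I * t * x) = 1 := by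
      rw [← e1, ← Complex.exp_add, ← Complex.exp_zero]
      congr 1; push_cast; ring
    have e3 : (D.twist x).s t =
        D.s t * (Complex.exp (Complex.I * t * x) * Complex.exp (Complex.I * t * x)) := by
      rw [← Complex.exp_add]
      change D.s t * Complex.exp (2 * Complex.I * t * x) = _
      congr 2; ring
    simp only [form, dotProduct, Fin.sum_univ_two, Pi.star_apply, Matrix.cons_val_zero,
      Matrix.cons_val_one, RCLike.star_def, map_mul, map_neg, Matrix.cons_val_fin_one,
      Matrix.mulVec, Matrix.of_apply, expMul, toPoint, Sum.elim_inl, e1, e3, Complex.conj_conj]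
    linear_combination (conj (f (Sum.inl t)) * f (Sum.inl t) +
      conj (f (Sum.inl (-t))) * f (Sum.inl (-t))) * e2
  have h2 : ∀ w : Λ, ‖expMul x f (Sum.inr w)‖ ^ 2 * D.ν w =
      ‖f (Sum.inr w)‖ ^ 2 * (D.twist x).ν w := by
    intro w
    change ‖Complex.exp (Complex.I * w * x) * f (Sum.inr w)‖ ^ 2 * D.ν w =
      ‖f (Sum.inr w)‖ ^ 2 * (D.ν w * Real.exp (-2 * (w : ℂ).im * x))
    have e : ‖Complex.exp (Complex.I * w * x)‖ ^ 2 = Real.exp (-2 * (w : ℂ).im * x) := by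
      rw [Complex.norm_exp, ← Real.exp_nat_mul]
      congr 1
      simp [Complex.mul_re, Complex.mul_im]
      ring
    rw [norm_mul, mul_pow, e]
    ring
  simp only [ScatteringData.norm, normSq, h1, h2]

lemma expMul_sub (x : ℝ) (f h : ℝ ⊕ Λ → ℂ) : expMul x f - expMul x h = expMul x (f - h) := by
  ext p
  simp [expMul, mul_sub]

/-- The scalar product with a function that is square-integrable on the real line. -/
theorem Represents.inner_eq_of_memLp (hf : D.Represents f η)
    (hh : MemLp (fun t => h (Sum.inl t)) 2) :
    D.inner f h = (∑' w : Λ, f (Sum.inr w) * conj (h (Sum.inr w)) * (D.ν w : ℂ)) -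
      1 / (2 * Real.pi) * ∫ t : ℝ, conj (h (Sum.inl (-t))) *
        (D.s t * f (Sum.inl t) - f (Sum.inl (-t))) := by
  set q : ℝ → ℂ := fun t => conj (h (Sum.inl (-t))) *
    (D.s t * f (Sum.inl t) - f (Sum.inl (-t))) with hq
  have hqi : Integrable q := hh.comp_neg_real.star.integrable_fun_mul hf.memLp_mid
  -- By the symmetry of s₊ the two rows of the form are reflections of each other. Each is
  -- integrable because h and s₊f − f(−·) are in L², even when f is not.
  have hform : ∀ᵐ t, D.form f h t = -(q t + q (-t)) := by
    filter_upwards [ae_comp_neg D.symm_s] with t ht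
    rw [neg_neg] at ht
    simp only [hq, neg_neg, ht, form, dotProduct, Fin.sum_univ_two, Pi.star_apply,
      Matrix.cons_val_zero, Matrix.cons_val_one, RCLike.star_def, map_neg,
      Matrix.cons_val_fin_one, Matrix.mulVec, Matrix.of_apply]
    ring
  rw [ScatteringData.inner, integral_congr_ae hform, integral_neg, integral_add hqi hqi.comp_neg,
    integral_neg_eq_self]
  have : (Real.pi : ℂ) ≠ 0 := by exact_mod_cast Real.pi_ne_zero
  field_simp
  ring

/-- Square-integrable functions on the real line, extended to `Λ` with finite support, belong to
`L²_{s₊,ν₊}`. -/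
theorem exists_represents_of_memLp (D : ScatteringData Λ) (hf : MemLp (fun t => f (Sum.inl t)) 2)
    (E : Finset Λ) (hE : ∀ w ∉ E, f (Sum.inr w) = 0) : ∃ η, D.Represents f η := by
  have l1 := (D.memLp_outer_mul hf).const_mul (normFactor : ℂ)
  have l2 : MemLp (fun t => (normFactor : ℂ) * (D.s t * f (Sum.inl t) - f (Sum.inl (-t)))) 2 :=
    ((D.memLp_s_mul hf).sub hf.comp_neg_real).const_mul _
  have l3 : Memℓp (fun w : Λ => (√(D.ν w) : ℂ) * f (Sum.inr w)) 2 := by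
    refine memℓp_gen (summable_of_ne_finset_zero (s := E) fun w hw => ?_)
    rw [hE w hw]; simp
  exact ⟨WithLp.toLp 2 (l1.toLp, WithLp.toLp 2 (l2.toLp, ⟨_, l3⟩)),
    ⟨l1.coeFn_toLp, l2.coeFn_toLp, fun w => rfl⟩⟩

/-- For f square-integrable on the line the x-independent part splits off; under a twist only the
masses and the integral containing s₊ change. -/
lemma Represents.norm_sq_eq_of_memLp (hη : D.Represents f η)
    (hf : MemLp (fun t => f (Sum.inl t)) 2) :
    ‖η‖ ^ 2 = (∑' w : Λ, ‖f (Sum.inr w)‖ ^ 2 * D.ν w) + 1 / (2 * Real.pi) *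
      ((∫ t, ‖f (Sum.inl t)‖ ^ 2) -
        (∫ t, D.s t * (f (Sum.inl t) * conj (f (Sum.inl (-t))))).re) := by
  have hin := hη.inner_eq hη
  rw [inner_self_eq_norm_sq_to_K, hη.inner_eq_of_memLp hf] at hin
  have hsum : ∑' w : Λ, f (Sum.inr w) * conj (f (Sum.inr w)) * (D.ν w : ℂ) =
      ((∑' w : Λ, ‖f (Sum.inr w)‖ ^ 2 * D.ν w : ℝ) : ℂ) := by
    rw [Complex.ofReal_tsum]
    congr 1; ext w
    rw [Complex.mul_conj']; push_cast; rfl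
  have hsplit : ∫ t : ℝ, conj (f (Sum.inl (-t))) * (D.s t * f (Sum.inl t) - f (Sum.inl (-t))) =
      (∫ t, D.s t * (f (Sum.inl t) * conj (f (Sum.inl (-t))))) -
        ((∫ t, ‖f (Sum.inl t)‖ ^ 2 : ℝ) : ℂ) := by
    have i1 : Integrable fun t => D.s t * f (Sum.inl t) * conj (f (Sum.inl (-t))) :=
      (D.memLp_s_mul hf).integrable_fun_mul hf.comp_neg_real.star
    have i2 : Integrable fun t => conj (f (Sum.inl (-t))) * f (Sum.inl (-t)) :=
      hf.comp_neg_real.star.integrable_fun_mul hf.comp_neg_real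
    have e1 : ∫ t, conj (f (Sum.inl (-t))) * f (Sum.inl (-t)) =
        ((∫ t, ‖f (Sum.inl t)‖ ^ 2 : ℝ) : ℂ) := by
      rw [integral_neg_eq_self fun t => conj (f (Sum.inl t)) * f (Sum.inl t),
        ← integral_complex_ofReal]
      congr 1; ext t
      rw [Complex.conj_mul']; push_cast; rfl
    rw [← e1]
    simp_rw [← mul_assoc]
    rw [← integral_sub i1 i2]
    congr 1; ext t; ring
  rw [hsum, hsplit] at hin
  have hre := congrArg Complex.re hin
  have hc : (1 / (2 * Real.pi) : ℂ) = ((1 / (2 * Real.pi) : ℝ) : ℂ) := by push_cast; rfl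
  rw [hc, Complex.sub_re, Complex.ofReal_re, Complex.re_ofReal_mul, Complex.sub_re,
    Complex.ofReal_re] at hre
  have h2 : (((‖η‖ : ℝ) : ℂ) ^ 2).re = ‖η‖ ^ 2 := by
    rw [← Complex.ofReal_pow, Complex.ofReal_re]
  have h3 := hre.trans h2
  linarith

/-- Since |s₊| ≤ 1, Cauchy–Schwarz bounds the cross term by the main one. The bound does not involve
the data, so for twisted data it is uniform in x. -/
lemma Represents.norm_sq_le_of_memLp (hη : D.Represents f η)
    (hf : MemLp (fun t => f (Sum.inl t)) 2) (h0 : ∀ w, f (Sum.inr w) = 0) :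
    ‖η‖ ^ 2 ≤ 1 / Real.pi * ∫ t, ‖f (Sum.inl t)‖ ^ 2 := by
  have hpi := Real.pi_pos
  have h1 := norm_integral_mul_le (D.memLp_s_mul hf) hf.comp_neg_real.star
  have h2 : ∫ t, ‖D.s t * f (Sum.inl t)‖ ^ 2 ≤ ∫ t, ‖f (Sum.inl t)‖ ^ 2 := by
    refine integral_mono_ae (D.memLp_s_mul hf).integrable_norm_sq hf.integrable_norm_sq ?_
    filter_upwards [D.norm_s_le_one] with t ht
    rw [norm_mul, mul_pow]
    exact mul_le_of_le_one_left (by positivity) (pow_le_one₀ (norm_nonneg _) ht)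
  have h3 : ∫ t, ‖star (fun t => f (Sum.inl (-t))) t‖ ^ 2 = ∫ t, ‖f (Sum.inl t)‖ ^ 2 := by
    simp only [Pi.star_apply, norm_star]
    exact integral_neg_eq_self (fun t => ‖f (Sum.inl t)‖ ^ 2) volume
  rw [h3] at h1
  have h4 : ‖∫ t, D.s t * (f (Sum.inl t) * conj (f (Sum.inl (-t))))‖ ≤
      ∫ t, ‖f (Sum.inl t)‖ ^ 2 := by
    simp_rw [← mul_assoc]
    refine h1.trans ((mul_le_mul_of_nonneg_right (Real.sqrt_le_sqrt h2) (Real.sqrt_nonneg _)).trans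
      ?_)
    rw [Real.mul_self_sqrt (integral_nonneg fun _ => by positivity)]
  have h5 := (neg_le_abs _).trans ((Complex.abs_re_le_norm _).trans h4)
  have h6 : ∑' w : Λ, ‖f (Sum.inr w)‖ ^ 2 * D.ν w = 0 := by simp [h0]
  rw [hη.norm_sq_eq_of_memLp hf, h6, zero_add]
  calc _ ≤ 1 / (2 * Real.pi) * (2 * ∫ t, ‖f (Sum.inl t)‖ ^ 2) := by
        gcongr
        linarith
    _ = _ := by field_simp

/-- Finitely many masses contribute, each with the decaying factor e^{−2x Im w}, and the cross term
vanishes in the limit by Riemann–Lebesgue. -/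
theorem tendsto_norm_sq_twist (D : ScatteringData Λ) (hf : MemLp (fun t => f (Sum.inl t)) 2)
    (E : Finset Λ) (hE : ∀ w ∉ E, f (Sum.inr w) = 0) {η : ℝ → Ambient Λ}
    (hη : ∀ x, (D.twist x).Represents f (η x)) :
    Tendsto (fun x => ‖η x‖ ^ 2) atTop (𝓝 (1 / (2 * Real.pi) * ∫ t, ‖f (Sum.inl t)‖ ^ 2)) := by
  have heq : ∀ x, ‖η x‖ ^ 2 = (∑ w ∈ E, ‖f (Sum.inr w)‖ ^ 2 *
      (D.ν w * Real.exp (-(2 * (w : ℂ).im * x)))) + 1 / (2 * Real.pi) *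
      ((∫ t, ‖f (Sum.inl t)‖ ^ 2) - (∫ t : ℝ, Complex.exp (2 * Complex.I * t * x) *
        (D.s t * (f (Sum.inl t) * conj (f (Sum.inl (-t)))))).re) := by
    intro x
    rw [(hη x).norm_sq_eq_of_memLp hf, tsum_eq_sum (s := E) fun w hw => by rw [hE w hw]; simp]
    congr 3
    · ext w
      change _ * (D.ν w * Real.exp (-2 * (w : ℂ).im * x)) = _
      congr 3; ring
    · congr 2; ext t
      change D.s t * Complex.exp (2 * Complex.I * t * x) * _ = _
      ring
  simp_rw [heq]
  have h1 : Tendsto (fun x : ℝ => ∑ w ∈ E, ‖f (Sum.inr w)‖ ^ 2 *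
      (D.ν w * Real.exp (-(2 * (w : ℂ).im * x)))) atTop (𝓝 0) := by
    suffices h : Tendsto (fun x : ℝ => ∑ w ∈ E, ‖f (Sum.inr w)‖ ^ 2 *
        (D.ν w * Real.exp (-(2 * (w : ℂ).im * x)))) atTop (𝓝 (∑ w ∈ E, (0 : ℝ))) by
      simpa using h
    refine tendsto_finsetSum _ fun w _ => ?_
    have hw := D.im_pos w w.2
    have : Tendsto (fun x : ℝ => Real.exp (-(2 * (w : ℂ).im * x))) atTop (𝓝 0) :=
      Real.tendsto_exp_neg_atTop_nhds_zero.comp (tendsto_id.const_mul_atTop (by positivity))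
    simpa using (this.const_mul (D.ν w)).const_mul (‖f (Sum.inr w)‖ ^ 2)
  have h2 := (Complex.continuous_re.tendsto _).comp
    (tendsto_integral_exp_mul fun t => D.s t * (f (Sum.inl t) * conj (f (Sum.inl (-t)))))
  have h3 := h1.add ((h2.const_sub (∫ t, ‖f (Sum.inl t)‖ ^ 2)).const_mul (1 / (2 * Real.pi)))
  simpa using h3

lemma Represents.integral_norm_outer_mul_sq_le (hf : D.Represents f η) :
    ∫ t, ‖D.outerBoundary t * f (Sum.inl t)‖ ^ 2 ≤ 4 * Real.pi * ‖η‖ ^ 2 := by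
  have h1 := integral_norm_sq_eq (hf.memLp_fst.const_mul (normFactor : ℂ)) hf.fst
  have hpi := Real.pi_pos
  simp only [norm_mul, mul_pow, Complex.norm_real, Real.norm_of_nonneg normFactor_pos.le,
    normFactor_sq] at h1
  rw [integral_const_mul] at h1
  have h2 : ‖η.fst‖ ^ 2 ≤ ‖η‖ ^ 2 := by
    rw [WithLp.prod_norm_sq_eq_of_L2]
    exact le_add_of_nonneg_right (by positivity)
  simp only [norm_mul, mul_pow]
  rw [← h1, one_div, inv_mul_le_iff₀ (by positivity)] at h2
  exact h2

lemma Represents.sqrt_integral_le (hf : D.Represents f η) :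
    √(∫ t, ‖D.outerBoundary t * f (Sum.inl t)‖ ^ 2) ≤ √(4 * Real.pi) * ‖η‖ := by
  have := Real.sqrt_le_sqrt hf.integral_norm_outer_mul_sq_le
  rwa [Real.sqrt_mul' _ (by positivity), Real.sqrt_sq (norm_nonneg _)] at this

lemma IsContinuation.hasBoundaryValues (hF : D.IsContinuation f F) :
    HasBoundaryValues (fun z => D.outer z * F z) fun t => D.outerBoundary t * f (Sum.inl t) :=
  D.hasBoundaryValues_outer.mul hF.2.2

/-- The values of the analytic continuation are bounded by the norm. -/
lemma Represents.norm_continuation_le (hf : D.Represents f η) (hF : D.IsContinuation f F) {z : ℂ}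
    (hz : 0 < z.im) :
    ‖F z‖ ≤ (2 * Real.pi * ‖D.outer z‖)⁻¹ * (√(Real.pi / z.im) * √(4 * Real.pi)) * ‖η‖ := by
  have h1 := hF.2.1.norm_le hF.hasBoundaryValues hz
  have hpi := Real.pi_pos
  have ho := norm_pos_iff.2 (D.outer_ne_zero z)
  have h2 : ‖2 * Real.pi * Complex.I * (D.outer z * F z)‖ = 2 * Real.pi * ‖D.outer z‖ * ‖F z‖ := by
    simp only [norm_mul, Complex.norm_I, Complex.norm_real, Complex.norm_ofNat,
      Real.norm_of_nonneg hpi.le]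
    ring
  rw [h2] at h1
  rw [mul_assoc, le_inv_mul_iff₀ (by positivity), mul_assoc (√_)]
  exact h1.trans (mul_le_mul_of_nonneg_left hf.sqrt_integral_le (Real.sqrt_nonneg _))

/-- The analytic continuation is unique. -/
lemma IsContinuation.eq {F' : ℂ → ℂ} (hF : D.IsContinuation f F) (hF' : D.IsContinuation f F')
    {z : ℂ} (hz : 0 < z.im) : F z = F' z := by
  have h := (hF.cauchy.1 z hz).symm.trans (hF'.cauchy.1 z hz)
  exact mul_left_cancel₀ (D.outer_ne_zero z) (mul_left_cancel₀ two_pi_I_ne_zero h)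

lemma memLp_kTilde {z₀ : ℂ} (hz₀ : 0 < z₀.im) : MemLp (fun t => kTilde Λ z₀ (Sum.inl t)) 2 := by
  have hc : (conj z₀).im ≠ 0 := by simpa using hz₀.ne'
  exact (memLp_inv_ofReal_sub hc).const_mul Complex.I

lemma integral_norm_kTilde_sq {z₀ : ℂ} (hz₀ : 0 < z₀.im) :
    ∫ t, ‖kTilde Λ z₀ (Sum.inl t)‖ ^ 2 = Real.pi / z₀.im := by
  have hc : (conj z₀).im ≠ 0 := by simpa using hz₀.ne'
  have h := integral_norm_inv_ofReal_sub_sq hc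
  rw [Complex.conj_im, abs_neg, abs_of_pos hz₀] at h
  rw [← h]
  congr 1; ext t
  simp [kTilde]

end ScatteringData
-- The modified kernel conj(s_e ω) k̃ and asymptotic reproduction.
namespace ScatteringData

variable {Λ : Set ℂ} {D : ScatteringData Λ} {f h : ℝ ⊕ Λ → ℂ} {F : ℂ → ℂ} {η θ τ : Ambient Λ}

/-- The function `conj (s_e ω) k̃` on the real line, extended by zero to `Λ`. -/
def cutKernel (D : ScatteringData Λ) (z₀ : ℂ) (ω : ℝ → ℂ) : ℝ ⊕ Λ → ℂ :=
  Sum.elim (fun t => conj (D.outerBoundary t * ω t) * kTilde Λ z₀ (Sum.inl t)) fun _ => 0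

section CutKernel

variable {z₀ : ℂ} {b : ℂ → ℂ} {ω : ℝ → ℂ}

lemma memLp_cutKernel (D : ScatteringData Λ) (hz₀ : 0 < z₀.im) (hωm : AEMeasurable ω)
    (h1 : ∀ᵐ t, ‖D.outerBoundary t * ω t‖ ≤ 1) :
    MemLp (fun t => D.cutKernel z₀ ω (Sum.inl t)) 2 :=
  (memLp_kTilde hz₀).bdd_mul_of_ae (Complex.continuous_conj.measurable.comp_aemeasurable
    (D.aemeasurable_outerBoundary.mul hωm)) (C := 1) (by
      filter_upwards [h1] with t ht
      rwa [RCLike.norm_conj])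

/-- Conjugation moves the pole of k̃ to z₀ and puts s_e ω next to f, so this is Cauchy's formula for
b s_e F ∈ H². -/
lemma integral_conj_cutKernel_mul (hF : D.IsContinuation f F) (hz₀ : 0 < z₀.im)
    (hb : IsHardyInfty b) (hω : HasBoundaryValues b ω) :
    ∫ t, conj (D.cutKernel z₀ ω (Sum.inl t)) * f (Sum.inl t) =
      2 * Real.pi * (D.outer z₀ * b z₀ * F z₀) := by
  obtain ⟨-, h, -⟩ := (hF.2.1.bdd_mul hb).cauchy (hω.mul hF.hasBoundaryValues)
  have h1 : ∀ t : ℝ, conj (D.cutKernel z₀ ω (Sum.inl t)) * f (Sum.inl t) =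
      -Complex.I * (ω t * (D.outerBoundary t * f (Sum.inl t)) / (t - z₀)) := by
    intro t
    simp only [cutKernel, kTilde, Sum.elim_inl, map_mul, map_div₀, map_sub, Complex.conj_conj,
      Complex.conj_I, Complex.conj_ofReal]
    ring
  simp_rw [h1]
  rw [integral_const_mul, h z₀ hz₀]
  linear_combination (-2 * Real.pi * (D.outer z₀ * b z₀ * F z₀)) * Complex.I_sq

/-- The multiplier of `s_e f` in the oscillating part of the scalar product with `cutKernel`. -/
def cutMultiplier (D : ScatteringData Λ) (z₀ : ℂ) (ω : ℝ → ℂ) (t : ℝ) : ℂ :=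
  D.s t * (D.outerBoundary (-t) / D.outerBoundary t) * ω (-t) * conj (kTilde Λ z₀ (Sum.inl (-t)))

lemma memLp_cutMultiplier (D : ScatteringData Λ) (hz₀ : 0 < z₀.im) (hωm : AEMeasurable ω) {C : ℝ}
    (hC : ∀ᵐ t, ‖ω t‖ ≤ C) : MemLp (D.cutMultiplier z₀ ω) 2 := by
  refine (memLp_kTilde hz₀).comp_neg_real.star.bdd_mul_of_ae (g := fun t =>
    D.s t * (D.outerBoundary (-t) / D.outerBoundary t) * ω (-t)) (C := C) ?_ ?_
  · exact (D.aemeasurable_s.mul (D.aemeasurable_outerBoundary.comp_neg_real.div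
      D.aemeasurable_outerBoundary)).mul hωm.comp_neg_real
  · filter_upwards [D.norm_s_le_one, D.norm_outerBoundary_neg, D.outerBoundary_ne_zero,
      ae_comp_neg hC] with t h1 h2 h3 h4
    rw [norm_mul, norm_mul, norm_div, h2, div_self (norm_ne_zero_iff.2 h3), mul_one]
    calc _ ≤ 1 * ‖ω (-t)‖ := by gcongr
      _ ≤ C := by rwa [one_mul]

/-- The term without s₊ is a Cauchy integral. In the oscillating term f is written as (s_e f)/s_e;
the factor s_e(−t) from the modified kernel compensates the division because |s_e| is even, which
keeps the multiplier in L². -/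
lemma Represents.inner_cutKernel {x : ℝ} (hf : (D.twist x).Represents f η)
    (hF : (D.twist x).IsContinuation f F) (hθ : (D.twist x).Represents (D.cutKernel z₀ ω) θ)
    (hz₀ : 0 < z₀.im) (hb : IsHardyInfty b) (hω : HasBoundaryValues b ω) (hωm : AEMeasurable ω)
    {C : ℝ} (hC : ∀ᵐ t, ‖ω t‖ ≤ C) (h1 : ∀ᵐ t, ‖D.outerBoundary t * ω t‖ ≤ 1) :
    Inner.inner ℂ θ η = D.outer z₀ * b z₀ * F z₀ - 1 / (2 * Real.pi) *
      ∫ t : ℝ, D.cutMultiplier z₀ ω t * (Complex.exp (2 * Complex.I * t * x) *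
        (D.outerBoundary t * f (Sum.inl t))) := by
  have hσ : MemLp (fun t => D.outerBoundary t * f (Sum.inl t)) 2 := by
    have := hf.memLp_fst
    rwa [outerBoundary_twist] at this
  have hA : ∫ t, conj (D.cutKernel z₀ ω (Sum.inl t)) * f (Sum.inl t) =
      2 * Real.pi * (D.outer z₀ * b z₀ * F z₀) := by
    have := integral_conj_cutKernel_mul (ω := ω) hF hz₀ hb hω
    rwa [outer_twist, cutKernel, outerBoundary_twist] at this
  have hAi : Integrable fun t => conj (D.cutKernel z₀ ω (Sum.inl t)) * f (Sum.inl t) := by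
    have hm : MemLp (fun t => ω t * (D.outerBoundary t * f (Sum.inl t))) 2 :=
      hσ.bdd_mul_of_ae hωm hC
    refine ((memLp_kTilde (Λ := Λ) hz₀).star.integrable_fun_mul hm).congr
      (Eventually.of_forall fun t => ?_)
    simp only [cutKernel, Sum.elim_inl, map_mul, Complex.conj_conj, Pi.star_apply, RCLike.star_def]
    ring
  have hAi' := hAi.comp_neg
  have hBi := (D.memLp_cutMultiplier hz₀ hωm hC).integrable_fun_mul (hσ.exp_mul x)
  rw [← hf.inner_eq hθ, hf.inner_eq_of_memLp (D.memLp_cutKernel hz₀ hωm h1)]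
  have hsum : ∑' w : Λ, f (Sum.inr w) * conj (D.cutKernel z₀ ω (Sum.inr w)) *
      ((D.twist x).ν w : ℂ) = 0 := by
    simp [cutKernel]
  have hsplit : ∫ t : ℝ, conj (D.cutKernel z₀ ω (Sum.inl (-t))) *
      ((D.twist x).s t * f (Sum.inl t) - f (Sum.inl (-t))) =
      (∫ t : ℝ, D.cutMultiplier z₀ ω t * (Complex.exp (2 * Complex.I * t * x) *
        (D.outerBoundary t * f (Sum.inl t)))) -
      ∫ t, conj (D.cutKernel z₀ ω (Sum.inl t)) * f (Sum.inl t) := by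
    rw [← integral_neg_eq_self fun t => conj (D.cutKernel z₀ ω (Sum.inl t)) * f (Sum.inl t),
      ← integral_sub hBi hAi']
    refine integral_congr_ae ?_
    filter_upwards [D.outerBoundary_ne_zero] with t ht
    change _ * (D.s t * Complex.exp (2 * Complex.I * t * x) * f (Sum.inl t) - _) = _
    simp only [cutKernel, cutMultiplier, Sum.elim_inl, map_mul, Complex.conj_conj]
    field_simp
  rw [hsum, hsplit, hA]
  generalize (∫ t : ℝ, D.cutMultiplier z₀ ω t * (Complex.exp (2 * Complex.I * t * x) *
    (D.outerBoundary t * f (Sum.inl t)))) = J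
  have : (Real.pi : ℂ) ≠ 0 := by exact_mod_cast Real.pi_ne_zero
  field_simp
  ring

/-- Both functions vanish on Λ, and on the line their difference is (1 − conj(s_e ω)) k̃, small in
L² by the mean-square estimate; the bound does not depend on x. -/
lemma Represents.norm_sub_cutKernel_sq_le {x : ℝ} (hτ : (D.twist x).Represents (kTilde Λ z₀) τ)
    (hθ : (D.twist x).Represents (D.cutKernel z₀ ω) θ) (hz₀ : 0 < z₀.im) (hb : IsHardyInfty b)
    (hω : HasBoundaryValues b ω) (hωm : AEMeasurable ω)
    (h1 : ∀ᵐ t, ‖D.outerBoundary t * ω t‖ ≤ 1) {δ : ℝ} (hδ : ‖D.outer z₀ * b z₀ - 1‖ ≤ δ) :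
    ‖τ - θ‖ ^ 2 ≤ 2 * δ / z₀.im := by
  have hpi := Real.pi_pos
  have hm := D.memLp_cutKernel hz₀ hωm h1
  refine ((hτ.sub hθ).norm_sq_le_of_memLp ((memLp_kTilde hz₀).sub hm)
    fun w => by simp [cutKernel, kTilde]).trans ?_
  have h2 : ∀ t : ℝ, ‖(kTilde Λ z₀ - D.cutKernel z₀ ω) (Sum.inl t)‖ =
      ‖(D.outerBoundary t * ω t - 1) * ((t : ℂ) - z₀)⁻¹‖ := by
    intro t
    have h3 : (kTilde Λ z₀ - D.cutKernel z₀ ω) (Sum.inl t) =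
        -Complex.I * conj ((D.outerBoundary t * ω t - 1) * ((t : ℂ) - z₀)⁻¹) := by
      simp only [Pi.sub_apply, cutKernel, kTilde, Sum.elim_inl, map_mul, map_sub, map_one,
        Complex.conj_ofReal, map_inv₀]
      ring
    rw [h3, norm_mul, norm_neg, Complex.norm_I, one_mul, RCLike.norm_conj]
  simp_rw [h2]
  calc _ ≤ 1 / Real.pi * (2 * (Real.pi / z₀.im) * δ) := by
        gcongr
        exact D.integral_norm_outer_mul_sub_one_le hz₀ hb hω h1 hδ
    _ = _ := by field_simp

end CutKernel

/-- Asymptotically, `k̃` reproduces the values at `z₀`. -/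
theorem eventually_norm_inner_kTilde_sub_le (D : ScatteringData Λ) {z₀ : ℂ} (hz₀ : 0 < z₀.im)
    {ε : ℝ} (hε : 0 < ε) : ∀ᶠ x : ℝ in atTop, ∀ f η F τ, (D.twist x).Represents f η →
      (D.twist x).IsContinuation f F → (D.twist x).Represents (kTilde Λ z₀) τ →
      ‖Inner.inner ℂ τ η - F z₀‖ ≤ ε * ‖η‖ := by
  have hpi := Real.pi_pos
  set C₁ := (2 * Real.pi * ‖D.outer z₀‖)⁻¹ * (√(Real.pi / z₀.im) * √(4 * Real.pi)) with hC₁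
  have hC₁0 : 0 ≤ C₁ := by positivity
  -- The first bound makes 2δ / Im z₀ ≤ (ε/3)² for replacing k̃ by the modified kernel; the second
  -- makes δ|F(z₀)| ≤ (ε/3)‖η‖, where C₁ bounds point evaluation. The oscillating term takes the
  -- last third.
  set δ := min (ε ^ 2 * z₀.im / 18) (ε / (3 * (C₁ + 1))) with hδdef
  have hδ : 0 < δ := lt_min (by positivity) (by positivity)
  obtain ⟨b, ω, C, hb, hω, hωm, hC, h1, hbδ⟩ := D.exists_approx_inv_outer hz₀ hδ
  filter_upwards [eventually_norm_integral_mul_exp_le (D.memLp_cutMultiplier hz₀ hωm hC)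
    (ε := ε / 3) (by positivity)] with x hx f η F τ hf hF hτ
  obtain ⟨θ, hθ⟩ := (D.twist x).exists_represents_of_memLp
    (D.memLp_cutKernel hz₀ hωm h1) ∅ fun w _ => rfl
  have e1 : Inner.inner ℂ τ η - F z₀ = Inner.inner ℂ (τ - θ) η + (D.outer z₀ * b z₀ - 1) * F z₀ -
      1 / (2 * Real.pi) * ∫ t : ℝ, D.cutMultiplier z₀ ω t * (Complex.exp (2 * Complex.I * t * x) *
        (D.outerBoundary t * f (Sum.inl t))) := by
    rw [inner_sub_left, hf.inner_cutKernel hF hθ hz₀ hb hω hωm hC h1]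
    ring
  have b1 : ‖Inner.inner ℂ (τ - θ) η‖ ≤ ε / 3 * ‖η‖ := by
    refine (norm_inner_le_norm _ _).trans (mul_le_mul_of_nonneg_right ?_ (norm_nonneg _))
    refine (sq_le_sq₀ (norm_nonneg _) (by positivity)).1 ?_
    refine (hτ.norm_sub_cutKernel_sq_le hθ hz₀ hb hω hωm h1 hbδ.le).trans ?_
    rw [div_le_iff₀ hz₀]
    have : δ ≤ ε ^ 2 * z₀.im / 18 := min_le_left _ _
    linarith
  have b2 : ‖(D.outer z₀ * b z₀ - 1) * F z₀‖ ≤ ε / 3 * ‖η‖ := by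
    have hv := hf.norm_continuation_le hF hz₀
    rw [outer_twist, ← hC₁] at hv
    rw [norm_mul]
    calc _ ≤ ε / (3 * (C₁ + 1)) * ((C₁ + 1) * ‖η‖) := by
          gcongr
          · exact hbδ.le.trans (min_le_right _ _)
          · exact hv.trans (by gcongr; linarith)
      _ = _ := by field_simp
  have b3 : ‖1 / (2 * Real.pi) * ∫ t : ℝ, D.cutMultiplier z₀ ω t *
      (Complex.exp (2 * Complex.I * t * x) * (D.outerBoundary t * f (Sum.inl t)))‖ ≤
      ε / 3 * ‖η‖ := by
    have hbv := hF.hasBoundaryValues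
    have hsq := hf.sqrt_integral_le
    rw [outerBoundary_twist] at hbv hsq
    have hn : ‖(1 / (2 * Real.pi) : ℂ)‖ = 1 / (2 * Real.pi) := by
      have : (1 / (2 * Real.pi) : ℂ) = ((1 / (2 * Real.pi) : ℝ) : ℂ) := by push_cast; rfl
      rw [this, Complex.norm_real, Real.norm_of_nonneg (by positivity)]
    have h4 : √(4 * Real.pi) ≤ 4 := by
      rw [Real.sqrt_le_left (by norm_num)]
      linarith [Real.pi_le_four]
    rw [norm_mul, hn]
    calc _ ≤ 1 / (2 * Real.pi) * (ε / 3 * (√(4 * Real.pi) * ‖η‖)) := by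
          gcongr
          exact (hx _ _ hF.2.1 hbv).trans (by gcongr)
      _ ≤ 1 / (2 * Real.pi) * (ε / 3 * (2 * Real.pi * ‖η‖)) := by
          gcongr
          linarith [Real.pi_gt_three]
      _ = _ := by field_simp
  rw [e1]
  refine (norm_sub_le _ _).trans ((add_le_add ((norm_add_le _ _).trans (add_le_add b1 b2))
    b3).trans_eq ?_)
  ring

/-! ### The lower bound on the diagonal and convergence of the kernels. -/

/-- The generator `B' k̃`. -/
lemma exists_test_generator (D : ScatteringData Λ) {z₀ : ℂ} (hz₀ : 0 < z₀.im) (E : Finset Λ) :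
    ∃ f ∈ generators Λ, MemLp (fun t => f (Sum.inl t)) 2 ∧ (∀ w ∉ E, f (Sum.inr w) = 0) ∧
      (∫ t, ‖f (Sum.inl t)‖ ^ 2 ≤ Real.pi / z₀.im) ∧ ∀ (D' : ScatteringData Λ) (F : ℂ → ℂ),
      D'.IsContinuation f F → F z₀ = blaschkeProd Λ E z₀ * (1 / (2 * z₀.im)) := by
  have hc : (conj z₀).im < 0 := by simpa using hz₀
  set g : ℂ → ℂ := fun z => Complex.I * (z - conj z₀)⁻¹ with hg
  have hg1 : IsHardyInfty g := (isHardyInfty_const _).mul (isHardyInfty_inv_sub hc)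
  have hg2 : IsHardyTwo g := (isHardyTwo_inv_sub hc).bdd_mul (isHardyInfty_const _)
  have hgb : HasBoundaryValues g fun t => kTilde Λ z₀ (Sum.inl t) :=
    hasBoundaryValues_of_continuousAt (F := g) fun t =>
      continuousAt_const.mul (ContinuousAt.inv₀ (by fun_prop) (ofReal_sub_ne_zero t hc.ne))
  obtain ⟨β, hβ⟩ := (D.isHardyInfty_blaschkeProd E).exists_hasBoundaryValues
  have hβ1 : ∀ᵐ t, ‖β t‖ ≤ 1 := by
    filter_upwards [hβ] with t ht
    refine le_of_tendsto ht.norm ?_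
    filter_upwards [self_mem_nhdsWithin] with y hy
    exact D.norm_blaschkeProd_le_one E (add_mul_I_mem_upperHalf t hy)
  have hm : MemLp (fun t => β t * kTilde Λ z₀ (Sum.inl t)) 2 :=
    (memLp_kTilde hz₀).bdd_mul_of_ae (hβ.aemeasurable (D.differentiableOn_blaschkeProd E)) hβ1
  refine ⟨Sum.elim (fun t => β t * kTilde Λ z₀ (Sum.inl t)) fun w => blaschkeProd Λ E w * g w,
    ⟨E, g, hg1, hg2, hβ.mul hgb, fun w => rfl⟩, hm, fun w hw => ?_, ?_, fun D' F hF => ?_⟩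
  · simp [blaschkeProd_eq_zero hw]
  · rw [← integral_norm_kTilde_sq (Λ := Λ) hz₀]
    refine integral_mono_ae hm.integrable_norm_sq (memLp_kTilde hz₀).integrable_norm_sq ?_
    filter_upwards [hβ1] with t ht
    simp only [Sum.elim_inl]
    rw [norm_mul, mul_pow]
    exact mul_le_of_le_one_left (by positivity) (pow_le_one₀ (norm_nonneg _) ht)
  · have hF' : D'.IsContinuation (Sum.elim (fun t => β t * kTilde Λ z₀ (Sum.inl t))
        fun w : Λ => blaschkeProd Λ E w * g w) fun z => blaschkeProd Λ E z * g z :=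
      ⟨(D.differentiableOn_blaschkeProd E).mul hg2.1,
        (hg2.bdd_mul (D.isHardyInfty_blaschkeProd E)).bdd_mul D'.isHardyInfty_outer, hβ.mul hgb⟩
    rw [hF.eq hF' hz₀, hg]
    simp only
    rw [two_I_im]
    have : (z₀.im : ℂ) ≠ 0 := by exact_mod_cast hz₀.ne'
    field_simp

section Asymptotics

variable {z₀ : ℂ} {M : ℝ → Set (ℝ ⊕ Λ → ℂ)} {k : ℝ → ℝ ⊕ Λ → ℂ} {κ : ℝ → Ambient Λ}

/-- The lower bound for the values of the reproducing kernels on the diagonal. -/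
lemma eventually_le_norm_sq_kernel (D : ScatteringData Λ) (hz₀ : 0 < z₀.im)
    (hM : ∀ x, ∀ f ∈ generators Λ, f ∈ (D.twist x).L2 → f ∈ M x)
    (hk : ∀ x, (D.twist x).IsReproducingKernel (M x) z₀ (k x))
    (hκ : ∀ x, (D.twist x).Represents (k x) (κ x)) {ε : ℝ} (hε : 0 < ε) :
    ∀ᶠ x : ℝ in atTop, 1 / (2 * z₀.im) - ε ≤ ‖κ x‖ ^ 2 := by
  have hpi := Real.pi_pos
  set K := 1 / (2 * z₀.im) with hK
  have hK0 : 0 < K := by positivity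
  have hlim := ((D.tendsto_blaschkeProd hz₀).norm).pow 2
  rw [norm_one, one_pow] at hlim
  have hlt : 1 - ε / (2 * K) < 1 := sub_lt_self _ (by positivity)
  -- Removing enough zeros gives |B'(z₀)|² > 1 − ε/(2K), while ‖B'k̃‖² is eventually at most K +
  -- ε/2.
  obtain ⟨E, hE⟩ := (hlim.eventually (lt_mem_nhds hlt)).exists
  obtain ⟨f, hf, hfm, hfE, hfn, hfF⟩ := D.exists_test_generator hz₀ E
  choose η hη using fun x => (D.twist x).exists_represents_of_memLp hfm E hfE
  have hL : 1 / (2 * Real.pi) * ∫ t, ‖f (Sum.inl t)‖ ^ 2 < K + ε / 2 := by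
    calc _ ≤ 1 / (2 * Real.pi) * (Real.pi / z₀.im) := by gcongr
      _ = K := by rw [hK]; field_simp
      _ < _ := by linarith
  filter_upwards [(D.tendsto_norm_sq_twist hfm E hfE hη).eventually_le_const hL] with x hx
  obtain ⟨F, hF, hFk⟩ := (hk x).2 f (hM x f hf (hη x).mem_L2)
  rw [hfF _ F hF, (hη x).inner_eq (hκ x)] at hFk
  have h1 := norm_inner_le_norm (𝕜 := ℂ) (κ x) (η x)
  have hKn : ‖(1 / (2 * z₀.im) : ℂ)‖ = K := by
    have : (1 / (2 * z₀.im) : ℂ) = ((1 / (2 * z₀.im) : ℝ) : ℂ) := by push_cast; rfl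
    rw [this, Complex.norm_real, Real.norm_of_nonneg hK0.le]
  rw [← hFk, norm_mul, hKn] at h1
  have h2 := pow_le_pow_left₀ (by positivity) h1 2
  rw [mul_pow, mul_pow] at h2
  have h3 : ‖κ x‖ ^ 2 * ‖η x‖ ^ 2 ≤ ‖κ x‖ ^ 2 * (K + ε / 2) := by gcongr
  have h4 : (1 - ε / (2 * K)) * K ^ 2 ≤ ‖blaschkeProd Λ E z₀‖ ^ 2 * K ^ 2 := by gcongr
  have h5 : (1 - ε / (2 * K)) * K ^ 2 = K ^ 2 - ε * K / 2 := by field_simp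
  by_contra hcon
  push Not at hcon
  -- Otherwise K² − εK/2 ≤ ‖κ‖²(K + ε/2) < (K − ε)(K + ε/2) = K² − εK/2 − ε²/2.
  have h6 : ‖κ x‖ ^ 2 * (K + ε / 2) < (K - ε) * (K + ε / 2) := by gcongr
  nlinarith

/-- The reproducing kernels of the twisted data are asymptotically close to `k̃`. -/
theorem tendsto_norm_kernel_sub (D : ScatteringData Λ) (hz₀ : 0 < z₀.im)
    (hM : ∀ x, ∀ f ∈ generators Λ, f ∈ (D.twist x).L2 → f ∈ M x)
    (hML : ∀ x, M x ⊆ (D.twist x).L2)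
    (hk : ∀ x, (D.twist x).IsReproducingKernel (M x) z₀ (k x)) :
    Tendsto (fun x => D.norm (expMul x (k x) - expMul x (kTilde Λ z₀))) atTop (𝓝 0) := by
  choose κ hκ using fun x => exists_represents (hML x (hk x).1)
  choose τ hτ using fun x => (D.twist x).exists_represents_of_memLp
    (memLp_kTilde (Λ := Λ) hz₀) ∅ fun w _ => rfl
  have hnorm : ∀ x, D.norm (expMul x (k x) - expMul x (kTilde Λ z₀)) =
      ENNReal.ofReal ‖κ x - τ x‖ := fun x => by
    rw [expMul_sub, norm_expMul, ((hκ x).sub (hτ x)).norm_eq]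
  simp_rw [hnorm]
  rw [← ENNReal.ofReal_zero]
  refine (ENNReal.continuous_ofReal.tendsto 0).comp ?_
  have hpi := Real.pi_pos
  set K := 1 / (2 * z₀.im) with hK
  set C := (2 * Real.pi * ‖D.outer z₀‖)⁻¹ * (√(Real.pi / z₀.im) * √(4 * Real.pi)) with hC
  have hC0 : 0 ≤ C := by positivity
  choose F hF hFk using fun x => (hk x).2 (k x) (hk x).1
  have hdiag : ∀ x, F x z₀ = ((‖κ x‖ ^ 2 : ℝ) : ℂ) := fun x => by
    rw [hFk, (hκ x).inner_eq (hκ x), inner_self_eq_norm_sq_to_K]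
    push_cast; rfl
  -- ‖κ‖² is the value of the kernel at z₀, which is at most C‖κ‖; C does not depend on x because
  -- the twist leaves s_e unchanged.
  have hκC : ∀ x, ‖κ x‖ ≤ C := by
    intro x
    have h1 := (hκ x).norm_continuation_le (hF x) hz₀
    rw [outer_twist, ← hC, hdiag, Complex.norm_real, Real.norm_of_nonneg (by positivity), sq] at h1
    rcases (norm_nonneg (κ x)).eq_or_lt with h | h
    · rwa [← h]
    · exact le_of_mul_le_mul_right h1 h
  have hτlim := D.tendsto_norm_sq_twist (memLp_kTilde (Λ := Λ) hz₀) ∅ (fun w _ => rfl) hτ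
  have hKval : 1 / (2 * Real.pi) * ∫ t, ‖kTilde Λ z₀ (Sum.inl t)‖ ^ 2 = K := by
    rw [integral_norm_kTilde_sq hz₀, hK]
    field_simp
  rw [hKval] at hτlim
  suffices hsq : Tendsto (fun x => ‖κ x - τ x‖ ^ 2) atTop (𝓝 0) by
    have := (Real.continuous_sqrt.tendsto 0).comp hsq
    simpa [Function.comp_def, Real.sqrt_sq (norm_nonneg _)] using this
  rw [Metric.tendsto_nhds]
  intro ε hε
  -- Here ‖τ‖² ≤ K + ε/4, ‖κ‖² ≥ K − ε/4 and Re⟨τ, κ⟩ ≥ ‖κ‖² − ε/8, so ‖κ − τ‖² ≤ ‖τ‖² − ‖κ‖² + ε/4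
  -- ≤ 3ε/4.
  filter_upwards [hτlim.eventually_le_const (show K < K + ε / 4 by linarith),
    D.eventually_le_norm_sq_kernel hz₀ hM hk hκ (ε := ε / 4) (by positivity),
    D.eventually_norm_inner_kTilde_sub_le hz₀ (ε := ε / (8 * (C + 1))) (by positivity)]
    with x h1 h2 h3
  have h4 := h3 (k x) (κ x) (F x) (τ x) (hκ x) (hF x) (hτ x)
  have h5 : ε / (8 * (C + 1)) * ‖κ x‖ ≤ ε / 8 := by
    calc _ ≤ ε / (8 * (C + 1)) * (C + 1) := by
          gcongr
          linarith [hκC x]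
      _ = _ := by field_simp
  have h6 := ((neg_le_abs _).trans (Complex.abs_re_le_norm _)).trans (h4.trans h5)
  rw [hdiag, Complex.sub_re, Complex.ofReal_re] at h6
  have h7 := norm_sub_sq (𝕜 := ℂ) (κ x) (τ x)
  rw [inner_re_symm, RCLike.re_to_complex] at h7
  rw [Real.dist_0_eq_abs, abs_of_nonneg (by positivity), h7]
  linarith

end Asymptotics

lemma mem_H2_of_generator (D : ScatteringData Λ) (hf : f ∈ generators Λ) (hf2 : f ∈ D.L2) :
    f ∈ D.H2 := by
  refine ⟨hf2, fun ε hε => ⟨f, hf, hf2, ?_⟩⟩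
  rwa [sub_self, D.represents_zero.norm_eq, norm_zero, ENNReal.ofReal_zero]

end ScatteringData
end

theorem theorem1p3 {Λ : Set ℂ} (D : ScatteringData Λ) (z₀ : ℂ) (hz₀ : 0 < z₀.im) :
    (∀ x : ℝ, ∃ k, (D.twist x).IsReproducingKernel (D.twist x).H2 z₀ k) ∧
    (∀ x : ℝ, ∃ k, (D.twist x).IsReproducingKernel (D.twist x).H2hat z₀ k) ∧
    (∀ k : ℝ → (ℝ ⊕ Λ → ℂ),
      (∀ x, (D.twist x).IsReproducingKernel (D.twist x).H2 z₀ (k x)) →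
        Tendsto (fun x : ℝ => D.norm (expMul x (k x) - expMul x (kTilde Λ z₀))) atTop (𝓝 0)) ∧
    (∀ k : ℝ → (ℝ ⊕ Λ → ℂ),
      (∀ x, (D.twist x).IsReproducingKernel (D.twist x).H2hat z₀ (k x)) →
        Tendsto (fun x : ℝ => D.norm (expMul x (k x) - expMul x (kTilde Λ z₀))) atTop (𝓝 0)) := by
  exact ⟨fun x => (D.twist x).exists_kernel_H2 hz₀, fun x => (D.twist x).exists_kernel_H2hat hz₀,
    fun k hk => D.tendsto_norm_kernel_sub hz₀ (fun x _ hf hf2 => (D.twist x).mem_H2_of_generator hf hf2)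
      (fun x _ hf => hf.1) hk,
    fun k hk => D.tendsto_norm_kernel_sub hz₀
      (fun x _ hf hf2 => (D.twist x).mem_H2hat_of_generator hf hf2) (fun x _ hf => hf.1) hk⟩
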